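/- **Definitions.** Let $\Gamma$ be a group and $H\le\Gamma$ a subgroup of finite index. The pair $(\Gamma,H)$ satisfies *Moore's condition* if no element of prime order lies in $\Gamma\setminus H$. It satisfies *Moore's conjecture* if it satisfies Moore's condition and every $\mathbb{Z}\Gamma$-module that is projective over $\mathbb{Z}H$ is projective over $\mathbb{Z}\Gamma$. A group $G$ is *acyclic* if $H_n(G,\mathbb{Z})=0$ for all $n>0$. If $H$ is normal of prime index $p$ and $x$ generates $\Gamma/H$, the *Bockstein* $\beta_{(\Gamma,H)}\in H^2(\Gamma,\mathbb{Z})=\mathrm{Ext}^2_{\mathbb{Z}\Gamma}(\mathbb{Z},\mathbb{Z})$ is the class of the exact sequence of $\mathbb{Z}\Gamma$-modules $0\to\mathbb{Z}\to\mathbb{Z}[\Gamma/H]\to\mathbb{Z}[\Gamma/H]\to\mathbb{Z}\to0$ with the maps $1\mapsto\sum_{i=0}^{p-1}x^i$, $1\mapsto 1-x$, and the augmentation; whether it is nilpotent in the cohomology ring $H^*(\Gamma,\mathbb{Z})$ does not depend on $x$. For a class of groups $\mathscr{X}$ let $\mathbf{H}_1\mathscr{X}$ be the class of groups $G$ that act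 cellularly on a contractible finite-dimensional CW-complex such that the setwise and pointwise stabilizers of each cell coincide and belong to $\mathscr{X}$. Put $\mathbf{H}_0\mathscr{X}=\mathscr{X}$, $\mathbf{H}_{\alpha+1}\mathscr{X}=\mathbf{H}_1(\mathbf{H}_\alpha\mathscr{X})$, $\mathbf{H}_\lambda\mathscr{X}=\bigcup_{\gamma<\lambda}\mathbf{H}_\gamma\mathscr{X}$ for limit ordinals $\lambda$, and $\mathbf{H}\mathscr{X}=\bigcup_\alpha\mathbf{H}_\alpha\mathscr{X}$. Let $\mathscr{F}$ be the class of finite groups, and let $\mathbf{LH}\mathscr{F}$ be the class of groups all of whose finitely generated subgroups are in $\mathbf{H}\mathscr{F}$. **Theorem.** For every group $\Gamma_0$ with a normal subgroup $H_0$ of prime index there exist a group $\Gamma$, a subgroup $H\le\Gamma$ and a homomorphism $\phi:\Gamma_0\to\Gamma$ such that: 1. $H$ is normal and of prime index in $\Gamma$; 2. $H$ is acyclic, and the Bockstein $\beta_{(\Gamma,H)}$ is not nilpotent; 3. $\phi$ is injective, $H_0=\phi^{-1}(H)$, and $\phi$ induces an isomorphism $\Gamma_0/H_0\cong\Gamma/H$;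 4. $(\Gamma,H)$ satisfies Moore's condition if and only if $(\Gamma_0,H_0)$ does; 5. $(\Gamma,H)$ satisfies Moore's conjecture if and only if $(\Gamma_0,H_0)$ does; 6. $\Gamma$ is in $\mathbf{LH}\mathscr{F}$ if and only if $\Gamma_0$ is in $\mathbf{LH}\mathscr{F}$. -/

import Mathlib

open scoped Pointwise
open CategoryTheory

universe u

/-! ### Classes of groups and Kropholler's hierarchy -/

/-- A class of groups (in the universe `u`). -/
abbrev GroupClass : Type (u + 1) := ∀ (G : Type u) [Group G], Prop

/-- The class of finite groups. -/
def finiteGroups : GroupClass.{u} := fun G _ => Finite G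

/-- The operator `H₁`: the group `G` acts cellularly on a contractible finite-dimensional CW complex
such that the setwise and the pointwise stabilizer of each cell coincide and lie in the class `𝔛`.
A cellular action is an action by homeomorphisms that permutes the open cells of each dimension. -/
def KrophollerStep (𝔛 : GroupClass.{u}) : GroupClass.{u} := fun G _ =>
  ∃ (X : Type u) (_ : TopologicalSpace X) (_ : T2Space X)
    (_ : Topology.CWComplex (Set.univ : Set X)) (_ : MulAction G X),
    ContractibleSpace X ∧
    Topology.CWComplex.FiniteDimensional (Set.univ : Set X) ∧
    (∀ g : G, Continuous fun x : X => g • x) ∧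
    (∀ (g : G) (n : ℕ) (e : Topology.CWComplex.cell (Set.univ : Set X) n),
      ∃ e' : Topology.CWComplex.cell (Set.univ : Set X) n,
        g • Topology.CWComplex.openCell (C := (Set.univ : Set X)) n e =
          Topology.CWComplex.openCell (C := (Set.univ : Set X)) n e') ∧
    ∀ (n : ℕ) (e : Topology.CWComplex.cell (Set.univ : Set X) n),
      MulAction.stabilizer G (Topology.CWComplex.openCell (C := (Set.univ : Set X)) n e) =
        fixingSubgroup G (Topology.CWComplex.openCell (C := (Set.univ : Set X)) n e) ∧
      𝔛 (MulAction.stabilizer G (Topology.CWComplex.openCell (C := (Set.univ : Set X)) n e))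

/-- The classes `H_α 𝔛`, by transfinite recursion: `H_0 𝔛 = 𝔛`, `H_(α+1) 𝔛 = H₁ (H_α 𝔛)`, and
`H_λ 𝔛` is the union of the `H_γ 𝔛`, `γ < λ`, for a limit ordinal `λ`. -/
noncomputable def KrophollerStage (𝔛 : GroupClass.{u}) (α : Ordinal.{u}) : GroupClass.{u} :=
  Ordinal.limitRecOn (motive := fun _ => GroupClass.{u}) α 𝔛
    (fun _ ih => KrophollerStep ih)
    (fun l _ ih => fun G _ => ∃ (γ : Ordinal.{u}) (hγ : γ < l), ih γ hγ G)

/-- The class `H 𝔛`, the union of the `H_α 𝔛` over all ordinals `α`. -/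
def KrophollerClass (𝔛 : GroupClass.{u}) : GroupClass.{u} := fun G _ =>
  ∃ α : Ordinal.{u}, KrophollerStage 𝔛 α G

/-- The class `L 𝔛` of the groups all of whose finitely generated subgroups are in `𝔛`. -/
def Locally (𝔛 : GroupClass.{u}) : GroupClass.{u} := fun G _ =>
  ∀ K : Subgroup G, K.FG → 𝔛 K

/-- The class `LHF`. -/
def LHF : GroupClass.{u} := Locally (KrophollerClass finiteGroups)

/-! ### Moore's condition and Moore's conjecture -/

/-- Moore's condition for the pair `(Γ, H)`: no element of prime order lies in `Γ - H`. -/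
def MooreCondition {Γ : Type u} [Group Γ] (H : Subgroup Γ) : Prop :=
  ∀ g : Γ, g ∉ H → ¬ (orderOf g).Prime

/-- The `ℤΓ`-module `M` is projective when it is regarded as a `ℤH`-module. -/
def ProjectiveOver {Γ : Type u} [Group Γ] (H : Subgroup Γ) (M : Type u) [AddCommGroup M]
    [Module (MonoidAlgebra ℤ Γ) M] : Prop :=
  letI : Module (MonoidAlgebra ℤ H) M :=
    Module.compHom M (MonoidAlgebra.mapDomainRingHom ℤ H.subtype)
  Module.Projective (MonoidAlgebra ℤ H) M

/-- Moore's conjecture holds for the pair `(Γ, H)`: Moore's condition holds, and every `ℤΓ`-module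
that is projective over `ℤH` is projective over `ℤΓ`. -/
def MooreConjecture {Γ : Type u} [Group Γ] (H : Subgroup Γ) : Prop :=
  MooreCondition H ∧
  ∀ (M : Type u) [AddCommGroup M] [Module (MonoidAlgebra ℤ Γ) M],
    ProjectiveOver H M → Module.Projective (MonoidAlgebra ℤ Γ) M

/-! ### Acyclic groups -/

/-- `G` is acyclic: `H_n(G, ℤ) = 0` for all `n > 0`. The copy `ULift ℤ` of `ℤ` in the universe of
`G` is used. -/
def AcyclicGroup (G : Type u) [Group G] : Prop :=
  ∀ n : ℕ, 0 < n →
    Subsingleton (groupHomology (Rep.trivial (ULift.{u} ℤ) G (ULift.{u} ℤ)) n)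

/-! ### The Bockstein -/

/-- The augmentation `ℤG → ℤ`. -/
noncomputable def augmentation (G : Type u) [Group G] : MonoidAlgebra ℤ G →+* ℤ :=
  (MonoidAlgebra.lift ℤ ℤ G (1 : G →* ℤ)).toRingHom

/-- The trivial `ℤΓ`-module `ℤ` (in the universe of `Γ`). -/
def TrivialModule (_Γ : Type u) : Type u := ULift.{u} ℤ

instance (Γ : Type u) : AddCommGroup (TrivialModule Γ) :=
  inferInstanceAs (AddCommGroup (ULift.{u} ℤ))

noncomputable instance (Γ : Type u) [Group Γ] : Module (MonoidAlgebra ℤ Γ) (TrivialModule Γ) :=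
  Module.compHom (ULift.{u} ℤ) (augmentation Γ)

/-- The `ℤΓ`-module `ℤ[Γ/H]`. -/
def QuotientModule {Γ : Type u} [Group Γ] (H : Subgroup Γ) : Type u := MonoidAlgebra ℤ (Γ ⧸ H)

section Bockstein

variable {Γ : Type u} [Group Γ] (H : Subgroup Γ) [H.Normal]

noncomputable instance : AddCommGroup (QuotientModule H) :=
  inferInstanceAs (AddCommGroup (MonoidAlgebra ℤ (Γ ⧸ H)))

noncomputable instance : Module (MonoidAlgebra ℤ Γ) (QuotientModule H) :=
  Module.compHom (MonoidAlgebra ℤ (Γ ⧸ H))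
    (MonoidAlgebra.mapDomainRingHom ℤ (QuotientGroup.mk' H))

theorem augmentation_single {G : Type u} [Group G] (g : G) (r : ℤ) :
    augmentation G (MonoidAlgebra.single g r) = r := by
  simp [augmentation]

theorem augmentation_map (a : MonoidAlgebra ℤ Γ) :
    augmentation (Γ ⧸ H) (MonoidAlgebra.mapDomainRingHom ℤ (QuotientGroup.mk' H) a) =
      augmentation Γ a := by
  induction a using MonoidAlgebra.induction_linear with
  | zero => simp
  | add x y hx hy => rw [map_add, map_add, map_add, hx, hy]
  | single m r => simp [augmentation_single]

/-- The augmentation `ℤ[Γ/H] → ℤ`, as a map of `ℤΓ`-modules. -/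
noncomputable def quotientAugmentation :
    QuotientModule H →ₗ[MonoidAlgebra ℤ Γ] TrivialModule Γ where
  toFun y := ULift.up (augmentation (Γ ⧸ H) y)
  map_add' y z := congrArg ULift.up (map_add (augmentation (Γ ⧸ H)) y z)
  map_smul' a y := congrArg ULift.up <|
    (map_mul (augmentation (Γ ⧸ H))
      (MonoidAlgebra.mapDomainRingHom ℤ (QuotientGroup.mk' H) a) y).trans
    (congrArg (· * augmentation (Γ ⧸ H) y) (augmentation_map H a))

/-- The map `ℤ[Γ/H] → ℤ[Γ/H]` of `ℤΓ`-modules with `1 ↦ 1 - x`. -/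
noncomputable def oneSubGenerator (x : Γ ⧸ H) :
    QuotientModule H →ₗ[MonoidAlgebra ℤ Γ] QuotientModule H where
  toFun y := (show MonoidAlgebra ℤ (Γ ⧸ H) from y) * (1 - MonoidAlgebra.single x 1)
  map_add' y z := add_mul (show MonoidAlgebra ℤ (Γ ⧸ H) from y) z _
  map_smul' a y := mul_assoc (MonoidAlgebra.mapDomainRingHom ℤ (QuotientGroup.mk' H) a)
    (show MonoidAlgebra ℤ (Γ ⧸ H) from y) _

end Bockstein

section CyclicGroupRing

variable {Q : Type u} [Group Q] (x : Q)

/-- The element `∑_{i < |Q|} x ^ i` of `ℤQ`. -/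
noncomputable def normElement : MonoidAlgebra ℤ Q :=
  ∑ i ∈ Finset.range (Nat.card Q), MonoidAlgebra.single (x ^ i) 1

theorem single_pow_one (i : ℕ) :
    (MonoidAlgebra.single x (1 : ℤ)) ^ i = MonoidAlgebra.single (x ^ i) 1 := by
  simp [MonoidAlgebra.single_pow]

theorem normElement_coeff [Finite Q] (hx : ∀ q : Q, q ∈ Subgroup.zpowers x)
    (q : Q) : (normElement x).coeff q = 1 := by
  classical
  have hcard : orderOf x = Nat.card Q := orderOf_eq_card_of_forall_mem_zpowers hx
  obtain ⟨k, hk, rfl⟩ : ∃ k < Nat.card Q, x ^ k = q := by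
    have h := (mem_powers_iff_mem_zpowers (x := x) (y := q)).2 (hx q)
    obtain ⟨k, rfl⟩ := h
    exact ⟨k % orderOf x, hcard ▸ Nat.mod_lt _ (orderOf_pos x), pow_mod_orderOf x k⟩
  rw [normElement, MonoidAlgebra.coeff_sum, Finsupp.finsetSum_apply,
    Finset.sum_eq_single k]
  · simp
  · intro i hi hik
    have : x ^ i ≠ x ^ k := fun h =>
      hik (pow_injOn_Iio_orderOf (by simpa [hcard] using hi) (by simpa [hcard] using hk) h)
    simp [MonoidAlgebra.coeff_single, this]
  · intro h
    exact absurd (Finset.mem_range.2 hk) h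

theorem mul_one_sub_eq_zero_iff [Finite Q] (hx : ∀ q : Q, q ∈ Subgroup.zpowers x)
    (y : MonoidAlgebra ℤ Q) :
    y * (1 - MonoidAlgebra.single x 1) = 0 ↔ ∃ n : ℤ, n • normElement x = y := by
  constructor
  · intro h
    have h1 : ∀ q, y.coeff (q * x⁻¹) = y.coeff q := by
      intro q
      have h2 : y = y * MonoidAlgebra.single x 1 := by
        rwa [mul_sub, mul_one, sub_eq_zero] at h
      conv_rhs => rw [h2]
      simp
    have h3 : ∀ k : ℕ, y.coeff (x ^ k) = y.coeff 1 := by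
      intro k
      induction k with
      | zero => simp
      | succ k ih => rw [← h1, pow_succ, mul_inv_cancel_right, ih]
    refine ⟨y.coeff 1, ?_⟩
    ext q
    obtain ⟨k, rfl⟩ := (mem_powers_iff_mem_zpowers (x := x) (y := q)).2 (hx q)
    simp only [MonoidAlgebra.coeff_smul, Finsupp.smul_apply, normElement_coeff x hx]
    simp [h3]
  · rintro ⟨n, rfl⟩
    have h : normElement x * (1 - MonoidAlgebra.single x 1) = 0 := by
      have hcard : orderOf x = Nat.card Q := orderOf_eq_card_of_forall_mem_zpowers hx
      have := geom_sum_mul_neg (MonoidAlgebra.single x (1 : ℤ)) (Nat.card Q)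
      simp only [single_pow_one] at this
      rw [normElement, this, ← hcard, pow_orderOf_eq_one, ← MonoidAlgebra.one_def, sub_self]
    rw [smul_mul_assoc, h, smul_zero]

theorem augmentation_eq_zero_iff [Finite Q] (hx : ∀ q : Q, q ∈ Subgroup.zpowers x)
    (y : MonoidAlgebra ℤ Q) :
    augmentation Q y = 0 ↔ ∃ z, z * (1 - MonoidAlgebra.single x 1) = y := by
  constructor
  · intro h
    have key : ∀ y : MonoidAlgebra ℤ Q, ∃ z,
        z * (1 - MonoidAlgebra.single x 1) = y - augmentation Q y • 1 := by
      intro y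
      induction y using MonoidAlgebra.induction_linear with
      | zero => exact ⟨0, by simp⟩
      | add a b ha hb =>
        obtain ⟨z, hz⟩ := ha
        obtain ⟨w, hw⟩ := hb
        refine ⟨z + w, ?_⟩
        rw [add_mul, hz, hw, map_add, add_smul]
        abel
      | single q r =>
        obtain ⟨k, rfl⟩ := (mem_powers_iff_mem_zpowers (x := x) (y := q)).2 (hx q)
        refine ⟨-(r • ∑ i ∈ Finset.range k, MonoidAlgebra.single x (1 : ℤ) ^ i), ?_⟩
        rw [neg_mul, smul_mul_assoc, geom_sum_mul_neg, augmentation_single, single_pow_one,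
          smul_sub, neg_sub, MonoidAlgebra.smul_single, smul_eq_mul, mul_one]
    obtain ⟨z, hz⟩ := key y
    exact ⟨z, by rw [hz, h, zero_smul, sub_zero]⟩
  · rintro ⟨z, rfl⟩
    rw [map_mul, map_sub, map_one, augmentation_single, sub_self, mul_zero]

theorem mul_normElement [Finite Q] (hx : ∀ q : Q, q ∈ Subgroup.zpowers x)
    (a : MonoidAlgebra ℤ Q) : a * normElement x = augmentation Q a • normElement x := by
  induction a using MonoidAlgebra.induction_linear with
  | zero => simp
  | add a b ha hb => rw [add_mul, ha, hb, map_add, add_smul]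
  | single q r =>
    ext p
    rw [MonoidAlgebra.coeff_single_mul_apply, augmentation_single, MonoidAlgebra.coeff_smul,
      Finsupp.smul_apply, normElement_coeff x hx, normElement_coeff x hx, smul_eq_mul]

end CyclicGroupRing

section Bockstein

variable {Γ : Type u} [Group Γ] (H : Subgroup Γ) [H.Normal]

/-- The map `ℤ → ℤ[Γ/H]` of `ℤΓ`-modules with `1 ↦ ∑ x ^ i`, where `x` generates the finite
group `Γ/H`. -/
noncomputable def normMap [Finite (Γ ⧸ H)] (x : Γ ⧸ H)
    (hx : ∀ q : Γ ⧸ H, q ∈ Subgroup.zpowers x) :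
    TrivialModule Γ →ₗ[MonoidAlgebra ℤ Γ] QuotientModule H where
  toFun n := (show ULift.{u} ℤ from n).down • normElement x
  map_add' m n := add_smul (show ULift.{u} ℤ from m).down (show ULift.{u} ℤ from n).down _
  map_smul' a n := by
    change (augmentation Γ a * (show ULift.{u} ℤ from n).down) • normElement x =
      MonoidAlgebra.mapDomainRingHom ℤ (QuotientGroup.mk' H) a *
        ((show ULift.{u} ℤ from n).down • normElement x)
    rw [mul_smul_comm, mul_normElement x hx, augmentation_map, mul_comm, mul_smul]

theorem oneSubGenerator_mem_ker (x : Γ ⧸ H) (y : QuotientModule H) :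
    oneSubGenerator H x y ∈ LinearMap.ker (quotientAugmentation H) := by
  have h : augmentation (Γ ⧸ H)
      ((show MonoidAlgebra ℤ (Γ ⧸ H) from y) * (1 - MonoidAlgebra.single x 1)) = 0 := by
    rw [map_mul, map_sub, map_one, augmentation_single, sub_self, mul_zero]
  exact LinearMap.mem_ker.2 (congrArg ULift.up h)

/-- The map `1 ↦ 1 - x` with its values in the kernel of the augmentation `ℤ[Γ/H] → ℤ`. -/
noncomputable def oneSubGeneratorToKer (x : Γ ⧸ H) :
    QuotientModule H →ₗ[MonoidAlgebra ℤ Γ] LinearMap.ker (quotientAugmentation H) :=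
  (oneSubGenerator H x).codRestrict _ (oneSubGenerator_mem_ker H x)

theorem quotientAugmentation_surjective : Function.Surjective (quotientAugmentation H) :=
  fun n => ⟨MonoidAlgebra.single 1 (show ULift.{u} ℤ from n).down,
    congrArg ULift.up (augmentation_single _ _)⟩

theorem normMap_injective [Finite (Γ ⧸ H)] (x : Γ ⧸ H)
    (hx : ∀ q : Γ ⧸ H, q ∈ Subgroup.zpowers x) : Function.Injective (normMap H x hx) := by
  intro m n h
  change (show ULift.{u} ℤ from m).down • normElement x =
    (show ULift.{u} ℤ from n).down • normElement x at h
  have h1 := congrArg (fun y : MonoidAlgebra ℤ (Γ ⧸ H) => y.coeff 1) h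
  simp only [MonoidAlgebra.coeff_smul, Finsupp.smul_apply, normElement_coeff x hx,
    smul_eq_mul, mul_one] at h1
  exact ULift.ext _ _ h1

theorem exact_normMap [Finite (Γ ⧸ H)] (x : Γ ⧸ H)
    (hx : ∀ q : Γ ⧸ H, q ∈ Subgroup.zpowers x) :
    Function.Exact (normMap H x hx) (oneSubGeneratorToKer H x) := by
  intro y
  rw [Subtype.ext_iff]
  refine (mul_one_sub_eq_zero_iff x hx y).trans ?_
  exact ⟨fun ⟨n, hn⟩ => ⟨ULift.up n, hn⟩, fun ⟨n, hn⟩ => ⟨(show ULift.{u} ℤ from n).down, hn⟩⟩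

theorem oneSubGeneratorToKer_surjective [Finite (Γ ⧸ H)] (x : Γ ⧸ H)
    (hx : ∀ q : Γ ⧸ H, q ∈ Subgroup.zpowers x) :
    Function.Surjective (oneSubGeneratorToKer H x) := by
  rintro ⟨y, hy⟩
  have hy' : augmentation (Γ ⧸ H) y = 0 := congrArg ULift.down (LinearMap.mem_ker.1 hy)
  obtain ⟨z, hz⟩ := (augmentation_eq_zero_iff x hx y).1 hy'
  exact ⟨z, Subtype.ext hz⟩

/-- The short exact sequence `0 → ℤ → ℤ[Γ/H] → I → 0`, where `I` is the kernel of the augmentation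
and the second map is induced by `1 ↦ 1 - x`. -/
theorem shortExact_normMap [Finite (Γ ⧸ H)] (x : Γ ⧸ H)
    (hx : ∀ q : Γ ⧸ H, q ∈ Subgroup.zpowers x) :
    (ModuleCat.shortComplexOfCompEqZero (normMap H x hx) (oneSubGeneratorToKer H x)
      (exact_normMap H x hx).linearMap_comp_eq_zero).ShortExact :=
  ModuleCat.shortComplex_shortExact _ (exact_normMap H x hx) (normMap_injective H x hx)
    (oneSubGeneratorToKer_surjective H x hx)

/-- The degree `n` part `H^n(Γ, ℤ) = Ext^n_{ℤΓ}(ℤ, ℤ)` of the cohomology ring, whose product is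
the Yoneda product. -/
abbrev IntegralCohomology (Γ : Type u) [Group Γ] (n : ℕ) : Type u :=
  Abelian.Ext (ModuleCat.of (MonoidAlgebra ℤ Γ) (TrivialModule Γ))
    (ModuleCat.of (MonoidAlgebra ℤ Γ) (TrivialModule Γ)) n

/-- The Bockstein `β ∈ H²(Γ, ℤ)` of the pair `(Γ, H)`, where `H` is normal and `x` generates the
finite group `Γ/H`: the class of the exact sequence `0 → ℤ → ℤ[Γ/H] → ℤ[Γ/H] → ℤ → 0` of
`ℤΓ`-modules with the maps `1 ↦ ∑ x ^ i`, `1 ↦ 1 - x` and the augmentation. It is the Yoneda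
product of the classes of `0 → I → ℤ[Γ/H] → ℤ → 0` and `0 → ℤ → ℤ[Γ/H] → I → 0`. -/
noncomputable def bockstein [Finite (Γ ⧸ H)] (x : Γ ⧸ H)
    (hx : ∀ q : Γ ⧸ H, q ∈ Subgroup.zpowers x) : IntegralCohomology Γ 2 :=
  (LinearMap.shortExact_shortComplexKer (quotientAugmentation_surjective H)).extClass.comp
    (shortExact_normMap H x hx).extClass rfl

/-- The powers `β ^ k ∈ H^(2k)(Γ, ℤ)` of a class `β ∈ H²(Γ, ℤ)` in the cohomology ring. -/
noncomputable def cohomologyPow {Γ : Type u} [Group Γ] (β : IntegralCohomology Γ 2) :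
    (k : ℕ) → IntegralCohomology Γ (2 * k)
  | 0 => Abelian.Ext.mk₀ (𝟙 _)
  | k + 1 => (cohomologyPow β k).comp β rfl

/-- The Bockstein of the pair `(Γ, H)`, for some choice of a generator `x` of `Γ/H`, is nilpotent.
(For another generator the Bockstein changes by a factor that is invertible modulo `[Γ : H]`, so
that nilpotency does not depend on the choice.) -/
def BocksteinNilpotent : Prop :=
  ∃ (_ : Finite (Γ ⧸ H)) (x : Γ ⧸ H) (hx : ∀ q : Γ ⧸ H, q ∈ Subgroup.zpowers x) (k : ℕ),
    cohomologyPow (bockstein H x hx) k = 0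

end Bockstein

/-! Put `Q = Γ₀/H₀`. The group `Γ` is the union of a tower of groups over `Q` that starts with `Γ₀ →
Q`. At each stage `f : G → Q`, the group `G` is amalgamated along `N = f.ker` with the overgroup
`Mitosis N`, and `f` is extended by the trivial map on this overgroup. In `Mitosis N` there are a
homomorphic image `φ(N)` that commutes with `N` and one element `g` that conjugates `k φ(k)` to
`φ(k)` for all `k`. Both lie in the kernel at the next stage, so the kernel `H` on the union is
binate (`isBinate_ker_union`).

Binate groups are acyclic (`WordComplex.exists_barBd_eq`). Let `z` be a cycle of degree `n`, and let
the homology vanish in the degrees strictly between `0` and `n`. By a Künneth argument the diagonal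
of `z` is `z ⊗ 1 + 1 ⊗ z` up to a boundary. Hence `k ↦ k φ(k)` carries the class of `z` to `z + φ
z`; since conjugation acts trivially on homology, it also carries it to `φ z`. So `z` is a boundary.

Vanishing homology gives vanishing integral cohomology of `H`, and an argument in the manner of
Shapiro's lemma gives `Ext^n(ℤ, ℤ[Γ/H]) = 0` for `n > 0` (`WordComplex.ext_quotientModule_eq_zero`).
Multiplication by either of the two extension classes whose product is the Bockstein is therefore
injective in positive degrees. A vanishing power would lead back to a splitting of the augmentation
`ℤ[Γ/H] → ℤ`, which does not exist (`not_bocksteinNilpotent_of_ext_eq_zero`).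

The other properties are carried up the tower by actions on trees: an amalgam acts on its Bass-Serre
tree, an ascending union on a tree of cosets. Stabilizers are, up to conjugation, contained in
earlier stages or in the kernel. Moore's condition: an element of prime order fixes a vertex
(`TreeAction.exists_smul_eq`). Moore's conjecture: if `M` is projective over `H`, so is the cokernel
`N` of `M → M ⊗ ℤ[G/H]`. The chains of the tree with coefficients in `N` form a projective
resolution of `N` of length one, and Schanuel's lemma makes `M` a summand of a projective module
(`TreeAction.liftsProjective`). `LHF`: the realization of a tree is a contractible complex of
dimension one, so `LHF` is closed under such actions (`LHF.of_tree`); it also passes from `N` to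
`Mitosis N` (`lhf_mitosis`). In the other direction everything restricts to subgroups; for Moore's
conjecture this uses induced modules (`LiftsProjective.comap`). -/

/-! ### The complex of words -/

namespace WordComplex

open TensorProduct

/-- The free module on the words in `X`. A word of length `n + 1` is an ordered simplex of
dimension `n`, the empty word is the augmentation. -/
def Words (R X : Type*) [CommRing R] : Type _ := List X →₀ R

variable {R : Type*} [CommRing R] {X Y Z : Type*}

noncomputable instance : AddCommGroup (Words R X) := inferInstanceAs (AddCommGroup (List X →₀ R))

noncomputable instance : Module R (Words R X) := inferInstanceAs (Module R (List X →₀ R))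

instance : Module.Free R (Words R X) := inferInstanceAs (Module.Free R (List X →₀ R))

/-- The basis element given by a word. -/
noncomputable def word (w : List X) : Words R X := (Finsupp.single w 1 : List X →₀ R)

/-- Two linear maps that agree on words are equal. -/
theorem hom_ext {A : Type*} [AddCommMonoid A] [Module R A] {f g : Words R X →ₗ[R] A}
    (h : ∀ w, f (word w) = g (word w)) : f = g :=
  Finsupp.lhom_ext' (M := R) (α := List X) fun w => LinearMap.ext_ring (h w)

theorem hom_eq {A : Type*} [AddCommMonoid A] [Module R A] {f g : Words R X →ₗ[R] A}
    (h : ∀ w, f (word w) = g (word w)) (c : Words R X) : f c = g c :=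
  LinearMap.congr_fun (hom_ext h) c

/-- The linear extension of a function on words. -/
noncomputable def ext {A : Type*} [AddCommMonoid A] [Module R A] (f : List X → A) :
    Words R X →ₗ[R] A :=
  Finsupp.linearCombination R f

@[simp] theorem ext_word {A : Type*} [AddCommMonoid A] [Module R A] (f : List X → A) (w : List X) :
    ext (R := R) f (word w) = f w :=
  (Finsupp.linearCombination_single R 1 w).trans (one_smul R _)

/-- The span of a set of words. -/
noncomputable def spanWords (R : Type*) [CommRing R] (s : Set (List X)) : Submodule R (Words R X) :=
  Submodule.span R (word '' s)

theorem word_mem {s : Set (List X)} {w : List X} (hw : w ∈ s) : word (R := R) w ∈ spanWords R s :=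
  Submodule.subset_span ⟨w, hw, rfl⟩

theorem spanWords_mono {s t : Set (List X)} (h : s ⊆ t) : spanWords R s ≤ spanWords R t :=
  Submodule.span_mono (Set.image_mono h)

/-- Two maps agree on a span of words if they agree on the words. -/
theorem eqOn_spanWords {A : Type*} [AddCommMonoid A] [Module R A] {f g : Words R X →ₗ[R] A}
    {s : Set (List X)} (h : ∀ w ∈ s, f (word w) = g (word w)) {c : Words R X}
    (hc : c ∈ spanWords R s) : f c = g c := by
  refine LinearMap.eqOn_span (f := f) (g := g) ?_ hc
  rintro _ ⟨w, hw, rfl⟩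
  exact h w hw

/-- A map carries a span of words to a submodule if it does so on the words. -/
theorem mem_of_spanWords {A : Type*} [AddCommMonoid A] [Module R A] {f : Words R X →ₗ[R] A}
    {s : Set (List X)} {N : Submodule R A} (h : ∀ w ∈ s, f (word w) ∈ N) {c : Words R X}
    (hc : c ∈ spanWords R s) : f c ∈ N := by
  have : spanWords R s ≤ N.comap f := by
    rw [spanWords, Submodule.span_le]
    rintro _ ⟨w, hw, rfl⟩
    exact h w hw
  exact this hc

/-- Put a letter in front of each word. -/
noncomputable def cone (x : X) : Words R X →ₗ[R] Words R X := ext fun w => word (x :: w)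

@[simp] theorem cone_word (x : X) (w : List X) : cone x (word (R := R) w) = word (x :: w) := by
  simp [cone]

/-- Apply a function to each letter. -/
noncomputable def map (f : X → Y) : Words R X →ₗ[R] Words R Y := ext fun w => word (w.map f)

@[simp] theorem map_word (f : X → Y) (w : List X) :
    map f (word (R := R) w) = word (w.map f) := by
  simp [map]

theorem map_cone (f : X → Y) (x : X) (c : Words R X) : map f (cone x c) = cone (f x) (map f c) :=
  hom_eq (f := map f ∘ₗ cone x) (g := cone (f x) ∘ₗ map f) (by simp) c

theorem map_map (g : Y → Z) (f : X → Y) (c : Words R X) : map g (map f c) = map (g ∘ f) c :=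
  hom_eq (f := map g ∘ₗ map f) (g := map (g ∘ f)) (by simp) c

theorem map_id (c : Words R X) : map id c = c :=
  hom_eq (f := map id) (g := LinearMap.id) (by simp) c

/-- The boundary of a word. -/
noncomputable def bdWord : List X → Words R X
  | [] => 0
  | x :: w => word w - cone x (bdWord w)

/-- The boundary map, the alternating sum of the faces. -/
noncomputable def bd : Words R X →ₗ[R] Words R X := ext bdWord

@[simp] theorem bd_nil : bd (word (R := R) ([] : List X)) = 0 := by simp [bd, bdWord]

theorem bd_cone (x : X) (c : Words R X) : bd (cone x c) = c - cone x (bd c) :=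
  hom_eq (f := bd ∘ₗ cone x) (g := LinearMap.id - cone x ∘ₗ bd) (by simp [bd, bdWord]) c

theorem bd_cons (x : X) (w : List X) : bd (word (R := R) (x :: w)) = word w - cone x (bd (word w)) := by
  rw [← cone_word, bd_cone]

theorem bd_bd (c : Words R X) : bd (bd c) = 0 := by
  refine hom_eq (f := bd ∘ₗ bd) (g := 0) (fun w => ?_) c
  induction w with
  | nil => simp
  | cons x w ih =>
    simp only [LinearMap.comp_apply, LinearMap.zero_apply] at ih ⊢
    rw [bd_cons, map_sub, bd_cone, ih]
    simp

theorem bd_map (f : X → Y) (c : Words R X) : bd (map f c) = map f (bd c) := by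
  refine hom_eq (f := bd ∘ₗ map f) (g := map f ∘ₗ bd) (fun w => ?_) c
  induction w with
  | nil => simp
  | cons x w ih =>
    simp only [LinearMap.comp_apply, map_word, List.map_cons] at ih ⊢
    rw [bd_cons, bd_cons, ih, map_sub, map_cone, map_word]

/-- The words of length at most `n`. -/
noncomputable abbrev lengthLE (R X : Type*) [CommRing R] (n : ℕ) : Submodule R (Words R X) :=
  spanWords R {w : List X | w.length ≤ n}

/-- The words of length `n`. -/
noncomputable abbrev lengthEq (R X : Type*) [CommRing R] (n : ℕ) : Submodule R (Words R X) :=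
  spanWords R {w : List X | w.length = n}

theorem cone_mem_lengthEq {n : ℕ} (x : X) {c : Words R X} (hc : c ∈ lengthEq R X n) :
    cone x c ∈ lengthEq R X (n + 1) :=
  mem_of_spanWords (fun w hw => by
    rw [cone_word]; exact word_mem (by simpa using hw)) hc

theorem bd_mem_lengthEq {n : ℕ} {c : Words R X} (hc : c ∈ lengthEq R X (n + 1)) :
    bd c ∈ lengthEq R X n := by
  refine mem_of_spanWords (fun w hw => ?_) hc
  clear hc
  induction n generalizing w with
  | zero =>
    obtain ⟨x, rfl⟩ := List.length_eq_one_iff.1 hw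
    rw [bd_cons, bd_nil, map_zero, sub_zero]
    exact word_mem rfl
  | succ n ih =>
    cases w with
    | nil => simp at hw
    | cons x w =>
      rw [bd_cons]
      simp only [Set.mem_ofPred_eq, List.length_cons, add_left_inj] at hw
      exact sub_mem (word_mem hw) (cone_mem_lengthEq x (ih w hw))

theorem lengthEq_le_lengthLE {m n : ℕ} (h : m ≤ n) : lengthEq R X m ≤ lengthLE R X n :=
  spanWords_mono fun _ hw => le_trans (le_of_eq hw) h

theorem bd_word_mem_lengthLE {n : ℕ} {w : List X} (hw : w.length ≤ n + 1) :
    bd (word (R := R) w) ∈ lengthLE R X n := by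
  cases w with
  | nil => simp
  | cons x w =>
    exact lengthEq_le_lengthLE (by simpa using hw)
      (bd_mem_lengthEq (n := w.length) (word_mem (by simp)))

theorem exists_mem_lengthLE (c : Words R X) : ∃ n, c ∈ lengthLE R X n := by
  refine ⟨(show List X →₀ R from c).support.sup List.length, ?_⟩
  have h : c = (show List X →₀ R from c).sum fun w r => r • word (R := R) w :=
    (Finsupp.sum_single c).symm.trans (Finsupp.sum_congr fun w _ => by
      exact (Finsupp.smul_single_one w _).symm)
  have hs : (show List X →₀ R from c).sum (fun w r => r • word (R := R) w) ∈
      lengthLE R X ((show List X →₀ R from c).support.sup List.length) :=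
    Submodule.sum_mem _ fun w hw =>
      Submodule.smul_mem _ _ (word_mem (Finset.le_sup (f := List.length) hw))
  rwa [← h] at hs

/-! ### Chain homotopies -/

/-- The chain homotopy from an augmented chain map `T` that vanishes on the empty word to zero,
constructed by recursion from the contraction of the target. -/
noncomputable def homotopy (T : Words R X →ₗ[R] Words R Y) (y : X → Y) : ℕ → Words R X →ₗ[R] Words R Y
  | 0 => 0
  | n + 1 => ext fun w => match w with
    | [] => 0
    | x :: w => cone (y x) (T (word (x :: w)) - homotopy T y n (bd (word (x :: w))))

@[simp] theorem homotopy_nil (T : Words R X →ₗ[R] Words R Y) (y : X → Y) (n : ℕ) :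
    homotopy T y n (word []) = 0 := by
  cases n <;> simp [homotopy]

theorem homotopy_cons (T : Words R X →ₗ[R] Words R Y) (y : X → Y) (n : ℕ) (x : X) (w : List X) :
    homotopy T y (n + 1) (word (x :: w)) =
      cone (y x) (T (word (x :: w)) - homotopy T y n (bd (word (x :: w)))) := by
  simp [homotopy]

/-- By induction `T w - h (bd w)` is a cycle, and a cycle is the boundary of its cone with any
vertex; `y` selects the vertex. The index of `homotopy` is a recursion depth, which has to be at
least the length of the word. -/
theorem bd_homotopy {T : Words R X →ₗ[R] Words R Y} (hT : ∀ c, bd (T c) = T (bd c))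
    (hT0 : T (word []) = 0) (y : X → Y) {n : ℕ} {c : Words R X} (hc : c ∈ lengthLE R X n) :
    bd (homotopy T y (n + 1) c) + homotopy T y n (bd c) = T c := by
  induction n generalizing c with
  | zero =>
    refine eqOn_spanWords (f := bd ∘ₗ homotopy T y 1 + homotopy T y 0 ∘ₗ bd) (fun w hw => ?_) hc
    obtain rfl : w = [] := by simpa using hw
    simp [hT0]
  | succ n ih =>
    refine eqOn_spanWords (f := bd ∘ₗ homotopy T y (n + 2) + homotopy T y (n + 1) ∘ₗ bd)
      (fun w hw => ?_) hc
    cases w with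
    | nil => simp [hT0]
    | cons x w =>
      have h := ih (bd_word_mem_lengthLE hw)
      rw [bd_bd, map_zero, add_zero] at h
      simp only [LinearMap.add_apply, LinearMap.comp_apply]
      rw [homotopy_cons, bd_cone, map_sub (bd : Words R Y →ₗ[R] _), hT, h, sub_self, map_zero, sub_zero]
      abel

/-- The homotopy is built from `T` and `y` only, so whatever is compatible with these is compatible
with it. With translations for `f` and `g` this is equivariance. -/
theorem map_homotopy {X' Y' : Type*} (f : X → X') (g : Y → Y') {T : Words R X →ₗ[R] Words R Y}
    {T' : Words R X' →ₗ[R] Words R Y'} {y : X → Y} {y' : X' → Y'} (hy : ∀ x, g (y x) = y' (f x))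
    (hT : ∀ c, map g (T c) = T' (map f c)) (n : ℕ) (c : Words R X) :
    map g (homotopy T y n c) = homotopy T' y' n (map f c) := by
  induction n generalizing c with
  | zero => simp [homotopy]
  | succ n ih =>
    refine hom_eq (f := map g ∘ₗ homotopy T y (n + 1))
      (g := homotopy T' y' (n + 1) ∘ₗ map f) (fun w => ?_) c
    cases w with
    | nil => simp
    | cons x w =>
      simp only [LinearMap.comp_apply]
      rw [homotopy_cons, map_cone, map_sub, ih, hT, hy, ← bd_map, map_word, List.map_cons,
        homotopy_cons]

/-! ### Shuffles -/

/-- The sign of a word. -/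
noncomputable def sgn : Words R X →ₗ[R] Words R X := ext fun w => (-1 : R) ^ w.length • word w

theorem sgn_word (w : List X) : sgn (word (R := R) w) = (-1 : R) ^ w.length • word w := by simp [sgn]

theorem sgn_cone (x : X) (c : Words R X) : sgn (cone x c) = -cone x (sgn c) :=
  hom_eq (f := sgn ∘ₗ cone x) (g := -(cone (R := R) x ∘ₗ sgn)) (fun w => by
    simp [sgn_word, pow_succ, map_smul, cone_word]) c

theorem sgn_map (f : X → Y) (c : Words R X) : sgn (map f c) = map f (sgn c) :=
  hom_eq (f := sgn ∘ₗ map f) (g := map f ∘ₗ sgn) (fun w => by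
    simp [sgn_word, map_smul, map_word]) c

theorem sgn_sgn (c : Words R X) : sgn (sgn c) = c :=
  hom_eq (f := sgn ∘ₗ sgn) (g := LinearMap.id) (fun w => by
    simp only [LinearMap.comp_apply, sgn_word, map_smul, smul_smul, ← mul_pow]
    simp) c

theorem bd_sgn (c : Words R X) : bd (sgn c) = -sgn (bd c) := by
  refine hom_eq (f := bd ∘ₗ sgn) (g := -(sgn (R := R) ∘ₗ bd)) (fun w => ?_) c
  induction w with
  | nil => simp [sgn_word]
  | cons x w ih =>
    simp only [LinearMap.comp_apply, LinearMap.neg_apply] at ih ⊢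
    rw [← cone_word, sgn_cone, map_neg, bd_cone, ih, bd_cone, map_sub, sgn_cone, map_neg]

/-- The coefficient of the empty word. -/
noncomputable def aug : Words R X →ₗ[R] R := ext fun w => if w = [] then 1 else 0

@[simp] theorem aug_nil : aug (word (R := R) ([] : List X)) = 1 := by simp [aug]

@[simp] theorem aug_cons (x : X) (w : List X) : aug (word (R := R) (x :: w)) = 0 := by simp [aug]

@[simp] theorem aug_cone (x : X) (c : Words R X) : aug (cone x c) = 0 :=
  hom_eq (f := aug ∘ₗ cone x) (g := 0) (fun w => by simp) c

@[simp] theorem aug_sgn (c : Words R X) : aug (sgn c) = aug c :=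
  hom_eq (f := aug ∘ₗ sgn) (g := aug) (fun w => by
    cases w <;> simp [sgn_word, aug]) c

/-- The shuffle product of two words: the triangulation of the product of two simplices. -/
noncomputable def shuffleWord : List X → List Y → Words R (X × Y)
  | [], _ => 0
  | _ :: _, [] => 0
  | x :: u, y :: v => cone (x, y) (shuffleWord u (y :: v) +
      (-1 : R) ^ u.length • shuffleWord (x :: u) v +
      -- Shuffles with the empty word are zero, so the product of two single letters needs this
      -- empty word to be coned to the vertex `(x, y)`.
      (aug (word (R := R) u) * aug (word (R := R) v)) • word [])
  termination_by u v => u.length + v.length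

/-- The shuffle product. -/
noncomputable def shuffle : Words R X →ₗ[R] Words R Y →ₗ[R] Words R (X × Y) :=
  ext fun u => ext fun v => shuffleWord u v

/-- Two bilinear maps that agree on words are equal. -/
theorem hom_eq₂ {A : Type*} [AddCommMonoid A] [Module R A] {f g : Words R X →ₗ[R] Words R Y →ₗ[R] A}
    (h : ∀ u v, f (word u) (word v) = g (word u) (word v)) (a : Words R X) (b : Words R Y) :
    f a b = g a b :=
  LinearMap.congr_fun (hom_eq (fun u => hom_ext (h u)) a) b

@[simp] theorem shuffle_nil_left (b : Words R Y) : shuffle (word (R := R) ([] : List X)) b = 0 :=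
  hom_eq (g := 0) (fun v => by simp [shuffle, shuffleWord]) b

@[simp] theorem shuffle_nil_right (a : Words R X) : shuffle a (word ([] : List Y)) = 0 := by
  refine hom_eq (f := shuffle.flip (word ([] : List Y))) (g := 0) (fun u => ?_) a
  cases u <;> simp [shuffle, shuffleWord]

theorem shuffle_cone_cone (x : X) (a : Words R X) (y : Y) (b : Words R Y) :
    shuffle (cone x a) (cone y b) = cone (x, y) (shuffle a (cone y b) +
      shuffle (cone x (sgn a)) b + (aug a * aug b) • word []) := by
  refine hom_eq₂ (f := shuffle.compl₁₂ (cone x) (cone y))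
    (g := (shuffle.compl₁₂ LinearMap.id (cone y) + shuffle.compl₁₂ (cone x ∘ₗ sgn) LinearMap.id +
      ((LinearMap.mul R R).compl₁₂ aug aug).compr₂
        ((LinearMap.lsmul R (Words R (X × Y))).flip (word []))).compr₂ (cone (x, y)))
    (fun u v => ?_) a b
  simp only [LinearMap.compl₁₂_apply, LinearMap.compr₂_apply, LinearMap.add_apply, cone_word,
    LinearMap.comp_apply, LinearMap.id_apply, sgn_word, map_smul, LinearMap.smul_apply,
    LinearMap.flip_apply, LinearMap.lsmul_apply, LinearMap.mul_apply']
  simp only [shuffle, ext_word]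
  rw [shuffleWord]

/-- The Leibniz rule for a product of simplices. The sign is `-sgn` because a word has one letter
more than its dimension. The last term is a correction in the lowest degree: the boundary of a
vertex `(x, y)` is the empty word, whereas shuffles with the empty word are zero. -/
theorem bd_shuffle (a : Words R X) (b : Words R Y) :
    bd (shuffle a b) = shuffle (bd a) b - shuffle (sgn a) (bd b) +
      (aug (bd a) * aug (bd b)) • word [] := by
  suffices h : ∀ n, ∀ u : List X, ∀ v : List Y, u.length + v.length ≤ n →
      bd (shuffle (word (R := R) u) (word v)) = shuffle (bd (word u)) (word v) -
        shuffle (sgn (word u)) (bd (word v)) +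
        (aug (bd (word (R := R) u)) * aug (bd (word (R := R) v))) • word [] by
    have key := hom_eq₂ (f := shuffle.compr₂ bd) (g := shuffle.compl₁₂ bd LinearMap.id +
      shuffle.compl₁₂ ((-1 : R) • sgn) bd + ((LinearMap.mul R R).compl₁₂ (aug ∘ₗ bd) (aug ∘ₗ bd)).compr₂
        ((LinearMap.lsmul R (Words R (X × Y))).flip (word [])))
      (fun u v => by
        simp only [LinearMap.compr₂_apply, LinearMap.add_apply, neg_smul,
          one_smul, map_neg, LinearMap.neg_apply, LinearMap.compl₁₂_apply, LinearMap.id_apply, LinearMap.comp_apply, ← sub_eq_add_neg,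
          LinearMap.mul_apply', LinearMap.flip_apply, LinearMap.lsmul_apply]
        exact h _ u v le_rfl) a b
    simpa only [LinearMap.compr₂_apply, LinearMap.add_apply, LinearMap.smul_apply, neg_smul,
          one_smul, map_neg, LinearMap.neg_apply, LinearMap.compl₁₂_apply, LinearMap.id_apply, LinearMap.comp_apply, ← sub_eq_add_neg,
          LinearMap.mul_apply', LinearMap.flip_apply, LinearMap.lsmul_apply] using key
  intro n
  induction n with
  | zero =>
    intro u v h
    obtain rfl : u = [] := List.length_eq_zero_iff.1 (by lia)
    simp [sgn_word]
  | succ n ih =>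
    intro u v h
    rcases u with - | ⟨x, u⟩
    · simp [sgn_word]
    rcases v with - | ⟨y, v⟩
    · simp
    simp only [List.length_cons] at h
    have h1 := ih u (y :: v) (by simp only [List.length_cons]; lia)
    have h2 : bd (shuffle (cone x (sgn (word (R := R) u))) (word v)) =
        shuffle (bd (cone x (sgn (word u)))) (word v) -
        shuffle (sgn (cone x (sgn (word u)))) (bd (word v)) +
        (aug (bd (cone x (sgn (word (R := R) u)))) * aug (bd (word (R := R) v))) • word [] := by
      have := ih (x :: u) v (by simp only [List.length_cons]; lia)
      rw [sgn_word]
      simp only [map_smul, LinearMap.smul_apply, cone_word, this, smul_add, smul_sub, smul_eq_mul,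
        mul_smul, mul_assoc]
    rw [← cone_word y v] at h1
    rw [← cone_word, ← cone_word, shuffle_cone_cone, bd_cone]
    simp only [h1, h2, bd_cone, map_sub, map_add, LinearMap.sub_apply, sgn_cone, shuffle_cone_cone, sgn_sgn,
      bd_sgn, map_neg, LinearMap.neg_apply, aug_cone, aug_sgn, sub_zero, map_smul, bd_nil,
      smul_zero, neg_zero, add_zero]
    generalize (aug (word (R := R) u) * aug (word (R := R) v)) • word (R := R) ([] : List (X × Y)) = s₁
    generalize (aug (bd (word (R := R) u)) * aug (word (R := R) v)) • cone (R := R) (x, y) (word []) = s₂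
    generalize (aug (word (R := R) u) * aug (bd (word (R := R) v))) • cone (R := R) (x, y) (word []) = s₃
    abel

theorem map_shuffle {X' Y' : Type*} (f : X → X') (g : Y → Y') (a : Words R X) (b : Words R Y) :
    map (Prod.map f g) (shuffle a b) = shuffle (map f a) (map g b) := by
  suffices h : ∀ n, ∀ u : List X, ∀ v : List Y, u.length + v.length ≤ n →
      map (Prod.map f g) (shuffle (word (R := R) u) (word v)) =
        shuffle (map f (word u)) (map g (word v)) from
    hom_eq₂ (f := shuffle.compr₂ (map (Prod.map f g))) (g := shuffle.compl₁₂ (map f) (map g))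
      (fun u v => h _ u v le_rfl) a b
  intro n
  induction n with
  | zero =>
    intro u v h
    obtain rfl : u = [] := List.length_eq_zero_iff.1 (by lia)
    simp
  | succ n ih =>
    intro u v h
    rcases u with - | ⟨x, u⟩
    · simp
    rcases v with - | ⟨y, v⟩
    · simp
    simp only [List.length_cons] at h
    have h1 := ih u (y :: v) (by simp only [List.length_cons]; lia)
    have h2 := ih (x :: u) v (by simp only [List.length_cons]; lia)
    have h3 : aug (map f (word (R := R) u)) = aug (word u) := by cases u <;> simp [aug]
    have h4 : aug (map g (word (R := R) v)) = aug (word v) := by cases v <;> simp [aug]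
    rw [← cone_word y v] at h1
    rw [← cone_word x u] at h2
    rw [← cone_word, ← cone_word, shuffle_cone_cone, map_cone, map_add (map (Prod.map f g)),
      map_add (map (Prod.map f g)), h1, map_cone,
      map_cone, shuffle_cone_cone, sgn_map, h3, h4, sgn_word]
    rw [map_cone] at h2
    simp only [map_smul, LinearMap.smul_apply, h2, map_word, List.map_nil, Prod.map]

theorem shuffle_singleton (a : Words R X) (y : Y) (ha : aug a = 0) :
    shuffle a (word [y]) = map (fun x => (x, y)) a := by
  have : ∀ a : Words R X, shuffle a (word [y]) = map (fun x => (x, y)) a - aug a • word [] := by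
    intro a
    refine hom_eq (f := shuffle.flip (word [y])) (g := map (fun x => (x, y)) -
      (LinearMap.lsmul R (Words R (X × Y))).flip (word []) ∘ₗ aug) (fun u => ?_) a
    induction u with
    | nil => simp
    | cons x u ih =>
      simp only [LinearMap.flip_apply, LinearMap.sub_apply, LinearMap.comp_apply,
        LinearMap.lsmul_apply] at ih ⊢
      rw [← cone_word y [], ← cone_word x u, shuffle_cone_cone, cone_word y, ih, map_cone]
      simp
  rw [this, ha, zero_smul, sub_zero]

theorem shuffle_singleton_left (x : X) (b : Words R Y) (hb : aug b = 0) :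
    shuffle (word [x]) b = map (fun y => (x, y)) b := by
  have : ∀ b : Words R Y, shuffle (word [x]) b = map (fun y => (x, y)) b - aug b • word [] := by
    intro b
    refine hom_eq (f := shuffle (word [x])) (g := map (fun y => (x, y)) -
      (LinearMap.lsmul R (Words R (X × Y))).flip (word []) ∘ₗ aug) (fun v => ?_) b
    induction v with
    | nil => simp
    | cons y v ih =>
      simp only [LinearMap.flip_apply, LinearMap.sub_apply, LinearMap.comp_apply,
        LinearMap.lsmul_apply] at ih ⊢
      have h : sgn (word (R := R) ([] : List X)) = word [] := by simp [sgn_word]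
      rw [← cone_word y v, ← cone_word x [], shuffle_cone_cone, shuffle_nil_left, h, cone_word x,
        ih, map_cone]
      simp
  rw [this, hb, zero_smul, sub_zero]

/-! ### The diagonal -/

/-- The Alexander-Whitney diagonal of a word. -/
noncomputable def diagonalWord : List X → Words R X ⊗[R] Words R X
  | [] => 0
  | x :: w => word [x] ⊗ₜ word (x :: w) + (cone x).rTensor _ (diagonalWord w)

/-- The Alexander-Whitney diagonal. -/
noncomputable def diagonal : Words R X →ₗ[R] Words R X ⊗[R] Words R X := ext diagonalWord

@[simp] theorem diagonal_nil : diagonal (word (R := R) ([] : List X)) = 0 := by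
  simp [diagonal, diagonalWord]

theorem diagonal_cone (x : X) (c : Words R X) :
    diagonal (cone x c) = word [x] ⊗ₜ cone x c + (cone x).rTensor _ (diagonal c) :=
  hom_eq (f := diagonal ∘ₗ cone x) (g := TensorProduct.mk R _ _ (word [x]) ∘ₗ cone x +
    (cone x).rTensor _ ∘ₗ diagonal) (fun w => by simp [diagonal, diagonalWord]) c

/-- The boundary map of the tensor product. -/
noncomputable def tensorBd (d : Words R X →ₗ[R] Words R X) :
    Words R X ⊗[R] Words R X →ₗ[R] Words R X ⊗[R] Words R X :=
  d.rTensor (Words R X) - TensorProduct.map sgn d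

theorem tensorBd_tmul (d : Words R X →ₗ[R] Words R X) (a b : Words R X) :
    tensorBd d (a ⊗ₜ b) = d a ⊗ₜ b - sgn a ⊗ₜ d b := by
  simp [tensorBd]

theorem tensorBd_cone (x : X) (t : Words R X ⊗[R] Words R X) :
    tensorBd bd ((cone x).rTensor _ t) = t - (cone x).rTensor _ (tensorBd bd t) := by
  induction t with
  | zero => simp
  | add s t hs ht => simp only [map_add, hs, ht]; abel
  | tmul a b =>
    simp only [LinearMap.rTensor_tmul, tensorBd_tmul, bd_cone, sgn_cone, map_sub, sub_tmul,
      neg_tmul]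
    abel

/-- In the interior the Alexander-Whitney terms cancel as usual. The two extra terms come from the
first and the last summand of the diagonal: each has a factor of one letter, and the boundary of
this letter is the empty word. -/
theorem tensorBd_diagonal (c : Words R X) :
    tensorBd bd (diagonal c) = diagonal (bd c) + word [] ⊗ₜ c - sgn c ⊗ₜ word [] := by
  have key := hom_eq (f := tensorBd bd ∘ₗ diagonal) (g := diagonal ∘ₗ bd +
    TensorProduct.mk R (Words R X) (Words R X) (word []) +
      (-1 : R) • ((TensorProduct.mk R (Words R X) (Words R X)).flip (word []) ∘ₗ sgn))
    (fun w => ?_) c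
  · simpa only [LinearMap.add_apply, LinearMap.smul_apply, LinearMap.comp_apply, mk_apply,
      LinearMap.flip_apply, neg_smul, one_smul, ← sub_eq_add_neg] using key
  induction w with
  | nil => simp [sgn_word]
  | cons x w ih =>
    simp only [LinearMap.add_apply, LinearMap.smul_apply, LinearMap.comp_apply, mk_apply,
      LinearMap.flip_apply, neg_smul, one_smul, ← sub_eq_add_neg] at ih ⊢
    have h : sgn (word (R := R) [x]) = -word [x] := by simp [sgn_word]
    rw [← cone_word x w, diagonal_cone, map_add, tensorBd_cone, ih, bd_cone, map_sub diagonal,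
      diagonal_cone, tensorBd_tmul, bd_cons, sgn_cone, h, bd_cone]
    simp only [bd_nil, map_zero, sub_zero, tmul_sub, neg_tmul, map_sub, map_add,
      LinearMap.rTensor_tmul, cone_word]
    abel

theorem map_diagonal (f : X → Y) (c : Words R X) :
    TensorProduct.map (map f) (map f) (diagonal c) = diagonal (map f c) := by
  refine hom_eq (f := TensorProduct.map (map f) (map f) ∘ₗ diagonal)
    (g := diagonal ∘ₗ map f) (fun w => ?_) c
  induction w with
  | nil => simp
  | cons x w ih =>
    simp only [LinearMap.comp_apply] at ih ⊢
    have h : ∀ t : Words R X ⊗[R] Words R X, TensorProduct.map (map f) (map f)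
        ((cone x).rTensor _ t) = (cone (f x)).rTensor _ (TensorProduct.map (map f) (map f) t) := by
      intro t
      induction t with
      | zero => simp
      | add s t hs ht => simp only [map_add, hs, ht]
      | tmul a b => simp [map_cone]
    rw [← cone_word x w, diagonal_cone, map_cone, diagonal_cone, map_add, h, ih]
    simp

end WordComplex

namespace WordComplex

open TensorProduct

variable {R : Type*} [CommRing R] {K G N : Type*} [Group K] [Group G] [Group N]

/-! ### The bar complex -/

/-- The successive quotients of the letters of a word. -/
def diffs : G → List G → List G
  | _, [] => []
  | k, x :: w => (k⁻¹ * x) :: diffs x w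

/-- The word of the partial products, starting from a given element. -/
def path : G → List G → List G
  | k, [] => [k]
  | k, g :: w => k :: path (k * g) w

/-- The map from homogeneous chains to bar chains. -/
noncomputable def toBar : Words R G →ₗ[R] Words R G := ext fun
  | [] => 0
  | k :: w => word (diffs k w)

/-- The section of `toBar` whose values start with `1`. -/
noncomputable def ofBar : Words R G →ₗ[R] Words R G := ext fun u => word (path 1 u)

@[simp] theorem toBar_nil : toBar (word (R := R) ([] : List G)) = 0 := by simp [toBar]

@[simp] theorem toBar_cons (k : G) (w : List G) :
    toBar (word (R := R) (k :: w)) = word (diffs k w) := by simp [toBar]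

@[simp] theorem ofBar_word (w : List G) : ofBar (word (R := R) w) = word (path 1 w) := by
  simp [ofBar]

theorem toBar_path (k : G) (w : List G) : toBar (word (R := R) (path k w)) = word w := by
  have h : ∀ (w : List G) (k : G), ∃ v, path k w = k :: v ∧ diffs k v = w := by
    intro w
    induction w with
    | nil => exact fun k => ⟨[], rfl, rfl⟩
    | cons g w ih =>
      intro k
      obtain ⟨v, hv, hv'⟩ := ih (k * g)
      refine ⟨path (k * g) w, rfl, ?_⟩
      rw [hv, diffs, hv', inv_mul_cancel_left]
  obtain ⟨v, hv, hv'⟩ := h w k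
  rw [hv, toBar_cons, hv']

@[simp] theorem toBar_ofBar (c : Words R G) : toBar (ofBar c) = c :=
  (hom_eq (f := toBar ∘ₗ ofBar) (g := LinearMap.id) (fun w => by simp [toBar_path]) c :)

theorem map_path (f : G →* N) (k : G) (w : List G) : (path k w).map f = path (f k) (w.map f) := by
  induction w generalizing k with
  | nil => rfl
  | cons g w ih => simp [path, ih]

theorem map_diffs (f : G →* N) (k : G) (w : List G) : (diffs k w).map f = diffs (f k) (w.map f) := by
  induction w generalizing k with
  | nil => rfl
  | cons g w ih => simp [diffs, ih]

theorem map_mul_path (g k : G) (w : List G) : (path k w).map (g * ·) = path (g * k) w := by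
  induction w generalizing k with
  | nil => rfl
  | cons x w ih => simp [path, ih, mul_assoc]

theorem diffs_mul (g k : G) (w : List G) : diffs (g * k) (w.map (g * ·)) = diffs k w := by
  induction w generalizing k with
  | nil => rfl
  | cons x w ih => simp [diffs, ih, mul_assoc]

theorem path_diffs (k : G) (w : List G) : path k (diffs k w) = k :: w := by
  induction w generalizing k with
  | nil => rfl
  | cons x w ih => simp [path, diffs, ih]

theorem toBar_map_mul (g : G) (c : Words R G) : toBar (map (g * ·) c) = toBar c :=
  hom_eq (f := toBar ∘ₗ map (g * ·)) (g := toBar) (fun w => by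
    cases w <;> simp [diffs_mul]) c

theorem toBar_map (f : G →* N) (c : Words R G) : toBar (map f c) = map f (toBar c) :=
  hom_eq (f := toBar ∘ₗ map f) (g := map f ∘ₗ toBar) (fun w => by
    cases w <;> simp [map_diffs]) c

theorem ofBar_map (f : G →* N) (c : Words R G) : ofBar (map f c) = map f (ofBar c) :=
  hom_eq (f := ofBar ∘ₗ map f) (g := map f ∘ₗ ofBar) (fun w => by
    simp [map_path]) c

/-- A left invariant map that vanishes on the empty word factors through the bar chains. -/
theorem eq_ofBar_toBar {A : Type*} [AddCommGroup A] [Module R A] {F : Words R G →ₗ[R] A}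
    (hF : ∀ (g : G) c, F (map (g * ·) c) = F c) (h0 : F (word []) = 0) (c : Words R G) :
    F c = F (ofBar (toBar c)) := by
  refine hom_eq (f := F) (g := F ∘ₗ ofBar ∘ₗ toBar) (fun w => ?_) c
  cases w with
  | nil => simp [h0]
  | cons k w =>
    simp only [LinearMap.comp_apply, toBar_cons, ofBar_word]
    rw [← hF k (word (path 1 _)), map_word, map_mul_path, mul_one, path_diffs]

/-- The boundary map of the bar complex. -/
noncomputable def barBd : Words R G →ₗ[R] Words R G := toBar ∘ₗ bd ∘ₗ ofBar

theorem toBar_bd (c : Words R G) : toBar (bd c) = barBd (toBar c) :=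
  eq_ofBar_toBar (F := toBar ∘ₗ bd) (fun g c => by
    simp only [LinearMap.comp_apply, bd_map, toBar_map_mul]) (by simp) c

theorem barBd_barBd (c : Words R G) : barBd (barBd c) = 0 := by
  have h : barBd c = toBar (bd (ofBar c)) := rfl
  rw [h, ← toBar_bd, bd_bd, map_zero]

theorem barBd_map (f : G →* N) (c : Words R G) : barBd (map f c) = map f (barBd c) := by
  simp only [barBd, LinearMap.comp_apply, ofBar_map, bd_map, toBar_map]

@[simp] theorem length_path (k : G) (w : List G) : (path k w).length = w.length + 1 := by
  induction w generalizing k with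
  | nil => rfl
  | cons x w ih => simp [path, ih]

@[simp] theorem length_diffs (k : G) (w : List G) : (diffs k w).length = w.length := by
  induction w generalizing k with
  | nil => rfl
  | cons x w ih => simp [diffs, ih]

theorem ofBar_mem_lengthEq {n : ℕ} {c : Words R G} (hc : c ∈ lengthEq R G n) :
    ofBar c ∈ lengthEq R G (n + 1) :=
  mem_of_spanWords (fun w hw => by
    rw [ofBar_word]; exact word_mem (by simpa using hw)) hc

theorem toBar_mem_lengthEq {n : ℕ} {c : Words R G} (hc : c ∈ lengthEq R G (n + 1)) :
    toBar c ∈ lengthEq R G n :=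
  mem_of_spanWords (fun w hw => by
    cases w with
    | nil => simp
    | cons k w => rw [toBar_cons]; exact word_mem (by simpa using hw)) hc

theorem barBd_mem_lengthEq {n : ℕ} {c : Words R G} (hc : c ∈ lengthEq R G (n + 1)) :
    barBd c ∈ lengthEq R G n :=
  toBar_mem_lengthEq (bd_mem_lengthEq (ofBar_mem_lengthEq hc))

theorem barBd_singleton (g : G) : barBd (word (R := R) [g]) = 0 := by
  simp [barBd, path, bd_cons, diffs]

theorem barBd_nil : barBd (word (R := R) ([] : List G)) = 0 := by
  simp [barBd, path, bd_cons]

theorem sgn_toBar (c : Words R G) : sgn (toBar c) = -toBar (sgn c) :=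
  (hom_eq (f := sgn ∘ₗ toBar) (g := -(toBar (R := R) ∘ₗ sgn)) (fun w => by
    cases w <;> simp [sgn_word, map_smul, pow_succ]) c :)

theorem sgn_ofBar (c : Words R G) : sgn (ofBar c) = -ofBar (sgn c) :=
  (hom_eq (f := sgn ∘ₗ ofBar) (g := -(ofBar (R := R) ∘ₗ sgn)) (fun w => by
    simp [sgn_word, map_smul, pow_succ]) c :)

theorem aug_ofBar (c : Words R G) : aug (ofBar c) = 0 :=
  (hom_eq (f := aug ∘ₗ ofBar) (g := 0) (fun w => by
    cases w <;> simp [path]) c :)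

/-- Equivariant chain maps that agree in degree zero induce the same map in homology. -/
theorem toBar_ofBar_mem_range {T : Words R K →ₗ[R] Words R N} (hT : ∀ c, bd (T c) = T (bd c))
    (hT0 : T (word []) = 0) (f : K →* N)
    (hTf : ∀ k c, T (map (k * ·) c) = map (f k * ·) (T c)) {z : Words R K} (hz : barBd z = 0) :
    toBar (T (ofBar z)) ∈ LinearMap.range (barBd (R := R) (G := N)) := by
  obtain ⟨n, hn⟩ := exists_mem_lengthLE (ofBar z)
  have h := congrArg toBar (bd_homotopy hT hT0 f hn)
  -- The homotopy is equivariant, so its image under `toBar` at `bd (ofBar z)` depends only on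
  -- `barBd z`, which is zero.
  have h2 := eq_ofBar_toBar (F := toBar ∘ₗ homotopy T f n) (fun g c => by
    simp only [LinearMap.comp_apply]
    rw [← map_homotopy (g * ·) (f g * ·) (y := f) (T := T) (fun x => (map_mul f g x).symm)
      (fun c => (hTf g c).symm), toBar_map_mul]) (by simp) (bd (ofBar z))
  simp only [LinearMap.comp_apply] at h2
  rw [map_add, h2, toBar_bd (ofBar z), toBar_ofBar, hz, map_zero, map_zero, map_zero, add_zero,
    toBar_bd] at h
  exact ⟨_, h⟩

/-- Right translation by `g⁻¹` commutes with all left translations, so it is equivariantly homotopic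
to the identity. A further left translation by `g`, invisible to `toBar`, turns it into conjugation.
-/
theorem map_conj_sub_mem_range (g : G) {z : Words R G} (hz : barBd z = 0) :
    map (MulAut.conj g) z - z ∈ LinearMap.range (barBd (R := R) (G := G)) := by
  have h := toBar_ofBar_mem_range (T := map (· * g⁻¹) - LinearMap.id) (fun c => by
    simp [bd_map]) (by simp) (MonoidHom.id G) (fun k c => by
    simp [map_map, Function.comp_def, mul_assoc]) hz
  rw [LinearMap.sub_apply, map_sub, LinearMap.id_apply, toBar_ofBar,
    ← toBar_map_mul g, map_map] at h
  have h2 : (fun x => g * x) ∘ (fun x => x * g⁻¹) = (MulAut.conj g).toMonoidHom := by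
    ext x; simp [mul_assoc]
  rw [h2, toBar_map, toBar_ofBar] at h
  exact h

/-! ### Products of commuting homomorphisms -/

/-- Linear extension of the shuffle product. -/
noncomputable def shuffleTensor {X : Type*} :
    Words R X ⊗[R] Words R X →ₗ[R] Words R (X × X) := TensorProduct.lift shuffle

/-- Only a summand with two factors of one letter contributes, and it occurs only in the diagonal of
a single letter. This evaluates the correction term of `bd_shuffle` on a diagonal. -/
theorem augTensor_diagonal {X : Type*} (c : Words R X) :
    TensorProduct.lift ((LinearMap.mul R R).compl₁₂ (aug ∘ₗ bd) (aug ∘ₗ bd))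
      (diagonal (R := R) (X := X) c) = aug (bd c) := by
  have h1 : ∀ (x : X) (t : Words R X ⊗[R] Words R X),
      TensorProduct.lift ((LinearMap.mul R R).compl₁₂ (aug ∘ₗ bd) (aug ∘ₗ bd))
        ((cone x).rTensor _ t) =
      TensorProduct.lift ((LinearMap.mul R R).compl₁₂ aug (aug ∘ₗ bd)) t := by
    intro x t
    induction t with
    | zero => simp
    | add s t hs ht => simp only [map_add, hs, ht]
    | tmul a b => simp [bd_cone]
  have h2 : ∀ c : Words R X, TensorProduct.lift ((LinearMap.mul R R).compl₁₂ aug (aug ∘ₗ bd))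
      (diagonal (R := R) (X := X) c) = 0 := by
    intro c
    refine hom_eq (f := TensorProduct.lift ((LinearMap.mul R R).compl₁₂ aug (aug ∘ₗ bd)) ∘ₗ
      diagonal) (g := 0) (fun w => ?_) c
    have h3 : ∀ (x : X) (t : Words R X ⊗[R] Words R X),
        TensorProduct.lift ((LinearMap.mul R R).compl₁₂ aug (aug ∘ₗ bd))
          ((cone x).rTensor _ t) = 0 := by
      intro x t
      induction t with
      | zero => simp
      | add s t hs ht => simp only [map_add, hs, ht, add_zero]
      | tmul a b => simp
    cases w with
    | nil => simp
    | cons x w =>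
      rw [LinearMap.comp_apply, ← cone_word, diagonal_cone, map_add, h3]
      simp
  refine hom_eq (f := TensorProduct.lift ((LinearMap.mul R R).compl₁₂ (aug ∘ₗ bd) (aug ∘ₗ bd)) ∘ₗ
      diagonal) (g := aug ∘ₗ bd) (fun w => ?_) c
  cases w with
  | nil => simp
  | cons x w =>
    simp only [LinearMap.comp_apply]
    rw [← cone_word, diagonal_cone, map_add, h1, h2, TensorProduct.lift.tmul]
    simp [bd_cons]

theorem bd_shuffleTensor {X : Type*} (t : Words R X ⊗[R] Words R X) :
    bd (shuffleTensor t) = shuffleTensor (tensorBd bd t) +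
      (TensorProduct.lift ((LinearMap.mul R R).compl₁₂ (aug ∘ₗ bd) (aug ∘ₗ bd)) t : R) •
        word [] := by
  induction t with
  | zero => simp
  | add s t hs ht => simp only [map_add, hs, ht, add_smul]; abel
  | tmul a b => simp [shuffleTensor, bd_shuffle, tensorBd_tmul]

theorem map_shuffleTensor {X Y : Type*} (f : X → Y) (t : Words R X ⊗[R] Words R X) :
    map (Prod.map f f) (shuffleTensor t) = shuffleTensor (TensorProduct.map (map f) (map f) t) := by
  induction t with
  | zero => simp
  | add s t hs ht => simp only [map_add, hs, ht]
  | tmul a b => simp [shuffleTensor, map_shuffle]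

/-- The comparison of the diagonal map with the Alexander-Whitney map followed by the shuffle map. -/
noncomputable def diagonalDefect (X : Type*) : Words R X →ₗ[R] Words R (X × X) :=
  shuffleTensor ∘ₗ diagonal + (LinearMap.lsmul R _).flip (word []) ∘ₗ aug -
    map fun x => (x, x)

theorem diagonalDefect_apply {X : Type*} (c : Words R X) :
    diagonalDefect X c = shuffleTensor (diagonal c) + aug c • word [] - map (fun x => (x, x)) c :=
  rfl

/-- The extra terms of `tensorBd_diagonal` die under the shuffle product, and the correction of
`bd_shuffle` is the summand `aug • word []` of the defect at `bd c`. That summand also makes the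
defect vanish on the empty word, as the comparison of chain maps requires. -/
theorem bd_diagonalDefect {X : Type*} (c : Words R X) :
    bd (diagonalDefect X c) = diagonalDefect X (bd c) := by
  have h1 : ∀ c : Words R X, shuffleTensor (word [] ⊗ₜ[R] c) = 0 := fun c => by
    simp [shuffleTensor]
  have h2 : ∀ c : Words R X, shuffleTensor (c ⊗ₜ[R] word []) = 0 := fun c => by
    simp [shuffleTensor]
  simp only [diagonalDefect_apply, map_sub bd, map_add bd, bd_shuffleTensor, tensorBd_diagonal,
    augTensor_diagonal, map_smul, bd_nil, smul_zero, bd_map, map_add shuffleTensor,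
    map_sub shuffleTensor, h1, h2]
  abel

theorem map_diagonalDefect {X Y : Type*} (f : X → Y) (c : Words R X) :
    map (Prod.map f f) (diagonalDefect X c) = diagonalDefect Y (map f c) := by
  have : aug (map f c) = aug c :=
    hom_eq (f := aug ∘ₗ map f) (g := aug) (fun w => by cases w <;> simp) c
  simp only [diagonalDefect_apply, map_sub (map _), map_add (map _), map_shuffleTensor,
    map_diagonal, map_smul, map_word, List.map_nil, map_map, this]
  rfl

section Commuting

variable {α β : K →* G} (hc : ∀ a b, α a * β b = β b * α a)

/-- The product of two commuting homomorphisms. -/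
def mulHom (α β : K →* G) (hc : ∀ a b, α a * β b = β b * α a) : K →* G where
  toFun k := α k * β k
  map_one' := by simp
  map_mul' a b := by
    rw [map_mul, map_mul, mul_assoc, mul_assoc, ← mul_assoc (α b), hc, mul_assoc]

/-- The product of bar chains along two commuting homomorphisms. -/
noncomputable def barProduct (α β : K →* G) :
    Words R K ⊗[R] Words R K →ₗ[R] Words R G :=
  toBar ∘ₗ map (fun p : K × K => α p.1 * β p.2) ∘ₗ shuffleTensor ∘ₗ
    TensorProduct.map ofBar ofBar

-- Translating the factors by `k` and `l` translates the product by `α k * β l`, because `β l`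
-- commutes with the values of `α`. Since `toBar` ignores left translations, the product descends to
-- bar chains.
include hc in
theorem barProduct_toBar (t : Words R K ⊗[R] Words R K) :
    barProduct α β (TensorProduct.map toBar toBar t) =
      toBar (map (fun p : K × K => α p.1 * β p.2) (shuffleTensor t)) := by
  have hid : ∀ c : Words R K, map (fun x : K => 1 * x) c = c := fun c => by
    rw [show (fun x : K => 1 * x) = id from funext one_mul, map_id]
  have key : ∀ k l (a b : Words R K),
      toBar (map (fun p : K × K => α p.1 * β p.2) (shuffle (map (k * ·) a) (map (l * ·) b))) =
        toBar (map (fun p : K × K => α p.1 * β p.2) (shuffle a b)) := by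
    intro k l a b
    refine Eq.trans ?_ (toBar_map_mul (α k * β l) _)
    rw [← map_shuffle, map_map, map_map]
    congr 2
    congr 1
    ext ⟨x, y⟩
    simp only [Function.comp_apply, Prod.map, map_mul]
    rw [mul_assoc (α k), ← mul_assoc (α x), hc x l]
    simp only [mul_assoc]
  induction t with
  | zero => simp
  | add s t hs ht => simp only [map_add, hs, ht]
  | tmul a b =>
    have h1 := eq_ofBar_toBar (F := toBar ∘ₗ map (fun p : K × K => α p.1 * β p.2) ∘ₗ
      shuffle.flip b) (fun g c => by
        have h := key g 1 c b
        rw [hid] at h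
        exact h) (by simp) a
    have h2 := eq_ofBar_toBar (F := toBar ∘ₗ map (fun p : K × K => α p.1 * β p.2) ∘ₗ
      shuffle (ofBar (toBar a))) (fun g c => by
        have h := key 1 g (ofBar (toBar a)) c
        rw [hid] at h
        exact h) (by simp) b
    simp only [LinearMap.comp_apply, LinearMap.flip_apply] at h1 h2
    simp only [barProduct, LinearMap.comp_apply, TensorProduct.map_tmul, shuffleTensor,
      TensorProduct.lift.tmul]
    rw [h1, h2]

end Commuting

end WordComplex

/-! ### Supports and length components of chains; a Künneth argument for the bar complex -/

namespace WordComplex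

open TensorProduct

variable {R : Type*} [CommRing R] {K G N X : Type*} [Group K] [Group G] [Group N]

theorem words_induction {p : Words R X → Prop} (h0 : p 0) (hadd : ∀ a b, p a → p b → p (a + b))
    (hsmul : ∀ (r : R) a, p a → p (r • a)) (hw : ∀ w, p (word w)) (c : Words R X) : p c := by
  obtain ⟨n, hn⟩ := exists_mem_lengthLE c
  refine Submodule.span_induction (p := fun c _ => p c) ?_ h0 (fun a b _ _ => hadd a b)
    (fun r a _ => hsmul r a) hn
  rintro _ ⟨w, -, rfl⟩
  exact hw w

/-- A chain involves finitely many letters. This is what allows a cycle and a bounding chain to be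
moved into the subgroup that a binate group provides for a finite set. -/
theorem exists_finset_map_eq_self (c : Words R X) :
    ∃ S : Finset X, ∀ f : X → X, (∀ x ∈ S, f x = x) → map f c = c := by
  classical
  induction c using words_induction with
  | h0 => exact ⟨∅, fun f _ => map_zero _⟩
  | hadd a b ha hb =>
    obtain ⟨S, hS⟩ := ha
    obtain ⟨T, hT⟩ := hb
    refine ⟨S ∪ T, fun f hf => ?_⟩
    rw [map_add, hS f fun x hx => hf x (Finset.mem_union_left _ hx),
      hT f fun x hx => hf x (Finset.mem_union_right _ hx)]
  | hsmul r a ha =>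
    obtain ⟨S, hS⟩ := ha
    exact ⟨S, fun f hf => by rw [map_smul, hS f hf]⟩
  | hw w =>
    refine ⟨w.toFinset, fun f hf => ?_⟩
    rw [map_word, (List.map_congr_left fun x hx => hf x (List.mem_toFinset.2 hx) :
      w.map f = w.map id), List.map_id]

theorem exists_finset_map_eq_self_tensor (t : Words R X ⊗[R] Words R X) :
    ∃ S : Finset X, ∀ f : X → X, (∀ x ∈ S, f x = x) → TensorProduct.map (map f) (map f) t = t := by
  classical
  induction t with
  | zero => exact ⟨∅, fun f _ => map_zero _⟩
  | add a b ha hb =>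
    obtain ⟨S, hS⟩ := ha
    obtain ⟨T, hT⟩ := hb
    refine ⟨S ∪ T, fun f hf => ?_⟩
    rw [map_add, hS f fun x hx => hf x (Finset.mem_union_left _ hx),
      hT f fun x hx => hf x (Finset.mem_union_right _ hx)]
  | tmul a b =>
    obtain ⟨S, hS⟩ := exists_finset_map_eq_self a
    obtain ⟨T, hT⟩ := exists_finset_map_eq_self b
    refine ⟨S ∪ T, fun f hf => ?_⟩
    rw [TensorProduct.map_tmul, hS f fun x hx => hf x (Finset.mem_union_left _ hx),
      hT f fun x hx => hf x (Finset.mem_union_right _ hx)]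

/-- The part of length `n`. -/
noncomputable def component (n : ℕ) : Words R X →ₗ[R] Words R X :=
  ext fun w => if w.length = n then word w else 0

theorem component_of_mem {n : ℕ} {c : Words R X} (hc : c ∈ lengthEq R X n) : component n c = c :=
  eqOn_spanWords (g := LinearMap.id) (fun w hw => by
    simp only [Set.mem_ofPred_eq] at hw
    simp [component, hw]) hc

theorem component_of_mem_of_ne {m n : ℕ} (hmn : m ≠ n) {c : Words R X} (hc : c ∈ lengthEq R X m) :
    component n c = 0 :=
  eqOn_spanWords (g := 0) (fun w hw => by
    simp only [Set.mem_ofPred_eq] at hw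
    simp [component, hw, hmn]) hc

theorem component_mem (n : ℕ) (c : Words R X) : component n c ∈ lengthEq R X n := by
  induction c using words_induction with
  | h0 => simp
  | hadd a b ha hb => rw [map_add]; exact add_mem ha hb
  | hsmul r a ha => rw [map_smul]; exact Submodule.smul_mem _ _ ha
  | hw w =>
    simp only [component, ext_word]
    split_ifs with h
    · exact word_mem h
    · exact zero_mem _

theorem barBd_component (n : ℕ) (c : Words R G) :
    barBd (component (n + 1) c) = component n (barBd c) := by
  have h := hom_eq (f := barBd ∘ₗ component (R := R) (X := G) (n + 1))
    (g := component n ∘ₗ barBd) (fun w => ?_) c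
  · exact h
  simp only [LinearMap.comp_apply]
  have hw : word w ∈ lengthEq R G w.length := word_mem rfl
  rcases Nat.eq_zero_or_pos w.length with h0 | h0
  · obtain rfl := List.length_eq_zero_iff.1 h0
    rw [barBd_nil, component_of_mem_of_ne (by simp) hw, map_zero, map_zero]
  obtain ⟨m, hm⟩ := Nat.exists_eq_add_one.2 h0
  rw [hm] at hw
  rcases eq_or_ne m n with rfl | hmn
  · rw [component_of_mem hw, component_of_mem (barBd_mem_lengthEq hw)]
  · rw [component_of_mem_of_ne (by lia) hw, component_of_mem_of_ne hmn (barBd_mem_lengthEq hw),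
      map_zero]

theorem barBd_sgn (c : Words R G) : barBd (sgn c) = -sgn (barBd c) := by
  have h : ∀ c : Words R G, barBd c = toBar (bd (ofBar c)) := fun _ => rfl
  have h1 : ofBar (sgn c) = -sgn (ofBar c) := by rw [sgn_ofBar, neg_neg]
  rw [h, h, h1, sgn_toBar, map_neg, bd_sgn, neg_neg, neg_neg]

/-! ### The tensor square of the bar complex -/

/-- The boundary map of the tensor square of the bar complex. -/
noncomputable def barTensorBd : Words R G ⊗[R] Words R G →ₗ[R] Words R G ⊗[R] Words R G :=
  (barBd (R := R) (G := G)).rTensor _ + TensorProduct.map sgn barBd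

theorem barTensorBd_tmul (a b : Words R G) :
    barTensorBd (a ⊗ₜ b) = barBd a ⊗ₜ b + sgn a ⊗ₜ[R] barBd b := by
  simp [barTensorBd]

theorem barTensorBd_barTensorBd (t : Words R G ⊗[R] Words R G) :
    barTensorBd (barTensorBd t) = 0 := by
  induction t with
  | zero => simp
  | add s t hs ht => simp only [map_add, hs, ht, add_zero]
  | tmul a b =>
    simp [barTensorBd_tmul, barBd_barBd, barBd_sgn, neg_tmul]

theorem barTensorBd_map (f : G →* N) (t : Words R G ⊗[R] Words R G) :
    barTensorBd (TensorProduct.map (map f) (map f) t) =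
      TensorProduct.map (map f) (map f) (barTensorBd t) := by
  induction t with
  | zero => simp
  | add s t hs ht => simp only [map_add, hs, ht]
  | tmul a b => simp [barTensorBd_tmul, barBd_map, sgn_map]

/-- The diagonal of the bar complex. -/
noncomputable def split : Words R G →ₗ[R] Words R G ⊗[R] Words R G :=
  TensorProduct.map toBar toBar ∘ₗ diagonal ∘ₗ ofBar

theorem split_apply (c : Words R G) :
    split c = TensorProduct.map toBar toBar (diagonal (ofBar c)) := rfl

theorem map_toBar_map (f : G →* N) (t : Words R G ⊗[R] Words R G) :
    TensorProduct.map toBar toBar (TensorProduct.map (map f) (map f) t) =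
      TensorProduct.map (map f) (map f) (TensorProduct.map toBar toBar t) := by
  induction t with
  | zero => simp
  | add s t hs ht => simp only [map_add, hs, ht]
  | tmul a b => simp [toBar_map]

theorem split_map (f : G →* N) (c : Words R G) :
    split (map f c) = TensorProduct.map (map f) (map f) (split c) := by
  rw [split_apply, split_apply, ofBar_map, ← map_diagonal, map_toBar_map]

theorem barTensorBd_toBar (t : Words R G ⊗[R] Words R G) :
    barTensorBd (TensorProduct.map toBar toBar t) =
      TensorProduct.map toBar toBar (tensorBd bd t) := by
  induction t with
  | zero => simp
  | add s t hs ht => simp only [map_add, hs, ht]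
  | tmul a b =>
    simp [barTensorBd_tmul, tensorBd_tmul, toBar_bd, sgn_toBar, neg_tmul, sub_eq_add_neg]

/-- The two extra terms of `tensorBd_diagonal` have the empty word as a factor, and `toBar` kills
it. -/
theorem barTensorBd_split (c : Words R G) : barTensorBd (split c) = split (barBd c) := by
  have h := eq_ofBar_toBar (F := TensorProduct.map toBar toBar ∘ₗ diagonal (R := R) (X := G))
    (fun g c => ?_) (by simp) (bd (ofBar c))
  · simp only [LinearMap.comp_apply] at h
    rw [split_apply, split_apply, barTensorBd_toBar, tensorBd_diagonal, map_sub, map_add, h]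
    simp [barBd]
  · have key : ∀ t : Words R G ⊗[R] Words R G,
        TensorProduct.map toBar toBar (TensorProduct.map (map (g * ·)) (map (g * ·)) t) =
          TensorProduct.map toBar toBar t := by
      intro t
      induction t with
      | zero => simp
      | add s t hs ht => simp only [map_add, hs, ht]
      | tmul a b => simp [toBar_map_mul]
    rw [LinearMap.comp_apply, ← map_diagonal, key]
    rfl

/-- The span of tensor products of words with a condition on the lengths. -/
noncomputable def tensorSpan (R X : Type*) [CommRing R] (P : ℕ → ℕ → Prop) :
    Submodule R (Words R X ⊗[R] Words R X) :=
  Submodule.span R {t | ∃ u v : List X, P u.length v.length ∧ t = word u ⊗ₜ word v}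

theorem tmul_mem_tensorSpan {P : ℕ → ℕ → Prop} {m n : ℕ} (h : P m n) {a b : Words R X}
    (ha : a ∈ lengthEq R X m) (hb : b ∈ lengthEq R X n) : a ⊗ₜ b ∈ tensorSpan R X P := by
  refine mem_of_spanWords (f := (TensorProduct.mk R _ _).flip b) (fun u hu => ?_) ha
  refine mem_of_spanWords (f := TensorProduct.mk R _ _ (word u)) (fun v hv => ?_) hb
  refine Submodule.subset_span ⟨u, v, ?_, rfl⟩
  rw [show u.length = m from hu, show v.length = n from hv]
  exact h

theorem tensorSpan_mono {P P' : ℕ → ℕ → Prop} (h : ∀ i j, P i j → P' i j) :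
    tensorSpan R X P ≤ tensorSpan R X P' :=
  Submodule.span_mono fun _ ⟨u, v, huv, ht⟩ => ⟨u, v, h _ _ huv, ht⟩

theorem mem_of_tensorSpan {A : Type*} [AddCommGroup A] [Module R A]
    {f : Words R X ⊗[R] Words R X →ₗ[R] A} {P : ℕ → ℕ → Prop} {M : Submodule R A}
    (h : ∀ u v, P u.length v.length → f (word u ⊗ₜ word v) ∈ M) {t : Words R X ⊗[R] Words R X}
    (ht : t ∈ tensorSpan R X P) : f t ∈ M := by
  have : tensorSpan R X P ≤ M.comap f := by
    rw [tensorSpan, Submodule.span_le]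
    rintro _ ⟨u, v, huv, rfl⟩
    exact h u v huv
  exact this ht

theorem barBd_word_mem {u : List G} {n : ℕ} (hu : u.length = n) :
    barBd (word (R := R) u) ∈ lengthEq R G (n - 1) := by
  cases n with
  | zero =>
    obtain rfl := List.length_eq_zero_iff.1 hu
    rw [barBd_nil]
    exact zero_mem _
  | succ n => exact barBd_mem_lengthEq (word_mem hu)

theorem sgn_mem_lengthEq {n : ℕ} {c : Words R X} (hc : c ∈ lengthEq R X n) :
    sgn c ∈ lengthEq R X n :=
  mem_of_spanWords (fun w hw => by
    rw [sgn_word]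
    exact Submodule.smul_mem _ _ (word_mem hw)) hc

theorem barTensorBd_mem {p : ℕ} {t : Words R G ⊗[R] Words R G}
    (ht : t ∈ tensorSpan R G fun i _ => i ≤ p) :
    barTensorBd t ∈ tensorSpan R G fun i _ => i ≤ p := by
  refine mem_of_tensorSpan (fun u v hu => ?_) ht
  rw [barTensorBd_tmul]
  refine add_mem ?_ ?_
  · exact tmul_mem_tensorSpan (m := u.length - 1) (n := v.length) (by lia) (barBd_word_mem rfl)
      (word_mem rfl)
  · exact tmul_mem_tensorSpan (m := u.length) (n := v.length - 1) hu
      (sgn_mem_lengthEq (word_mem rfl)) (barBd_word_mem rfl)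

/-- The coefficients of a tensor with respect to the words in the first factor. -/
noncomputable def coefficients :
    Words R X ⊗[R] Words R X →ₗ[R] (List X →₀ Words R X) :=
  TensorProduct.lift (ext fun u => Finsupp.lsingle u)

theorem coefficients_tmul (u : List X) (b : Words R X) :
    coefficients (word u ⊗ₜ[R] b) = Finsupp.single u b := by simp [coefficients]

theorem sum_coefficients (t : Words R X ⊗[R] Words R X) :
    ∑ u ∈ (coefficients t).support, word u ⊗ₜ[R] coefficients t u = t := by
  have h : Finsupp.lsum R (fun u : List X => TensorProduct.mk R (Words R X) (Words R X) (word u)) ∘ₗ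
      coefficients = LinearMap.id := by
    refine TensorProduct.ext (hom_ext fun u => LinearMap.ext fun b => ?_)
    simp [coefficients_tmul]
  exact LinearMap.congr_fun h t

theorem coefficients_mem {P : ℕ → ℕ → Prop} {t : Words R X ⊗[R] Words R X}
    (ht : t ∈ tensorSpan R X P) (u : List X) :
    coefficients t u ∈ spanWords R {v : List X | P u.length v.length} := by
  refine mem_of_tensorSpan (f := Finsupp.lapply u ∘ₗ coefficients) (fun u' v h => ?_) ht
  simp only [LinearMap.comp_apply, coefficients_tmul, Finsupp.lapply_apply]
  rcases eq_or_ne u' u with rfl | hu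
  · rw [Finsupp.single_eq_same]
    exact word_mem h
  · rw [Finsupp.single_eq_of_ne' hu]
    exact zero_mem _

theorem coefficients_eq_zero {P : ℕ → ℕ → Prop} {t : Words R X ⊗[R] Words R X}
    (ht : t ∈ tensorSpan R X P) (u : List X) (hu : ∀ j, ¬ P u.length j) :
    coefficients t u = 0 := by
  have h := coefficients_mem ht u
  have h2 : {v : List X | P u.length v.length} = ∅ := Set.eq_empty_of_forall_notMem fun v => hu _
  rw [h2, spanWords, Set.image_empty, Submodule.span_empty] at h
  exact h

theorem coefficients_map_sgn (d : Words R X →ₗ[R] Words R X) (t : Words R X ⊗[R] Words R X)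
    (u : List X) :
    coefficients (TensorProduct.map sgn d t) u = (-1 : R) ^ u.length • d (coefficients t u) := by
  have h : Finsupp.lapply u ∘ₗ coefficients ∘ₗ TensorProduct.map sgn d =
      ((-1 : R) ^ u.length • d) ∘ₗ Finsupp.lapply u ∘ₗ coefficients := by
    refine TensorProduct.ext (hom_ext fun u' => LinearMap.ext fun b => ?_)
    change coefficients (TensorProduct.map sgn d (word u' ⊗ₜ b)) u =
      (-1 : R) ^ u.length • d (coefficients (word u' ⊗ₜ b) u)
    rw [TensorProduct.map_tmul, sgn_word, ← TensorProduct.smul_tmul', map_smul, coefficients_tmul,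
      coefficients_tmul, Finsupp.smul_apply]
    rcases eq_or_ne u' u with rfl | hu
    · simp
    · simp [Finsupp.single_eq_of_ne' hu]
  exact LinearMap.congr_fun h t

/-- The coefficients of `a` are cycles of degree strictly between `0` and `n`, hence boundaries of
chains `y u`. The sum of the `± u ⊗ y u` has as its boundary `a` and terms of smaller first degree,
so a cycle can be pushed one step down the filtration by the first degree. -/
theorem exists_barTensorBd_sub_mem {n p : ℕ}
    (hac : ∀ j, 1 ≤ j → j < n → ∀ x ∈ lengthEq R G j, barBd x = 0 →
      ∃ y ∈ lengthEq R G (j + 1), barBd y = x) {a : Words R G ⊗[R] Words R G}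
    (ha : a ∈ tensorSpan R G fun i j => i = p + 1 ∧ 1 ≤ j ∧ i + j = n)
    (hd : ∀ u, barBd (coefficients a u) = 0) :
    ∃ b c : Words R G ⊗[R] Words R G,
      c ∈ tensorSpan R G (fun i j => 1 ≤ i ∧ i ≤ p ∧ 1 ≤ j ∧ i + j = n) ∧
      barTensorBd b = c + a := by
  have hsupp : ∀ u, coefficients a u ≠ 0 → u.length = p + 1 ∧ 1 ≤ n - (p + 1) ∧ p + 1 < n := by
    intro u hu
    by_contra hlen
    exact hu (coefficients_eq_zero ha u fun j => by lia)
  have hy : ∀ u, ∃ y ∈ lengthEq R G (n - (p + 1) + 1), barBd y = coefficients a u := by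
    intro u
    by_cases hu : coefficients a u = 0
    · exact ⟨0, zero_mem _, by rw [hu, map_zero]⟩
    obtain ⟨h1, h2, h3⟩ := hsupp u hu
    refine hac _ h2 (by lia) _ (spanWords_mono ?_ (coefficients_mem ha u)) (hd u)
    intro v hv
    simp only [Set.mem_ofPred_eq] at hv ⊢
    lia
  choose y hymem hyd using hy
  refine ⟨∑ u ∈ (coefficients a).support, (-1 : R) ^ u.length • (word u ⊗ₜ[R] y u),
    ∑ u ∈ (coefficients a).support, (-1 : R) ^ u.length • (barBd (word u) ⊗ₜ[R] y u), ?_, ?_⟩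
  · refine Submodule.sum_mem _ fun u hu => Submodule.smul_mem _ _ ?_
    obtain ⟨h1, h2, h3⟩ := hsupp u (Finsupp.mem_support_iff.1 hu)
    cases p with
    | zero =>
      -- One-letter words are cycles in the bar complex, so no term of first degree zero arises.
      obtain ⟨x, rfl⟩ := List.length_eq_one_iff.1 h1
      rw [barBd_singleton, TensorProduct.zero_tmul]
      exact zero_mem _
    | succ p =>
      exact tmul_mem_tensorSpan (m := p + 1 + 1 - 1) (n := n - (p + 1 + 1) + 1) (by lia)
        (barBd_word_mem h1) (hymem u)
  · refine Eq.trans ?_ (congrArg (_ + ·) (sum_coefficients a))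
    rw [map_sum, ← Finset.sum_add_distrib]
    refine Finset.sum_congr rfl fun u _ => ?_
    rw [map_smul, barTensorBd_tmul, smul_add, sgn_word, ← TensorProduct.smul_tmul', smul_smul,
      ← mul_pow, hyd]
    simp

/-- If the bar complex is exact in the degrees between `1` and `n - 1`, then a cycle of total degree
`n` in the part of the tensor square where both degrees are positive is a boundary. -/
theorem mem_range_barTensorBd {n : ℕ}
    (hac : ∀ j, 1 ≤ j → j < n → ∀ x ∈ lengthEq R G j, barBd x = 0 →
      ∃ y ∈ lengthEq R G (j + 1), barBd y = x) (p : ℕ) {m : Words R G ⊗[R] Words R G}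
    (hm : m ∈ tensorSpan R G fun i j => 1 ≤ i ∧ i ≤ p ∧ 1 ≤ j ∧ i + j = n)
    (hm0 : barTensorBd m = 0) : ∃ b, barTensorBd b = m := by
  induction p generalizing m with
  | zero =>
    have h : tensorSpan R G (fun i j => 1 ≤ i ∧ i ≤ 0 ∧ 1 ≤ j ∧ i + j = n) ≤ ⊥ := by
      rw [tensorSpan, Submodule.span_le]
      rintro _ ⟨u, v, huv, rfl⟩
      lia
    exact ⟨0, by rw [map_zero, (Submodule.mem_bot R).1 (h hm)]⟩
  | succ p ih =>
    have hle : tensorSpan R G (fun i j => 1 ≤ i ∧ i ≤ p + 1 ∧ 1 ≤ j ∧ i + j = n) ≤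
        tensorSpan R G (fun i j => i = p + 1 ∧ 1 ≤ j ∧ i + j = n) ⊔
        tensorSpan R G (fun i j => 1 ≤ i ∧ i ≤ p ∧ 1 ≤ j ∧ i + j = n) := by
      rw [tensorSpan, Submodule.span_le]
      rintro _ ⟨u, v, huv, rfl⟩
      by_cases hu : u.length = p + 1
      · exact Submodule.mem_sup_left (Submodule.subset_span ⟨u, v, by lia, rfl⟩)
      · exact Submodule.mem_sup_right (Submodule.subset_span ⟨u, v, by lia, rfl⟩)
    obtain ⟨a, ha, m', hm', rfl⟩ := Submodule.mem_sup.1 (hle hm)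
    have hsupp : ∀ u, coefficients a u ≠ 0 → u.length = p + 1 ∧ 1 ≤ n - (p + 1) ∧ p + 1 < n := by
      intro u hu
      by_contra hlen
      exact hu (coefficients_eq_zero ha u fun j => by lia)
    -- In first degree `p + 1` the boundary of the given cycle is, up to sign, given by the
    -- boundaries of the coefficients of `a` alone: all other terms have first degree at most `p`.
    have hd : ∀ u, barBd (coefficients a u) = 0 := by
      intro u
      by_cases hu : coefficients a u = 0
      · rw [hu, map_zero]
      have hlen := (hsupp u hu).1
      have h1 : coefficients ((barBd (R := R) (G := G)).rTensor _ a + barTensorBd m') u = 0 := by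
        refine coefficients_eq_zero (P := fun i _ => i ≤ p) (add_mem ?_ ?_) u (by lia)
        · refine mem_of_tensorSpan (fun u v huv => ?_) ha
          rw [LinearMap.rTensor_tmul]
          exact tmul_mem_tensorSpan (m := u.length - 1) (n := v.length) (by lia)
            (barBd_word_mem rfl) (word_mem rfl)
        · exact barTensorBd_mem (tensorSpan_mono (by lia) hm')
      have h2 : coefficients (TensorProduct.map sgn barBd a) u = 0 := by
        have h3 : TensorProduct.map sgn barBd a +
            ((barBd (R := R) (G := G)).rTensor _ a + barTensorBd m') = 0 := by
          rw [← hm0, map_add]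
          simp only [barTensorBd, LinearMap.add_apply]
          abel
        have h4 := DFunLike.congr_fun (congrArg coefficients h3) u
        rwa [map_add, Finsupp.add_apply, h1, add_zero, map_zero] at h4
      rw [coefficients_map_sgn] at h2
      have h5 := congrArg (fun x => (-1 : R) ^ u.length • x) h2
      simpa [smul_smul, ← mul_pow] using h5
    obtain ⟨b, c, hc, hb⟩ := exists_barTensorBd_sub_mem hac ha hd
    have h0 : barTensorBd (m' - c) = 0 := by
      have h1 : m' - c = (a + m') - barTensorBd b := by
        rw [hb, add_comm c a, add_sub_add_left_eq_sub]
      rw [h1, map_sub, hm0, barTensorBd_barTensorBd, sub_zero]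
    obtain ⟨b', hb'⟩ := ih (sub_mem hm' hc) h0
    exact ⟨b + b', by rw [map_add, hb, hb', add_comm c a, add_assoc, add_sub_cancel]⟩

/-- Here `l` is the last letter. In every other Alexander-Whitney term the second factor has at
least two letters, so it keeps a positive degree after `toBar`. -/
theorem mem_of_diagonal_word (w : List X) (hw : w ≠ []) : ∃ l : X,
    diagonal (word (R := R) w) - word w ⊗ₜ[R] word [l] ∈
      tensorSpan R X fun i j => 1 ≤ i ∧ 2 ≤ j ∧ i + j = w.length + 1 := by
  induction w with
  | nil => exact absurd rfl hw
  | cons x w ih =>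
    rcases eq_or_ne w [] with rfl | hw'
    · refine ⟨x, ?_⟩
      rw [← cone_word, diagonal_cone]
      simp
    · obtain ⟨l, hl⟩ := ih hw'
      refine ⟨l, ?_⟩
      have h : diagonal (word (R := R) (x :: w)) - word (x :: w) ⊗ₜ[R] word [l] =
          word [x] ⊗ₜ[R] word (x :: w) + (cone x).rTensor _ (diagonal (word (R := R) w) -
            word w ⊗ₜ[R] word [l]) := by
        rw [← cone_word x w, diagonal_cone, map_sub, LinearMap.rTensor_tmul]
        abel
      rw [h]
      have hpos := List.length_pos_of_ne_nil hw'
      refine add_mem (tmul_mem_tensorSpan (m := 1) (n := w.length + 1)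
        (by simp only [List.length_cons]; lia) (word_mem rfl) (word_mem (by simp))) ?_
      refine mem_of_tensorSpan (fun u v huv => ?_) hl
      rw [LinearMap.rTensor_tmul, cone_word]
      exact tmul_mem_tensorSpan (m := u.length + 1) (n := v.length)
        (by simp only [List.length_cons]; lia) (word_mem rfl) (word_mem rfl)

/-- Among the Alexander-Whitney terms only the first and the last have a factor of bar degree zero;
they are the two that are subtracted. -/
theorem split_sub_mem {n : ℕ} (hn : 1 ≤ n) {c : Words R G} (hc : c ∈ lengthEq R G n) :
    split c - c ⊗ₜ[R] word [] - word [] ⊗ₜ[R] c ∈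
      tensorSpan R G fun i j => 1 ≤ i ∧ i ≤ n ∧ 1 ≤ j ∧ i + j = n := by
  refine mem_of_spanWords (f := split - (TensorProduct.mk R _ _).flip (word []) -
    TensorProduct.mk R _ _ (word [])) (fun w hw => ?_) hc
  cases w with
  | nil => simp only [Set.mem_ofPred_eq, List.length_nil] at hw; lia
  | cons g w =>
    simp only [LinearMap.sub_apply, LinearMap.flip_apply, TensorProduct.mk_apply, split_apply,
      ofBar_word, path, one_mul]
    obtain ⟨l, hl⟩ := mem_of_diagonal_word (R := R) (path g w) (by cases w <;> simp [path])
    rw [← cone_word, diagonal_cone, map_add, TensorProduct.map_tmul, cone_word]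
    have h1 : toBar (word (R := R) (1 :: path g w)) = word (g :: w) := by
      have := toBar_path (R := R) 1 (g :: w)
      rwa [path, one_mul] at this
    have h2 : ∀ l : G, toBar (word (R := R) [l]) = word [] := fun l => by simp [diffs]
    have h3 : TensorProduct.map toBar toBar ((cone (1 : G)).rTensor _ (word (R := R) (path g w) ⊗ₜ[R]
        word [l])) = word (g :: w) ⊗ₜ[R] word [] := by
      rw [LinearMap.rTensor_tmul, TensorProduct.map_tmul, cone_word, h1, h2]
    rw [h1, h2, ← h3, add_sub_assoc, ← map_sub, ← map_sub, add_sub_cancel_left]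
    refine mem_of_tensorSpan (f := TensorProduct.map toBar toBar ∘ₗ (cone (1 : G)).rTensor _)
      (fun u v huv => ?_) hl
    rw [LinearMap.comp_apply, LinearMap.rTensor_tmul, TensorProduct.map_tmul, cone_word]
    simp only [length_path] at huv
    simp only [Set.mem_ofPred_eq, List.length_cons] at hw
    exact tmul_mem_tensorSpan (m := u.length) (n := v.length - 1) (by lia)
      (toBar_mem_lengthEq (word_mem (by simp))) (toBar_mem_lengthEq (word_mem (by simp; lia)))

end WordComplex

/-! ### Acyclicity of binate groups -/

namespace WordComplex

open TensorProduct

variable {R : Type*} [CommRing R] {K G : Type*} [Group K] [Group G]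

section Commuting

variable {α β : K →* G} (hc : ∀ a b, α a * β b = β b * α a)

-- This is the Leibniz rule `bd_shuffle`; its correction term is a multiple of the empty word and
-- disappears under `toBar`.
include hc in
theorem barBd_barProduct (t : Words R K ⊗[R] Words R K) :
    barBd (barProduct α β t) = barProduct α β (barTensorBd t) := by
  induction t with
  | zero => simp
  | add s t hs ht => simp only [map_add, hs, ht]
  | tmul a b =>
    have h1 := barProduct_toBar (R := R) hc (bd (ofBar a) ⊗ₜ ofBar b)
    have h2 := barProduct_toBar (R := R) hc (ofBar (sgn a) ⊗ₜ bd (ofBar b))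
    rw [TensorProduct.map_tmul, toBar_ofBar] at h1 h2
    have h3 : ∀ c : Words R K, barBd c = toBar (bd (ofBar c)) := fun _ => rfl
    rw [barTensorBd_tmul, map_add (barProduct α β), h3 a, h3 b, h1, h2]
    simp only [barProduct, LinearMap.comp_apply, TensorProduct.map_tmul, shuffleTensor,
      TensorProduct.lift.tmul]
    rw [← toBar_bd, bd_map, bd_shuffle, sgn_ofBar]
    simp

/-- The product of the homomorphisms `α` and `β` induces on cycles, up to boundaries, the product
along `α` and `β` of the diagonal. -/
theorem barProduct_split_sub_mem_range {z : Words R K} (hz : barBd z = 0) :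
    barProduct α β (split z) - map (mulHom α β hc) z ∈
      LinearMap.range (barBd (R := R) (G := G)) := by
  have h := toBar_ofBar_mem_range
    (T := map (fun p : K × K => α p.1 * β p.2) ∘ₗ diagonalDefect (R := R) K)
    (fun c => by simp only [LinearMap.comp_apply, bd_map, bd_diagonalDefect])
    (by simp [diagonalDefect_apply]) (mulHom α β hc) (fun k c => by
      simp only [LinearMap.comp_apply]
      rw [← map_diagonalDefect, map_map, map_map]
      congr 2
      ext ⟨x, y⟩
      simp only [Function.comp_apply, Prod.map, map_mul, mulHom, MonoidHom.coe_mk, OneHom.coe_mk]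
      rw [mul_assoc (α k), ← mul_assoc (α x), hc x k]
      simp only [mul_assoc]) hz
  rw [LinearMap.comp_apply, diagonalDefect_apply, aug_ofBar, zero_smul, add_zero, map_sub, map_sub,
    ← barProduct_toBar hc, ← split_apply, map_map] at h
  have h2 : (fun p : K × K => α p.1 * β p.2) ∘ (fun x : K => (x, x)) = mulHom α β hc := rfl
  rwa [h2, toBar_map, toBar_ofBar] at h

theorem barProduct_nil_right (z : Words R K) :
    barProduct α β (z ⊗ₜ[R] word []) = map α z := by
  simp only [barProduct, LinearMap.comp_apply, TensorProduct.map_tmul, shuffleTensor,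
    TensorProduct.lift.tmul, ofBar_word, path]
  rw [shuffle_singleton _ _ (aug_ofBar z), map_map]
  have h2 : (fun p : K × K => α p.1 * β p.2) ∘ (fun x : K => (x, 1)) = α := by
    ext; simp
  rw [h2, toBar_map, toBar_ofBar]

theorem barProduct_nil_left (z : Words R K) :
    barProduct α β (word [] ⊗ₜ[R] z) = map β z := by
  simp only [barProduct, LinearMap.comp_apply, TensorProduct.map_tmul, shuffleTensor,
    TensorProduct.lift.tmul, ofBar_word, path]
  rw [shuffle_singleton_left _ _ (aug_ofBar z), map_map]
  have h2 : (fun p : K × K => α p.1 * β p.2) ∘ (fun x : K => (1, x)) = β := by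
    ext; simp
  rw [h2, toBar_map, toBar_ofBar]

end Commuting

/-- A group is binate if each finite subset lies in a subgroup `K` with a homomorphism `φ` from `K`
to the group, whose image commutes with `K`, such that `k φ(k)` is conjugate to `φ(k)` by an element
that does not depend on `k`. -/
def IsBinate (G : Type*) [Group G] : Prop :=
  ∀ S : Finset G, ∃ (K : Subgroup G) (φ : K →* G) (g : G), (S : Set G) ⊆ K ∧
    (∀ a b : K, (a : G) * φ b = φ b * a) ∧ ∀ k : K, g * (k * φ k) * g⁻¹ = φ k

/-- The bar complex of a binate group is exact in positive degrees. -/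
theorem exists_barBd_eq (hG : IsBinate G) {n : ℕ} (hn : 1 ≤ n) {z : Words R G}
    (hz : z ∈ lengthEq R G n) (hz0 : barBd z = 0) : ∃ y ∈ lengthEq R G (n + 1), barBd y = z := by
  classical
  induction n using Nat.strong_induction_on generalizing z with
  | _ n ih =>
    -- Any bounding chain may be replaced by its component of length `n + 1`.
    suffices h : ∃ y, barBd y = z by
      obtain ⟨y, hy⟩ := h
      exact ⟨component (n + 1) y, component_mem _ _, by
        rw [barBd_component, hy, component_of_mem hz]⟩
    have h0 : ∀ z : Words R G, barBd z = 0 →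
        barTensorBd (split z - z ⊗ₜ[R] word [] - word [] ⊗ₜ[R] z) = 0 := fun z hz0 => by
      rw [map_sub, map_sub, barTensorBd_split, hz0, barTensorBd_tmul, barTensorBd_tmul, hz0,
        barBd_nil]
      simp
    -- The reduced diagonal of `z` is a cycle in which both degrees are positive, hence both are
    -- less than `n`, where exactness is known by induction.
    obtain ⟨b, hb⟩ := mem_range_barTensorBd (fun j h1 h2 x hx hx0 => ih j h2 h1 hx hx0) n
      (split_sub_mem hn hz) (h0 z hz0)
    obtain ⟨S, hS⟩ := exists_finset_map_eq_self z
    obtain ⟨T, hT⟩ := exists_finset_map_eq_self_tensor b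
    obtain ⟨K, φ, g, hK, hcomm, hconj⟩ := hG (S ∪ T)
    -- A retraction of sets is enough: applied letter by letter it pulls chains with letters in `S ∪
    -- T` back to `K`. It need not be a homomorphism.
    let r : G → K := fun x => if hx : x ∈ K then ⟨x, hx⟩ else 1
    have hr : ∀ x : K, r x = x := fun x => by simp [r]
    have hr' : ∀ x ∈ S ∪ T, ((r x : K) : G) = x := fun x hx => by
      have : x ∈ K := hK hx
      simp [r, this]
    have hleft : ∀ c : Words R K, map r (map K.subtype c) = c := fun c => by
      rw [map_map, show r ∘ K.subtype = id from funext hr, map_id]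
    have hleft2 : ∀ t : Words R K ⊗[R] Words R K,
        TensorProduct.map (map r) (map r) (TensorProduct.map (map K.subtype) (map K.subtype) t) =
          t := fun t => by
      induction t with
      | zero => simp
      | add s t hs ht => simp only [map_add, hs, ht]
      | tmul a b => simp only [TensorProduct.map_tmul, hleft]
    obtain ⟨zK, hzK⟩ : ∃ zK : Words R K, map K.subtype zK = z :=
      ⟨map r z, by rw [map_map]; exact hS _ fun x hx => hr' x (Finset.mem_union_left _ hx)⟩
    obtain ⟨bK, hbK⟩ : ∃ bK : Words R K ⊗[R] Words R K,
        TensorProduct.map (map K.subtype) (map K.subtype) bK = b := by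
      refine ⟨TensorProduct.map (map r) (map r) b, ?_⟩
      have h := hT (K.subtype ∘ r) fun x hx => hr' x (Finset.mem_union_right _ hx)
      have h2 : ∀ t : Words R G ⊗[R] Words R G,
          TensorProduct.map (map K.subtype) (map K.subtype)
            (TensorProduct.map (map r) (map r) t) =
          TensorProduct.map (map (K.subtype ∘ r)) (map (K.subtype ∘ r)) t := fun t => by
        induction t with
        | zero => simp
        | add s t hs ht => simp only [map_add, hs, ht]
        | tmul a b => simp only [TensorProduct.map_tmul, map_map]
      rw [h2, h]
    have hzK0 : barBd zK = 0 := by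
      rw [← hleft (barBd zK), ← barBd_map, hzK, hz0, map_zero]
    have hbK0 : barTensorBd bK = split zK - zK ⊗ₜ[R] word [] - word [] ⊗ₜ[R] zK := by
      have h1 : TensorProduct.map (map K.subtype) (map K.subtype)
          (split zK - zK ⊗ₜ[R] word [] - word [] ⊗ₜ[R] zK) = barTensorBd b := by
        rw [hb, map_sub, map_sub, ← split_map, hzK, TensorProduct.map_tmul, TensorProduct.map_tmul,
          hzK, map_word, List.map_nil]
      rw [← hleft2 (barTensorBd bK), ← barTensorBd_map, hbK, ← h1, hleft2]
    have hα : ∀ a b : K, K.subtype a * φ b = φ b * K.subtype a := hcomm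
    -- Modulo boundaries, the product of the diagonal of `zK` is its image under `k ↦ k φ(k)` by
    -- `h1`, and `z + φ z` by `h2`; by `h3` the homomorphisms `k ↦ k φ(k)` and `φ` have the same
    -- effect on `zK`. The three relations leave `z`.
    have h1 := barProduct_split_sub_mem_range hα hzK0
    have h2 : barProduct K.subtype φ (split zK - zK ⊗ₜ[R] word [] - word [] ⊗ₜ[R] zK) ∈
        LinearMap.range (barBd (R := R) (G := G)) :=
      ⟨barProduct K.subtype φ bK, by rw [barBd_barProduct hα, hbK0]⟩
    rw [map_sub, map_sub, barProduct_nil_left, barProduct_nil_right, hzK] at h2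
    have h3 : map (MulAut.conj g) (map (mulHom K.subtype φ hα) zK) -
        map (mulHom K.subtype φ hα) zK ∈ LinearMap.range (barBd (R := R) (G := G)) :=
      map_conj_sub_mem_range g (by rw [barBd_map, hzK0, map_zero])
    have h4 : (MulAut.conj g : G → G) ∘ (mulHom K.subtype φ hα) = φ := by
      ext k
      exact hconj k
    rw [map_map, h4] at h3
    have h5 := sub_mem (sub_mem h1 h2) h3
    have h6 : barProduct K.subtype φ (split zK) - map (mulHom K.subtype φ hα) zK -
        (barProduct K.subtype φ (split zK) - z - map φ zK) -
        (map φ zK - map (mulHom K.subtype φ hα) zK) = z := by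
      abel
    rw [h6] at h5
    exact h5

end WordComplex

/-! ### Comparison of the bar complex with the inhomogeneous chains -/

namespace WordComplex

variable {R : Type*} [CommRing R] {G X : Type*} [Group G]

theorem smul_smul_comm (a b : R) (c : Words R X) : a • b • c = b • a • c := smul_comm a b c

theorem bd_ofFn {n : ℕ} (f : Fin (n + 1) → X) : bd (word (R := R) (List.ofFn f)) =
    ∑ i : Fin (n + 1), (-1 : R) ^ (i : ℕ) • word (List.ofFn (f ∘ i.succAbove)) := by
  induction n with
  | zero =>
    simp [List.ofFn_succ, bd_cons]
  | succ n ih =>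
    rw [List.ofFn_succ, bd_cons, ih, map_sum, sub_eq_add_neg, ← Finset.sum_neg_distrib]
    conv_rhs => rw [Fin.sum_univ_succ]
    congr 1
    · simp [Function.comp_def]
    · refine Finset.sum_congr rfl fun i _ => ?_
      rw [map_smul, cone_word, List.ofFn_succ (f := f ∘ _)]
      simp [pow_succ, Function.comp_def]

theorem path_ofFn {n : ℕ} (k : G) (g : Fin n → G) :
    path k (List.ofFn g) = List.ofFn fun i => k * Fin.partialProd g i := by
  induction n generalizing k with
  | zero => simp [path]
  | succ n ih =>
    rw [List.ofFn_succ, path, ih, List.ofFn_succ (f := fun i => k * Fin.partialProd g i)]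
    simp [Fin.partialProd_succ', mul_assoc, Fin.tail_def]

theorem toBar_ofFn_partialProd {n : ℕ} (g : Fin n → G) :
    toBar (word (R := R) (List.ofFn (Fin.partialProd g))) = word (List.ofFn g) := by
  have := toBar_path (R := R) 1 (List.ofFn g)
  rw [path_ofFn] at this
  simpa using this

/-- Omitting the first of the partial products `1, g₀, g₀g₁, …` leaves a word that starts with `g₀`,
and `toBar` translates it back to `1`. Omitting another one multiplies two neighbours, or drops the
last entry. -/
theorem barBd_ofFn {n : ℕ} (g : Fin (n + 1) → G) : barBd (word (R := R) (List.ofFn g)) =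
    word (List.ofFn fun i => g i.succ) + ∑ j : Fin (n + 1),
      (-1 : R) ^ ((j : ℕ) + 1) • word (List.ofFn (Fin.contractNth j (· * ·) g)) := by
  have h : barBd (word (R := R) (List.ofFn g)) = toBar (bd (ofBar (word (List.ofFn g)))) := rfl
  have h1 : path 1 (List.ofFn g) = List.ofFn (Fin.partialProd g) := by
    rw [path_ofFn]; simp
  rw [h, ofBar_word, h1, bd_ofFn, map_sum, Fin.sum_univ_succ]
  congr 1
  · have h2 : List.ofFn (Fin.partialProd g ∘ (0 : Fin (n + 2)).succAbove) =
        (List.ofFn (Fin.partialProd (Fin.tail g))).map (g 0 * ·) := by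
      rw [List.map_ofFn]
      congr 1
      ext i
      simp [Fin.partialProd_succ']
    rw [h2, ← map_word, map_smul, toBar_map_mul, toBar_ofFn_partialProd]
    simp [Fin.tail_def]
  · refine Finset.sum_congr rfl fun j _ => ?_
    rw [map_smul, ← Fin.partialProd_contractNth, toBar_ofFn_partialProd]
    rfl

/-- The words of length `n` as functions on `Fin n`. -/
noncomputable def ofTuples (R X : Type*) [CommRing R] (n : ℕ) : ((Fin n → X) →₀ R) →ₗ[R] Words R X :=
  Finsupp.lmapDomain R R List.ofFn

theorem ofTuples_single {n : ℕ} (g : Fin n → X) (r : R) :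
    ofTuples R X n (Finsupp.single g r) = r • word (List.ofFn g) := by
  have h : ofTuples R X n (Finsupp.single g r) = (Finsupp.single (List.ofFn g) r : List X →₀ R) :=
    Finsupp.mapDomain_single
  rw [h]
  exact (Finsupp.smul_single_one _ r).symm

theorem ofTuples_injective (n : ℕ) : Function.Injective (ofTuples R X n) :=
  Finsupp.mapDomain_injective List.ofFn_injective

theorem range_ofTuples (n : ℕ) : LinearMap.range (ofTuples R X n) = lengthEq R X n := by
  apply le_antisymm
  · rintro _ ⟨x, rfl⟩
    induction x using Finsupp.induction_linear with
    | zero => simp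
    | add x y hx hy => rw [map_add]; exact add_mem hx hy
    | single g r =>
      rw [ofTuples_single]
      exact Submodule.smul_mem _ _ (word_mem (by simp))
  · rw [lengthEq, spanWords, Submodule.span_le]
    rintro _ ⟨w, rfl, rfl⟩
    exact ⟨Finsupp.single w.get 1, by rw [ofTuples_single, one_smul, List.ofFn_get]⟩

end WordComplex

open WordComplex in
theorem ofTuples_inhomogeneousChains {G : Type u} [Group G] (n : ℕ)
    (x : (Fin (n + 1) → G) →₀ ULift.{u} ℤ) :
    ofTuples (ULift.{u} ℤ) G n (groupHomology.inhomogeneousChains.d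
      (Rep.trivial (ULift.{u} ℤ) G (ULift.{u} ℤ)) n x) = barBd (ofTuples (ULift.{u} ℤ) G (n + 1) x) := by
  induction x using Finsupp.induction_linear with
  | zero => simp
  | add x y hx hy => rw [map_add, map_add, hx, hy, map_add, map_add]
  | single g r =>
    rw [groupHomology.inhomogeneousChains.d_single, ofTuples_single, map_smul, barBd_ofFn]
    rw [map_add, map_sum, ofTuples_single, smul_add, Finset.smul_sum]
    congr 1
    refine Finset.sum_congr rfl fun j _ => ?_
    rw [map_smul, ofTuples_single]
    exact smul_smul_comm _ _ _

open WordComplex in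
theorem acyclicGroup_of_isBinate {G : Type u} [Group G] (hG : IsBinate G) : AcyclicGroup G := by
  intro n hn
  obtain ⟨n, rfl⟩ := Nat.exists_eq_add_one.2 hn
  refine subsingleton_of_forall_eq 0 fun x => ?_
  induction x using groupHomology_induction_on with
  | h c =>
    let A := Rep.trivial (ULift.{u} ℤ) G (ULift.{u} ℤ)
    let f : (Fin (n + 1) → G) →₀ ULift.{u} ℤ := groupHomology.iCycles A (n + 1) c
    have hf : groupHomology.inhomogeneousChains.d A n f = 0 := by
      rw [← groupHomology.inhomogeneousChains.d_def]
      exact congr($(HomologicalComplex.iCycles_d (groupHomology.inhomogeneousChains A) (n + 1) n) c)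
    have hz : barBd (ofTuples (ULift.{u} ℤ) G (n + 1) f) = 0 := by
      rw [← ofTuples_inhomogeneousChains]
      exact (congrArg _ hf).trans (map_zero _)
    obtain ⟨y, hy, hyz⟩ := exists_barBd_eq hG (n := n + 1) (by lia)
      (range_ofTuples (R := ULift.{u} ℤ) (X := G) (n + 1) ▸ ⟨f, rfl⟩) hz
    rw [← range_ofTuples] at hy
    obtain ⟨f', rfl⟩ := hy
    have hf' : groupHomology.inhomogeneousChains.d A (n + 1) f' = f := by
      refine ofTuples_injective (n + 1) ?_
      rw [← hyz]
      exact ofTuples_inhomogeneousChains (n + 1) f'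
    have hc : c = groupHomology.toCycles A (n + 2) (n + 1) f' := by
      refine (ModuleCat.mono_iff_injective (groupHomology.iCycles A (n + 1))).1 inferInstance ?_
      have h := congr($(HomologicalComplex.toCycles_i (groupHomology.inhomogeneousChains A)
        (n + 2) (n + 1)) f')
      refine Eq.trans ?_ h.symm
      rw [groupHomology.inhomogeneousChains.d_def]
      exact hf'.symm
    rw [hc]
    exact congr($(HomologicalComplex.toCycles_comp_homologyπ (groupHomology.inhomogeneousChains A)
      (n + 2) (n + 1)) f')

/-! ### Modules over a group ring and representations -/

section Representations

variable {Γ : Type u} [Group Γ]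

/-- A linear map between representations is equivariant. -/
def Equivariant {G A B : Type*} [Group G] [AddCommGroup A] [AddCommGroup B]
    (σ : Representation ℤ G A) (τ : Representation ℤ G B) (f : A →ₗ[ℤ] B) : Prop :=
  ∀ g a, f (σ g a) = τ g (f a)

/-- The representation given by a module over the group ring. -/
noncomputable def moduleRep (Γ : Type u) [Group Γ] (X : Type u) [AddCommGroup X]
    [Module (MonoidAlgebra ℤ Γ) X] : Representation ℤ Γ X where
  toFun g := (DistribSMul.toAddMonoidHom X (MonoidAlgebra.single g (1 : ℤ))).toIntLinearMap
  map_one' := by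
    ext x
    change MonoidAlgebra.single (1 : Γ) (1 : ℤ) • x = x
    rw [← MonoidAlgebra.one_def, one_smul]
  map_mul' g h := by
    ext x
    change MonoidAlgebra.single (g * h) (1 : ℤ) • x =
      MonoidAlgebra.single g (1 : ℤ) • MonoidAlgebra.single h (1 : ℤ) • x
    rw [smul_smul, MonoidAlgebra.single_mul_single, mul_one]

/-- An equivariant map is linear over the group ring. -/
def Equivariant.toLinearMap {X Y : Type u} [AddCommGroup X] [AddCommGroup Y]
    [Module (MonoidAlgebra ℤ Γ) X] [Module (MonoidAlgebra ℤ Γ) Y] {f : X →ₗ[ℤ] Y}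
    (hf : Equivariant (moduleRep Γ X) (moduleRep Γ Y) f) : X →ₗ[MonoidAlgebra ℤ Γ] Y where
  toFun := f
  map_add' := map_add f
  map_smul' a x := by
    induction a using MonoidAlgebra.induction_linear with
    | zero => simp
    | add a b ha hb => simp only [add_smul, map_add, ha, hb]
    | single g r =>
      have h : MonoidAlgebra.single g r = r • MonoidAlgebra.single g (1 : ℤ) := by simp
      rw [h, RingHom.id_apply, smul_assoc, smul_assoc, map_smul]
      exact congrArg (r • ·) (hf g x)

theorem equivariant_of_linearMap {X Y : Type u} [AddCommGroup X] [AddCommGroup Y]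
    [Module (MonoidAlgebra ℤ Γ) X] [Module (MonoidAlgebra ℤ Γ) Y] (f : X →ₗ[MonoidAlgebra ℤ Γ] Y) :
    Equivariant (moduleRep Γ X) (moduleRep Γ Y) f.toAddMonoidHom.toIntLinearMap :=
  fun g x => map_smul f (MonoidAlgebra.single g 1) x

/-- The module over the group ring given by a representation. -/
noncomputable abbrev repModule {M : Type u} [AddCommGroup M] (ρ : Representation ℤ Γ M) :
    Module (MonoidAlgebra ℤ Γ) M :=
  Module.compHom M ρ.asAlgebraHom.toRingHom

theorem moduleRep_repModule {M : Type u} [AddCommGroup M] (ρ : Representation ℤ Γ M) :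
    @moduleRep Γ _ M _ (repModule ρ) = ρ := by
  ext g m
  change ρ.asAlgebraHom (MonoidAlgebra.single g (1 : ℤ)) m = ρ g m
  rw [Representation.asAlgebraHom_single, one_smul]

/-- The lifting property of projective modules, for representations. -/
def LiftProj {G : Type u} [Group G] {M : Type u} [AddCommGroup M] (ρ : Representation ℤ G M) : Prop :=
  ∀ ⦃A B : Type u⦄ [AddCommGroup A] [AddCommGroup B] (σ : Representation ℤ G A)
    (τ : Representation ℤ G B) (p : A →ₗ[ℤ] B) (f : M →ₗ[ℤ] B), Equivariant σ τ p →
    Equivariant ρ τ f → Function.Surjective p → ∃ f' : M →ₗ[ℤ] A, Equivariant ρ σ f' ∧ p ∘ₗ f' = f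

/-- For representations, restriction to a subgroup is composition of homomorphisms and needs no
second module structure; therefore projectivity is handled as a lifting property. Conversely,
lifting the identity through a free module splits that module. -/
theorem projective_iff_liftProj {X : Type u} [AddCommGroup X] [Module (MonoidAlgebra ℤ Γ) X] :
    Module.Projective (MonoidAlgebra ℤ Γ) X ↔ LiftProj (moduleRep Γ X) := by
  constructor
  · intro h A B _ _ σ τ p f hp hf hsurj
    let := repModule σ
    let := repModule τ
    rw [← moduleRep_repModule σ, ← moduleRep_repModule τ] at hp
    rw [← moduleRep_repModule τ] at hf
    obtain ⟨l, hl⟩ := Module.projective_lifting_property hp.toLinearMap hf.toLinearMap hsurj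
    refine ⟨l.toAddMonoidHom.toIntLinearMap, ?_, ?_⟩
    · exact fun g x => (equivariant_of_linearMap l g x).trans
        (congrArg (fun s : Representation ℤ Γ A => s g (l x)) (moduleRep_repModule σ))
    · ext x
      exact LinearMap.congr_fun hl x
  · intro h
    refine Module.Projective.of_lifting_property'' fun q hq => ?_
    obtain ⟨s, hs, hs'⟩ := h (moduleRep Γ (X →₀ MonoidAlgebra ℤ Γ)) (moduleRep Γ X)
      q.toAddMonoidHom.toIntLinearMap LinearMap.id (equivariant_of_linearMap q) (fun _ _ => rfl) hq
    exact ⟨hs.toLinearMap, LinearMap.ext fun x => LinearMap.congr_fun hs' x⟩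

theorem projectiveOver_iff_liftProj (H : Subgroup Γ) {X : Type u} [AddCommGroup X]
    [Module (MonoidAlgebra ℤ Γ) X] :
    ProjectiveOver H X ↔ LiftProj ((moduleRep Γ X).comp H.subtype) := by
  let : Module (MonoidAlgebra ℤ H) X :=
    Module.compHom X (MonoidAlgebra.mapDomainRingHom ℤ H.subtype)
  have h : moduleRep H X = (moduleRep Γ X).comp H.subtype := by
    ext g x
    change MonoidAlgebra.mapDomainRingHom ℤ H.subtype (MonoidAlgebra.single g (1 : ℤ)) • x =
      MonoidAlgebra.single (g : Γ) (1 : ℤ) • x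
    simp
  rw [← h]
  exact projective_iff_liftProj

/-- Every representation that is projective over `H` is projective. -/
def LiftsProjective (H : Subgroup Γ) : Prop :=
  ∀ (M : Type u) [AddCommGroup M] (ρ : Representation ℤ Γ M),
    LiftProj (ρ.comp H.subtype) → LiftProj ρ

theorem mooreConjecture_iff (H : Subgroup Γ) :
    MooreConjecture H ↔ MooreCondition H ∧ LiftsProjective H := by
  refine and_congr_right fun _ => ⟨fun h M _ ρ hρ => ?_, fun h M _ _ hM => ?_⟩
  · let := repModule ρ
    rw [← moduleRep_repModule ρ] at hρ ⊢
    exact projective_iff_liftProj.1 (h M ((projectiveOver_iff_liftProj H).2 hρ))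
  · rw [projective_iff_liftProj]
    exact h M _ ((projectiveOver_iff_liftProj H).1 hM)

end Representations

/-! ### Dimension shifting and the powers of the Bockstein -/

section Ext

open Abelian

/-- Dimension shifting: if every map from `S.X₁` to `Q` extends to the projective object `S.X₂`, and
`S.X₁` is a retract of `S.X₃`, then the groups `Ext^n(S.X₃, Q)` are zero for positive `n`. -/
theorem ext_eq_zero_of_retract {C : Type*} [Category* C] [Abelian C] [HasExt C]
    {S : ShortComplex C} (hS : S.ShortExact) [Projective S.X₂] {i : S.X₁ ⟶ S.X₃} {r : S.X₃ ⟶ S.X₁}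
    (hir : i ≫ r = 𝟙 _) {Q : C} (hQ : ∀ f : S.X₁ ⟶ Q, ∃ f' : S.X₂ ⟶ Q, S.f ≫ f' = f) (n : ℕ)
    (x : Ext S.X₃ Q (n + 1)) : x = 0 := by
  induction n with
  | zero =>
    obtain ⟨x₁, rfl⟩ := Ext.contravariant_sequence_exact₃ hS Q x (Ext.eq_zero_of_projective _)
      (n₀ := 0) rfl
    obtain ⟨f, rfl⟩ := (Ext.mk₀_bijective _ _).2 x₁
    obtain ⟨f', rfl⟩ := hQ f
    rw [← Ext.mk₀_comp_mk₀, hS.extClass_comp_assoc]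
  | succ n ih =>
    -- The connecting map lowers the degree and leads from `S.X₃` to `S.X₁`; the retraction leads
    -- back to `S.X₃`, so one sequence serves all degrees.
    obtain ⟨x₁, rfl⟩ := Ext.contravariant_sequence_exact₃ hS Q x (Ext.eq_zero_of_projective _)
      (n₀ := n + 1) (by lia)
    rw [← Ext.mk₀_id_comp x₁, ← hir, ← Ext.mk₀_comp_mk₀_assoc, ih ((Ext.mk₀ r).comp x₁ (zero_add _)),
      Ext.comp_zero, Ext.comp_zero]

theorem ext_eq_zero_of_retract_obj {C : Type*} [Category* C] [Abelian C] [HasExt C]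
    {X Y Q : C} {i : X ⟶ Y} {r : Y ⟶ X} (hir : i ≫ r = 𝟙 _) {n : ℕ}
    (hY : ∀ y : Ext Y Q n, y = 0) (x : Ext X Q n) : x = 0 := by
  rw [← Ext.mk₀_id_comp x, ← hir, ← Ext.mk₀_comp_mk₀_assoc, hY ((Ext.mk₀ r).comp x (zero_add _)),
    Ext.comp_zero]

variable {Γ : Type u} [Group Γ] {H : Subgroup Γ} [H.Normal]

/-- An equivariant map `ℤ → ℤ[Γ/H]` is not a section of the augmentation. -/
theorem not_section_quotientAugmentation (hH : H.index.Prime)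
    (f : TrivialModule Γ →ₗ[MonoidAlgebra ℤ Γ] QuotientModule H)
    (hf : quotientAugmentation H ∘ₗ f = LinearMap.id) : False := by
  have : Finite (Γ ⧸ H) := Nat.finite_of_card_ne_zero hH.ne_zero
  let := Fintype.ofFinite (Γ ⧸ H)
  let e : TrivialModule Γ := ULift.up.{u} (1 : ℤ)
  let y : MonoidAlgebra ℤ (Γ ⧸ H) := f e
  have h1 : augmentation (Γ ⧸ H) y = 1 :=
    congrArg ULift.down (LinearMap.congr_fun hf e)
  have h2 : ∀ g : Γ, MonoidAlgebra.single (QuotientGroup.mk' H g) (1 : ℤ) * y = y := by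
    intro g
    have h3 := map_smul f (MonoidAlgebra.single g (1 : ℤ)) e
    have h4 : MonoidAlgebra.single g (1 : ℤ) • e = e := by
      change augmentation Γ (MonoidAlgebra.single g (1 : ℤ)) • (ULift.up (1 : ℤ)) = ULift.up (1 : ℤ)
      rw [augmentation_single, one_smul]
    rw [h4] at h3
    have h5 : MonoidAlgebra.single g (1 : ℤ) • f e =
      (MonoidAlgebra.mapDomainRingHom ℤ (QuotientGroup.mk' H) (MonoidAlgebra.single g (1 : ℤ)) * y :
        MonoidAlgebra ℤ (Γ ⧸ H)) := rfl
    rw [h5, MonoidAlgebra.mapDomainRingHom_apply, MonoidAlgebra.mapDomain_single] at h3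
    exact h3.symm
  have h3 : ∀ q : Γ ⧸ H, y.coeff q = y.coeff 1 := by
    intro q
    obtain ⟨g, rfl⟩ := QuotientGroup.mk'_surjective H q
    conv_lhs => rw [← h2 g]
    rw [MonoidAlgebra.coeff_single_mul_apply]
    simp
  -- An invariant element has constant coefficients, so its augmentation is divisible by the prime
  -- index and cannot be `1`.
  have h4 : augmentation (Γ ⧸ H) y = Nat.card (Γ ⧸ H) * y.coeff 1 := by
    have h5 : y = ∑ q : Γ ⧸ H, MonoidAlgebra.single q (y.coeff 1) := by
      ext p
      rw [MonoidAlgebra.coeff_sum, Finsupp.finsetSum_apply, Finset.sum_eq_single p]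
      · simp [h3 p]
      · intro q _ hq
        simp [MonoidAlgebra.coeff_single, hq]
      · simp
    conv_lhs => rw [h5]
    rw [map_sum]
    simp [augmentation_single]
  have h5 : ((Nat.card (Γ ⧸ H) : ℕ) : ℤ) ∣ 1 := ⟨y.coeff 1, by rw [← h1, h4]⟩
  have h6 : Nat.card (Γ ⧸ H) = 1 := by exact_mod_cast Int.eq_one_of_dvd_one (by positivity) h5
  exact hH.one_lt.ne' h6

/-- The Bockstein is not nilpotent if the cohomology of `Γ` with values in `ℤ[Γ/H]` is zero in
positive degrees. -/
theorem not_bocksteinNilpotent_of_ext_eq_zero (hH : H.index.Prime)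
    (h : ∀ n (x : Ext (ModuleCat.of (MonoidAlgebra ℤ Γ) (TrivialModule Γ))
      (ModuleCat.of (MonoidAlgebra ℤ Γ) (QuotientModule H)) (n + 1)), x = 0) :
    ¬ BocksteinNilpotent H := by
  rintro ⟨hfin, x, hx, k, hk⟩
  set e₁ := (LinearMap.shortExact_shortComplexKer (quotientAugmentation_surjective H)).extClass
    with he₁
  set e₂ := (shortExact_normMap H x hx).extClass with he₂
  -- In positive degrees a class killed by `e₁` or by `e₂` comes from cohomology with values in
  -- `ℤ[Γ/H]`, hence is zero. So `β^(k+1) e₁ = 0` implies `β^k e₁ e₂ = β^(k+1) = 0`, and this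
  -- implies `β^k e₁ = 0`. The descent ends with `e₁ = 0`, a section of the augmentation.
  have key : ∀ k, (cohomologyPow (bockstein H x hx) k).comp e₁ rfl ≠ 0 := by
    intro k
    induction k with
    | zero =>
      intro h0
      obtain ⟨y, hy⟩ := Ext.covariant_sequence_exact₃ _
        (LinearMap.shortExact_shortComplexKer (quotientAugmentation_surjective H)) _ rfl h0
      obtain ⟨f, rfl⟩ := (Ext.mk₀_bijective _ _).2 y
      rw [Ext.mk₀_comp_mk₀] at hy
      have hy2 := (Ext.mk₀_bijective _ _).1 hy
      exact not_section_quotientAugmentation hH f.hom (congrArg ModuleCat.Hom.hom hy2)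
    | succ k ih =>
      intro h0
      obtain ⟨y, hy⟩ := Ext.covariant_sequence_exact₃ _
        (LinearMap.shortExact_shortComplexKer (quotientAugmentation_surjective H)) _ rfl h0
      have hk0 : cohomologyPow (bockstein H x hx) (k + 1) = 0 := by
        rw [← hy]
        have : y = 0 := h _ y
        rw [this, Ext.zero_comp]
      have h1 : ((cohomologyPow (bockstein H x hx) k).comp e₁ rfl).comp e₂ rfl = 0 := by
        rw [← hk0]
        exact Ext.comp_assoc _ _ _ _ _ (by lia)
      obtain ⟨y, hy⟩ := Ext.covariant_sequence_exact₃ _ (shortExact_normMap H x hx) _ rfl h1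
      refine ih ?_
      rw [← hy]
      have : y = 0 := h _ y
      rw [this, Ext.zero_comp]
  exact key k (by rw [hk, Ext.zero_comp])

end Ext

namespace WordComplex

/-! ### The cohomology of binate groups -/

noncomputable instance {X : Type*} : Module ℤ (Words ℤ X) := instModuleWords (R := ℤ)

section Dual

variable {G : Type*} [Group G]

theorem sum_component {R X : Type*} [CommRing R] {n : ℕ} {c : Words R X} (hc : c ∈ lengthLE R X n) :
    ∑ i ∈ Finset.range (n + 1), component i c = c := by
  have h := eqOn_spanWords (f := ∑ i ∈ Finset.range (n + 1), component (R := R) (X := X) i)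
    (g := LinearMap.id) (fun w hw => ?_) hc
  · simpa using h
  · rw [LinearMap.sum_apply, Finset.sum_eq_single w.length]
    · simp [component]
    · intro i _ hi
      simp [component, hi.symm]
    · intro h
      simp only [Set.mem_ofPred_eq] at hw
      simp only [Finset.mem_range] at h
      lia

theorem component_zero_barBd {R : Type*} [CommRing R] (c : Words R G) :
    component 0 (barBd c) = 0 := by
  rw [← barBd_component]
  refine eqOn_spanWords (g := 0) (fun w hw => ?_) (component_mem (0 + 1) c)
  obtain ⟨x, rfl⟩ := List.length_eq_one_iff.1 hw
  exact barBd_singleton x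

theorem eq_smul_of_mem_lengthEq_zero {A X : Type*} [AddCommGroup A] {f : Words ℤ X →ₗ[ℤ] A}
    (hf : f (word []) = 0) {c : Words ℤ X} (hc : c ∈ lengthEq ℤ X 0) : f c = 0 :=
  eqOn_spanWords (g := 0) (fun w hw => by
    obtain rfl := List.length_eq_zero_iff.1 hw
    exact hf) hc

/-- Since `χ` vanishes on boundaries, it vanishes on all cycles: those of positive degree are
boundaries, and degree zero is covered by the value at the empty word. So `χ` factors through the
image of `barBd`, from which it extends because divisible groups are injective. -/
theorem exists_comp_barBd_of_divisible (hG : IsBinate G) {A : Type*} [AddCommGroup A]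
    [DivisibleBy A ℤ] {χ : Words ℤ G →ₗ[ℤ] A} (hd : ∀ c, χ (barBd c) = 0) (h0 : χ (word []) = 0) :
    ∃ ψ : Words ℤ G →ₗ[ℤ] A, ∀ c, ψ (barBd c) = χ c := by
  have hker : ∀ z : Words ℤ G, barBd z = 0 → χ z = 0 := by
    intro z hz
    obtain ⟨n, hn⟩ := exists_mem_lengthLE z
    rw [← sum_component hn, map_sum]
    refine Finset.sum_eq_zero fun i _ => ?_
    cases i with
    | zero => exact eq_smul_of_mem_lengthEq_zero h0 (component_mem 0 z)
    | succ i =>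
      obtain ⟨y, -, hy⟩ := exists_barBd_eq hG (n := i + 1) (by lia) (component_mem (i + 1) z)
        (by rw [barBd_component, hz, map_zero])
      rw [← hy, hd]
  let K := LinearMap.ker (barBd (R := ℤ) (G := G))
  obtain ⟨ψ, hψ⟩ := (Module.Baer.of_divisible A).extension_property
    (K.liftQ barBd le_rfl) (LinearMap.ker_eq_bot.1 (Submodule.ker_liftQ_eq_bot _ _ _ le_rfl))
    (K.liftQ χ fun z hz => hker z hz)
  exact ⟨ψ, fun c => LinearMap.congr_fun hψ (K.mkQ c)⟩

/-- An integral cocycle of positive degree of a binate group is a coboundary. -/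
theorem exists_comp_barBd (hG : IsBinate G) {b : Words ℤ G →ₗ[ℤ] ℤ} (hd : ∀ c, b (barBd c) = 0)
    (h0 : b (word []) = 0) : ∃ a : Words ℤ G →ₗ[ℤ] ℤ, ∀ c, a (barBd c) = b c := by
  let ι : ℤ →ₗ[ℤ] ℚ := (Int.castAddHom ℚ).toIntLinearMap
  let q : ℚ →ₗ[ℤ] AddCircle (1 : ℚ) := (QuotientAddGroup.mk' _).toIntLinearMap
  have hq : Function.Surjective q := QuotientAddGroup.mk'_surjective _
  have hqι : ∀ n : ℤ, q (ι n) = 0 := fun n =>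
    (QuotientAddGroup.eq_zero_iff _).2 ⟨n, by simp [ι]⟩
  -- The sequence `ℤ → ℚ → ℚ/ℤ` is used. A rational cochain `φ` has coboundary `b`; modulo `ℤ` it is
  -- a cocycle, hence the coboundary of some `ψ`. Subtracting from `φ` the coboundary of a rational
  -- lift of `ψ` leaves an integral cochain that still has coboundary `b`. The component in degree
  -- zero is removed because the cocycle has to vanish on the empty word.
  obtain ⟨φ, hφ⟩ := exists_comp_barBd_of_divisible hG (χ := ι ∘ₗ b) (fun c => by simp [hd])
    (by simp [h0])
  obtain ⟨ψ, hψ⟩ := exists_comp_barBd_of_divisible hG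
    (χ := q ∘ₗ φ ∘ₗ (LinearMap.id - component 0)) (fun c => by
      simp only [LinearMap.comp_apply, LinearMap.sub_apply, component_zero_barBd, sub_zero,
        LinearMap.id_apply, hφ, hqι]) (by
        simp [component])
  obtain ⟨ψ', hψ'⟩ := Module.projective_lifting_property q ψ hq
  have hint : ∀ w : List G, ∃ n : ℤ,
      ι n = φ (word w - component 0 (word w)) - ψ' (barBd (word w)) := by
    intro w
    have h1 : q (φ (word w - component 0 (word w)) - ψ' (barBd (word w))) = 0 := by
      rw [map_sub]
      have h2 := hψ (word w)
      rw [← hψ'] at h2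
      exact sub_eq_zero.2 h2.symm
    obtain ⟨n, hn⟩ := (QuotientAddGroup.eq_zero_iff _).1 h1
    exact ⟨n, by rw [← hn]; simp [ι]⟩
  choose a ha using hint
  refine ⟨ext a, fun c => ?_⟩
  have h1 : ∀ c, ι (ext a c) = φ (c - component 0 c) - ψ' (barBd c) := by
    intro c
    have := hom_eq (f := ι ∘ₗ ext a)
      (g := φ ∘ₗ (LinearMap.id - component 0) - ψ' ∘ₗ barBd) (fun w => by simp [ha]) c
    simpa using this
  have h2 : ι (ext a (barBd c)) = ι (b c) := by
    rw [h1, barBd_barBd, map_zero, sub_zero, component_zero_barBd, sub_zero, hφ]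
    rfl
  exact Int.cast_injective h2

/-- An invariant integral cocycle of positive degree on the homogeneous complex of a binate group is
the coboundary of an invariant cochain. -/
theorem exists_comp_bd_of_isBinate (hG : IsBinate G) {c : Words ℤ G →ₗ[ℤ] ℤ}
    (hinv : ∀ (g : G) x, c (map (g * ·) x) = c x) (hd : ∀ x, c (bd x) = 0)
    (h0 : c (word []) = 0) (h1 : ∀ g, c (word [g]) = 0) :
    ∃ F : Words ℤ G →ₗ[ℤ] ℤ, (∀ (g : G) x, F (map (g * ·) x) = F x) ∧ ∀ x, F (bd x) = c x := by
  have hc := eq_ofBar_toBar hinv h0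
  obtain ⟨a, ha⟩ := exists_comp_barBd hG (b := c ∘ₗ ofBar) (fun x => by
    have h : barBd x = toBar (bd (ofBar x)) := rfl
    rw [LinearMap.comp_apply, h, ← hc, hd]) (by simp [path, h1])
  exact ⟨a ∘ₗ toBar, fun g x => by simp [toBar_map_mul], fun x => by
    rw [LinearMap.comp_apply, toBar_bd, ha, LinearMap.comp_apply, ← hc]⟩

end Dual

/-! ### Passage from the cohomology of a binate subgroup to invariant cochains of the group -/

section TotalHomotopy

variable {R X Y : Type*} [CommRing R]

/-- Each recursion step consumes one letter, so more depth than the length changes nothing. Hence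
the homotopies of all depths combine to one map. -/
theorem homotopy_eq_of_mem (T : Words R X →ₗ[R] Words R Y) (y : X → Y) {m n : ℕ} (hmn : n ≤ m)
    {c : Words R X} (hc : c ∈ lengthLE R X n) : homotopy T y m c = homotopy T y n c := by
  refine eqOn_spanWords (fun w hw => ?_) hc
  clear hc
  induction n generalizing m w with
  | zero =>
    obtain rfl : w = [] := by simpa using hw
    simp
  | succ n ih =>
    obtain ⟨m, rfl⟩ : ∃ k, m = k + 1 := ⟨m - 1, by lia⟩
    cases w with
    | nil => simp
    | cons x w =>
      rw [homotopy_cons, homotopy_cons, eqOn_spanWords (f := homotopy T y m)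
        (g := homotopy T y n) (fun v hv => ih (by lia) v hv) (bd_word_mem_lengthLE hw)]

/-- The homotopies `homotopy T y n` combined to one map. -/
noncomputable def totalHomotopy (T : Words R X →ₗ[R] Words R Y) (y : X → Y) :
    Words R X →ₗ[R] Words R Y :=
  ext fun w => homotopy T y w.length (word w)

theorem totalHomotopy_eq (T : Words R X →ₗ[R] Words R Y) (y : X → Y) {n : ℕ}
    {c : Words R X} (hc : c ∈ lengthLE R X n) : totalHomotopy T y c = homotopy T y n c :=
  eqOn_spanWords (f := totalHomotopy T y) (g := homotopy T y n) (fun w hw => by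
    rw [totalHomotopy, ext_word, ← homotopy_eq_of_mem T y hw (word_mem (by simp))]) hc

theorem bd_totalHomotopy {T : Words R X →ₗ[R] Words R Y} (hT : ∀ c, bd (T c) = T (bd c))
    (hT0 : T (word []) = 0) (y : X → Y) (c : Words R X) :
    bd (totalHomotopy T y c) + totalHomotopy T y (bd c) = T c := by
  obtain ⟨m, hm⟩ := exists_mem_lengthLE c
  obtain ⟨n, hn⟩ := exists_mem_lengthLE (bd c)
  have hm' : c ∈ lengthLE R X (m + n) :=
    spanWords_mono (fun w (hw : w.length ≤ m) => hw.trans (Nat.le_add_right m n)) hm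
  have hn' : bd c ∈ lengthLE R X (m + n) :=
    spanWords_mono (fun w (hw : w.length ≤ n) => hw.trans (Nat.le_add_left n m)) hn
  rw [totalHomotopy_eq T y hn', ← bd_homotopy hT hT0 y hm', totalHomotopy_eq T y hm',
    homotopy_eq_of_mem T y (Nat.le_succ _) hm']

theorem map_totalHomotopy {X' Y' : Type*} (f : X → X') (g : Y → Y') {T : Words R X →ₗ[R] Words R Y}
    {T' : Words R X' →ₗ[R] Words R Y'} {y : X → Y} {y' : X' → Y'} (hy : ∀ x, g (y x) = y' (f x))
    (hT : ∀ c, map g (T c) = T' (map f c)) (c : Words R X) :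
    map g (totalHomotopy T y c) = totalHomotopy T' y' (map f c) := by
  have h := hom_eq (f := map g ∘ₗ totalHomotopy T y) (g := totalHomotopy T' y' ∘ₗ map f)
    (fun w => ?_) c
  · exact h
  · simp only [LinearMap.comp_apply, map_word, totalHomotopy, ext_word, List.length_map]
    rw [map_homotopy f g hy hT, map_word]

end TotalHomotopy

/-- An integral cocycle of positive degree on the homogeneous complex of a group that is invariant
under a binate subgroup is the coboundary of an invariant cochain. -/
theorem exists_comp_bd_of_isBinate_subgroup {Γ : Type*} [Group Γ] {H : Subgroup Γ}
    (hH : IsBinate H) {c : Words ℤ Γ →ₗ[ℤ] ℤ} (hinv : ∀ (h : H) x, c (map ((h : Γ) * ·) x) = c x)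
    (hd : ∀ x, c (bd x) = 0) (h0 : c (word []) = 0) (h1 : ∀ g, c (word [g]) = 0) :
    ∃ F : Words ℤ Γ →ₗ[ℤ] ℤ, (∀ (h : H) x, F (map ((h : Γ) * ·) x) = F x) ∧
      ∀ x, F (bd x) = c x := by
  -- `Γ` is a free left `H`-set, so representatives of the right cosets give an equivariant map to
  -- `H`, which compares the words in `Γ` with those in `H`.
  obtain ⟨r, hr⟩ : ∃ r : Γ → H, ∀ (h : H) g, r (h * g) = h * r g := by
    have hmem : ∀ g : Γ, g * (Quotient.out (Quotient.mk (QuotientGroup.rightRel H) g))⁻¹ ∈ H :=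
      fun g => QuotientGroup.rightRel_apply.1
        (Quotient.exact (Quotient.out_eq (Quotient.mk (QuotientGroup.rightRel H) g)))
    refine ⟨fun g => ⟨_, hmem g⟩, fun h g => Subtype.ext ?_⟩
    have h2 : Quotient.mk (QuotientGroup.rightRel H) ((h : Γ) * g) = Quotient.mk _ g :=
      Quotient.sound (QuotientGroup.rightRel_apply.2 (by simp))
    simp only [h2, Subgroup.coe_mul, mul_assoc]
  let T : Words ℤ Γ →ₗ[ℤ] Words ℤ Γ := map (H.subtype ∘ r) - LinearMap.id
  have hT : ∀ x, bd (T x) = T (bd x) := fun x => by simp [T, bd_map]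
  have hT0 : T (word []) = 0 := by simp [T]
  have hTH : ∀ (h : H) x, map ((h : Γ) * ·) (T x) = T (map ((h : Γ) * ·) x) := fun h x => by
    simp [T, map_map, Function.comp_def, hr]
  obtain ⟨F, hF, hF'⟩ := exists_comp_bd_of_isBinate hH (c := c ∘ₗ map H.subtype) (fun h x => by
    simp only [LinearMap.comp_apply]
    refine Eq.trans ?_ (hinv h _)
    rw [map_map, map_map]
    rfl) (fun x => by simp [← bd_map, hd]) (by simp [h0]) (fun g => by simp [h1])
  -- The coboundary of `F ∘ map r` is `c` pulled back along `Γ → H → Γ`. The homotopy between this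
  -- composite and the identity, composed with `c`, supplies the difference to `c`.
  refine ⟨F ∘ₗ map r - c ∘ₗ totalHomotopy T id, fun h x => ?_, fun x => ?_⟩
  · simp only [LinearMap.sub_apply, LinearMap.comp_apply]
    have h2 := map_totalHomotopy (fun x => (h : Γ) * x) (fun x => (h : Γ) * x) (T := T) (T' := T)
      (y := id) (y' := id) (fun x => rfl) (hTH h) x
    have h3 : r ∘ (fun x => (h : Γ) * x) = (fun x => h * x) ∘ r := funext (hr h)
    rw [← h2, hinv, map_map, h3, ← map_map, hF]
  · have h2 := congrArg c (bd_totalHomotopy hT hT0 id x)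
    rw [map_add, hd, zero_add] at h2
    simp only [LinearMap.sub_apply, LinearMap.comp_apply]
    rw [h2, ← bd_map, hF', LinearMap.comp_apply, map_map]
    simp [T]

end WordComplex

/-! ### Cohomology of the group with values in `ℤ[Γ/H]` -/

section Objects

variable {Γ : Type u} [Group Γ]

/-- The object of the category of modules given by a representation. -/
noncomputable abbrev repObj {M : Type u} [AddCommGroup M] (ρ : Representation ℤ Γ M) :
    ModuleCat.{u} (MonoidAlgebra ℤ Γ) :=
  @ModuleCat.of (MonoidAlgebra ℤ Γ) _ M _ (repModule ρ)

/-- The linear map over the group ring given by an equivariant map of representations. -/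
noncomputable def Equivariant.repLinearMap {M N : Type u} [AddCommGroup M] [AddCommGroup N]
    {ρ : Representation ℤ Γ M} {σ : Representation ℤ Γ N} {f : M →ₗ[ℤ] N} (hf : Equivariant ρ σ f) :
    letI := repModule ρ
    letI := repModule σ
    M →ₗ[MonoidAlgebra ℤ Γ] N :=
  letI := repModule ρ
  letI := repModule σ
  Equivariant.toLinearMap (f := f) (by rwa [moduleRep_repModule, moduleRep_repModule])

theorem projective_repObj {M : Type u} [AddCommGroup M] {ρ : Representation ℤ Γ M}
    (hρ : LiftProj ρ) : Projective (repObj ρ) := by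
  let := repModule ρ
  rw [← moduleRep_repModule ρ, ← projective_iff_liftProj] at hρ
  exact (IsProjective.iff_projective _).1 hρ

end Objects

namespace WordComplex

variable {Γ : Type u} [Group Γ]

/-- The representation on an invariant subgroup of the words. -/
noncomputable def subRep (K : AddSubgroup (Words ℤ Γ)) (hK : ∀ (g : Γ), ∀ x ∈ K, map (g * ·) x ∈ K) :
    Representation ℤ Γ K where
  toFun g := (((map (R := ℤ) (g * ·)).toAddMonoidHom.comp K.subtype).codRestrict K
    fun x => hK g x x.2).toIntLinearMap
  map_one' := by
    ext x
    change map (R := ℤ) ((1 : Γ) * ·) x = x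
    rw [show (fun x : Γ => 1 * x) = id from funext one_mul, map_id]
  map_mul' g h := by
    ext x
    change map (R := ℤ) ((g * h) * ·) (x : Words ℤ Γ) = map (g * ·) (map (h * ·) (x : Words ℤ Γ))
    rw [map_map]
    congr 2
    ext y
    exact mul_assoc g h y

theorem subRep_apply {K : AddSubgroup (Words ℤ Γ)} (hK : ∀ (g : Γ), ∀ x ∈ K, map (g * ·) x ∈ K)
    (g : Γ) (x : K) : (subRep K hK g x : Words ℤ Γ) = map (g * ·) (x : Words ℤ Γ) := rfl

theorem aug_map {R X Y : Type*} [CommRing R] (f : X → Y) (c : Words R X) : aug (map f c) = aug c := by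
  have h := hom_eq (f := aug ∘ₗ map (R := R) f) (g := aug) (fun w => by cases w <;> simp) c
  exact h

/-- The cycles. -/
noncomputable def cycles (Γ : Type u) : AddSubgroup (Words ℤ Γ) := (bd (R := ℤ)).toAddMonoidHom.ker

/-- The chains of positive length. -/
noncomputable def positive (Γ : Type u) : AddSubgroup (Words ℤ Γ) :=
  (aug (R := ℤ)).toAddMonoidHom.ker

theorem mem_cycles {Γ : Type u} {x : Words ℤ Γ} : x ∈ cycles Γ ↔ bd x = 0 := Iff.rfl

theorem mem_positive {Γ : Type u} {x : Words ℤ Γ} : x ∈ positive Γ ↔ aug x = 0 := Iff.rfl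

theorem map_mem_cycles (g : Γ) : ∀ x ∈ cycles Γ, map (g * ·) x ∈ cycles Γ := fun x hx => by
  rw [mem_cycles] at hx ⊢
  rw [bd_map, hx, map_zero]

theorem map_mem_positive (g : Γ) : ∀ x ∈ positive Γ, map (g * ·) x ∈ positive Γ := fun x hx => by
  rw [mem_positive] at hx ⊢
  rw [aug_map, hx]

theorem map_mem_inf (g : Γ) :
    ∀ x ∈ cycles Γ ⊓ positive Γ, map (g * ·) x ∈ cycles Γ ⊓ positive Γ :=
  fun x hx => ⟨map_mem_cycles g x hx.1, map_mem_positive g x hx.2⟩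

/-- Remove the empty word. -/
noncomputable def toPositive : Words ℤ Γ →+ positive Γ :=
  (AddMonoidHom.id _ - ((LinearMap.toSpanSingleton ℤ (Words ℤ Γ) (word [])).comp
    aug).toAddMonoidHom).codRestrict (positive Γ) fun x => by
      rw [mem_positive]
      change aug (x - aug x • word (R := ℤ) []) = 0
      simp

theorem coe_toPositive (x : Words ℤ Γ) :
    (toPositive x : Words ℤ Γ) = x - aug x • word (R := ℤ) [] := rfl

/-- The chains of positive length are projective. -/
theorem liftProj_positive : LiftProj (subRep (positive Γ) map_mem_positive) := by
  intro A B _ _ σ τ p f hp hf hsurj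
  have hw : ∀ (k : Γ) (w : List Γ), word (R := ℤ) (k :: w) ∈ positive Γ := fun k w => by
    rw [mem_positive, aug_cons]
  -- The words that start with `1` form a basis over the group ring: lifts are chosen on these and
  -- translated.
  choose a ha using fun w : List Γ => hsurj (f ⟨word (1 :: w), hw 1 w⟩)
  let F : Words ℤ Γ →ₗ[ℤ] A := ext (R := ℤ) fun
    | [] => 0
    | k :: w => σ k (a (w.map (k⁻¹ * ·)))
  have hF0 : F (word []) = 0 := ext_word _ _
  have hF1 : ∀ k w, F (word (k :: w)) = σ k (a (w.map (k⁻¹ * ·))) := fun k w => ext_word _ _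
  have hF : ∀ (g : Γ) x, F (map (g * ·) x) = σ g (F x) := by
    intro g x
    induction x using words_induction with
    | h0 => simp
    | hadd x y hx hy => rw [map_add, map_add, map_add, map_add, hx, hy]
    | hsmul r x hx => rw [map_smul, map_smul, map_smul, map_smul, hx]
    | hw w =>
      cases w with
      | nil => simp [hF0]
      | cons k w =>
        rw [map_word, List.map_cons, hF1, hF1, List.map_map, map_mul, Module.End.mul_apply]
        congr 3
        ext x
        simp
  have hpF : ∀ x, p (F x) = f (toPositive x) := by
    intro x
    induction x using words_induction with
    | h0 => simp
    | hadd x y hx hy => rw [map_add, map_add, hx, hy, map_add, map_add]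
    | hsmul r x hx =>
      rw [map_smul, map_smul, hx, ← map_smul]
      congr 1
      exact (map_zsmul toPositive r x).symm
    | hw w =>
      cases w with
      | nil =>
        rw [hF0, map_zero]
        have : toPositive (word (R := ℤ) ([] : List Γ)) = 0 := Subtype.ext (by simp [coe_toPositive])
        rw [this, map_zero]
      | cons k w =>
        rw [hF1, hp, ha, ← hf]
        congr 1
        refine Subtype.ext ?_
        rw [subRep_apply, coe_toPositive, aug_cons, zero_smul, sub_zero, map_word]
        simp [List.map_map, Function.comp_def]
  refine ⟨(F.toAddMonoidHom.comp (positive Γ).subtype).toIntLinearMap, fun g x => hF g x, ?_⟩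
  ext x
  refine (hpF x).trans (congrArg f (Subtype.ext ?_))
  rw [coe_toPositive, mem_positive.1 x.2, zero_smul, sub_zero]

theorem component_zero {R X : Type*} [CommRing R] (c : Words R X) :
    component 0 c = aug c • word [] := by
  have h := hom_eq (f := component (R := R) (X := X) 0)
    (g := (LinearMap.toSpanSingleton R _ (word [])).comp aug) (fun w => by
      cases w <;> simp [component]) c
  exact h

theorem component_zero_of_aug {R X : Type*} [CommRing R] {c : Words R X} (hc : aug c = 0) :
    component 0 c = 0 := by
  rw [component_zero, hc, zero_smul]

theorem component_succ_cone {R X : Type*} [CommRing R] (n : ℕ) (x : X) (c : Words R X) :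
    component (n + 1) (cone x c) = cone x (component n c) := by
  have h := hom_eq (f := component (R := R) (X := X) (n + 1) ∘ₗ cone x)
    (g := cone x ∘ₗ component n) (fun w => by
      simp only [LinearMap.comp_apply, cone_word, component, ext_word, List.length_cons,
        add_left_inj]
      split_ifs <;> simp) c
  exact h

theorem bd_component {R X : Type*} [CommRing R] (n : ℕ) (c : Words R X) :
    bd (component (n + 1) c) = component n (bd c) := by
  have h := hom_eq (f := bd ∘ₗ component (R := R) (X := X) (n + 1))
    (g := component n ∘ₗ bd) (fun w => ?_) c
  · exact h
  simp only [LinearMap.comp_apply]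
  cases w with
  | nil => simp [component]
  | cons x w =>
    have hw : word (x :: w) ∈ lengthEq R X (w.length + 1) := word_mem rfl
    rcases eq_or_ne w.length n with rfl | hmn
    · rw [component_of_mem hw, component_of_mem (bd_mem_lengthEq hw)]
    · rw [component_of_mem_of_ne (by lia) hw, component_of_mem_of_ne hmn (bd_mem_lengthEq hw),
        map_zero]

/-- The boundaries of chains of length at least two. -/
noncomputable def toBoundaries : Words ℤ Γ →+ (cycles Γ ⊓ positive Γ : AddSubgroup (Words ℤ Γ)) :=
  ((bd (R := ℤ)).comp (LinearMap.id - component 0 - component 1)).toAddMonoidHom.codRestrict _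
    fun x => by
      refine ⟨mem_cycles.2 (bd_bd _), mem_positive.2 ?_⟩
      have h := hom_eq (f := aug ∘ₗ bd ∘ₗ (LinearMap.id - component (R := ℤ) (X := Γ) 0 -
        component 1)) (g := 0) (fun w => ?_) x
      · exact h
      · rcases w with - | ⟨x, - | ⟨y, w⟩⟩
        · simp [component]
        · simp [component]
        · simp [component, bd_cons, -cone_word]

theorem coe_toBoundaries (x : Words ℤ Γ) :
    (toBoundaries x : Words ℤ Γ) = bd (x - component 0 x - component 1 x) := rfl

theorem toBoundaries_map (g : Γ) (x : Words ℤ Γ) :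
    toBoundaries (map (g * ·) x) = subRep _ map_mem_inf g (toBoundaries x) := by
  refine Subtype.ext ?_
  have h : ∀ n (x : Words ℤ Γ), component n (map (g * ·) x) = map (g * ·) (component n x) := by
    intro n x
    have h := hom_eq (f := component n ∘ₗ map (R := ℤ) (g * ·)) (g := map (g * ·) ∘ₗ component n)
      (fun w => ?_) x
    · exact h
    · simp only [LinearMap.comp_apply, map_word, component, ext_word, List.length_map]
      split_ifs <;> simp
  rw [subRep_apply, coe_toBoundaries, coe_toBoundaries, h, h, ← map_sub, ← map_sub, bd_map]

/-- An equivariant map from the boundaries of positive length to `ℤ[Γ/H]` extends to the chains of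
positive length if `H` is binate of finite index. -/
theorem exists_extension {H : Subgroup Γ} [H.Normal] [Finite (Γ ⧸ H)] (hH : IsBinate H)
    (φ : (cycles Γ ⊓ positive Γ : AddSubgroup (Words ℤ Γ)) →+ QuotientModule H)
    (hφ : ∀ g x, φ (subRep _ map_mem_inf g x) = moduleRep Γ (QuotientModule H) g (φ x)) :
    ∃ φ' : Words ℤ Γ →+ QuotientModule H,
      (∀ (g : Γ) x, φ' (map (g * ·) x) = moduleRep Γ (QuotientModule H) g (φ' x)) ∧
      ∀ x : (cycles Γ ⊓ positive Γ : AddSubgroup (Words ℤ Γ)), φ' x = φ x := by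
  let := Fintype.ofFinite (Γ ⧸ H)
  let coeff : QuotientModule H → Γ ⧸ H → ℤ := fun y q => (show MonoidAlgebra ℤ (Γ ⧸ H) from y).coeff q
  have hcoeff_add : ∀ y z q, coeff (y + z) q = coeff y q + coeff z q := fun _ _ _ => rfl
  have hcoeff : ∀ g y q, coeff (moduleRep Γ (QuotientModule H) g y) q =
      coeff y ((QuotientGroup.mk' H g)⁻¹ * q) := by
    intro g y q
    change (MonoidAlgebra.mapDomainRingHom ℤ (QuotientGroup.mk' H) (MonoidAlgebra.single g (1 : ℤ)) *
      (show MonoidAlgebra ℤ (Γ ⧸ H) from y)).coeff q = _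
    rw [MonoidAlgebra.mapDomainRingHom_apply, MonoidAlgebra.mapDomain_single,
      MonoidAlgebra.coeff_single_mul_apply, one_mul]
  -- An equivariant map to `ℤ[Γ/H]` is determined by its coefficient at `1`, which is an
  -- `H`-invariant map to `ℤ`. Composed with the boundary it becomes a cocycle; `toBoundaries`
  -- discards the words of length at most one, whose boundaries do not have positive length.
  let c₀ : Words ℤ Γ →+ ℤ :=
    { toFun := fun x => coeff (φ (toBoundaries x)) 1
      map_zero' := by rw [map_zero, map_zero]; rfl
      map_add' := fun x y => by rw [map_add, map_add, hcoeff_add] }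
  let c : Words ℤ Γ →ₗ[ℤ] ℤ :=
    { c₀ with map_smul' := fun r x => map_zsmul c₀ r x }
  have hc : ∀ x, c x = coeff (φ (toBoundaries x)) 1 := fun _ => rfl
  have hcinv : ∀ (h : H) x, c (map ((h : Γ) * ·) x) = c x := by
    intro h x
    rw [hc, hc, toBoundaries_map, hφ, hcoeff]
    congr 1
    simp
  have hcbd : ∀ x, c (bd x) = 0 := by
    intro x
    have h0 : toBoundaries (bd x) = 0 := by
      refine Subtype.ext ?_
      rw [coe_toBoundaries, map_sub, map_sub, bd_bd, ← bd_component, ← bd_component, bd_bd, bd_bd]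
      simp
    rw [hc, h0, map_zero]
    rfl
  obtain ⟨F, hF, hF'⟩ := exists_comp_bd_of_isBinate_subgroup hH hcinv hcbd
    (by
      have h0 : toBoundaries (word (R := ℤ) ([] : List Γ)) = 0 :=
        Subtype.ext (by rw [coe_toBoundaries]; simp [component])
      rw [hc, h0, map_zero]
      rfl) (fun g => by
      have h0 : toBoundaries (word (R := ℤ) [g]) = 0 :=
        Subtype.ext (by rw [coe_toBoundaries]; simp [component])
      rw [hc, h0, map_zero]
      rfl)
  -- The way back from `H`-invariant maps to equivariant ones: the coefficient at `q` is the value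
  -- of `F` on a translate by the inverse of a representative of `q`. The finiteness of `Γ/H` makes
  -- the sum finite.
  let φ' : Words ℤ Γ →+ QuotientModule H :=
    { toFun := fun x => (∑ q : Γ ⧸ H, MonoidAlgebra.single q (F (map (q.out⁻¹ * ·) x)) :
        MonoidAlgebra ℤ (Γ ⧸ H))
      map_zero' := by simp; rfl
      map_add' := fun x y => by
        simp only [map_add, MonoidAlgebra.single_add, Finset.sum_add_distrib]
        rfl }
  have hφ' : ∀ x (q : Γ ⧸ H), coeff (φ' x) q = F (map (q.out⁻¹ * ·) x) := by
    intro x q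
    change (∑ q : Γ ⧸ H, MonoidAlgebra.single q (F (map (q.out⁻¹ * ·) x)) :
        MonoidAlgebra ℤ (Γ ⧸ H)).coeff q = _
    rw [MonoidAlgebra.coeff_sum, Finsupp.finsetSum_apply, Finset.sum_eq_single q]
    · simp
    · intro p _ hp
      simp [MonoidAlgebra.coeff_single, hp]
    · simp
  have hext : ∀ y z : QuotientModule H, (∀ q, coeff y q = coeff z q) → y = z := fun y z h =>
    MonoidAlgebra.ext (Finsupp.ext h)
  refine ⟨φ', fun g x => hext _ _ fun q => ?_, fun x => hext _ _ fun q => ?_⟩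
  · rw [hcoeff, hφ', hφ', map_map]
    set q' := (QuotientGroup.mk' H g)⁻¹ * q
    have hmem : q.out⁻¹ * g * q'.out ∈ H := by
      rw [← QuotientGroup.eq_one_iff]
      simp [q']
    have h1 := hF ⟨_, hmem⟩ (map (q'.out⁻¹ * ·) x)
    rw [← h1, map_map]
    exact congrArg (fun f => F (map f x)) (funext fun y => by simp [mul_assoc])
  · obtain ⟨x, hx⟩ := x
    rw [hφ']
    have h1 : bd (cone 1 x) = x := by
      rw [bd_cone, mem_cycles.1 hx.1, map_zero, sub_zero]
    have h2 : toBoundaries (cone 1 x) = ⟨x, hx⟩ := by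
      refine Subtype.ext ?_
      rw [coe_toBoundaries, component_zero_of_aug (aug_cone 1 x), component_succ_cone,
        component_zero_of_aug (mem_positive.1 hx.2), map_zero, sub_zero, sub_zero, h1]
    refine Eq.trans (b := F (map (q.out⁻¹ * ·) (bd (cone 1 x)))) (by rw [h1]) ?_
    rw [← bd_map, hF', hc, toBoundaries_map, hφ, hcoeff, h2]
    congr 1
    simp

theorem moduleRep_trivialModule (g : Γ) (n : TrivialModule Γ) :
    moduleRep Γ (TrivialModule Γ) g n = n := by
  change augmentation Γ (MonoidAlgebra.single g (1 : ℤ)) • (show ULift.{u} ℤ from n) = n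
  rw [augmentation_single, one_smul]

/-- The inclusion of the positive cycles into the cycles. -/
noncomputable def infToCycles : (cycles Γ ⊓ positive Γ : AddSubgroup (Words ℤ Γ)) →ₗ[ℤ] cycles Γ :=
  (AddSubgroup.inclusion inf_le_left).toIntLinearMap

/-- The boundary, from the positive chains to the cycles. -/
noncomputable def positiveToCycles : positive Γ →ₗ[ℤ] cycles Γ :=
  (((bd (R := ℤ)).toAddMonoidHom.comp
    (positive Γ).subtype).codRestrict (cycles Γ) fun _ => bd_bd _).toIntLinearMap

theorem toPositive_mem_inf (x : cycles Γ) :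
    (toPositive (x : Words ℤ Γ) : Words ℤ Γ) ∈ cycles Γ ⊓ positive Γ := by
  refine AddSubgroup.mem_inf.2 ⟨mem_cycles.2 ?_, (toPositive (x : Words ℤ Γ)).2⟩
  have h : ∀ n : ℤ, bd (R := ℤ) (n • word ([] : List Γ)) = 0 := fun n => by
    rw [map_smul, bd_nil]
    exact smul_zero n
  have h2 := map_sub (bd (R := ℤ)) (x : Words ℤ Γ) (aug (x : Words ℤ Γ) • word [])
  rw [mem_cycles.1 x.2, h, sub_zero] at h2
  exact h2

/-- The projection of the cycles to the positive cycles. -/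
noncomputable def cyclesToInf :
    cycles Γ →ₗ[ℤ] (cycles Γ ⊓ positive Γ : AddSubgroup (Words ℤ Γ)) :=
  (((positive Γ).subtype.comp (toPositive.comp (cycles Γ).subtype)).codRestrict
    (cycles Γ ⊓ positive Γ : AddSubgroup (Words ℤ Γ)) toPositive_mem_inf).toIntLinearMap

theorem coe_cyclesToInf (x : cycles Γ) : (cyclesToInf x : Words ℤ Γ) =
    (x : Words ℤ Γ) - aug (x : Words ℤ Γ) • word [] := rfl

theorem equivariant_cyclesToInf :
    Equivariant (subRep (cycles Γ) map_mem_cycles) (subRep (cycles Γ ⊓ positive Γ) map_mem_inf)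
      cyclesToInf := fun g x => Subtype.ext (by
  change map (g * ·) (x : Words ℤ Γ) - aug (map (g * ·) (x : Words ℤ Γ)) • word (R := ℤ) [] =
    map (g * ·) ((x : Words ℤ Γ) - aug (x : Words ℤ Γ) • word (R := ℤ) [])
  rw [map_sub, aug_map, map_smul, map_word, List.map_nil])

/-- The inclusion of `ℤ`, generated by the empty word, into the cycles. -/
noncomputable def trivialToCyclesHom : TrivialModule Γ →+ cycles Γ where
  toFun n := ⟨Finsupp.single [] (show ULift.{u} ℤ from n).down, by
    have h : Finsupp.single [] (show ULift.{u} ℤ from n).down =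
        (show ULift.{u} ℤ from n).down • word (R := ℤ) ([] : List Γ) := by
      exact (Finsupp.smul_single_one _ _).symm
    rw [h, mem_cycles, map_smul, bd_nil]
    exact smul_zero (show ULift.{u} ℤ from n).down⟩
  map_zero' := Subtype.ext (Finsupp.single_zero _)
  map_add' _ _ := Subtype.ext (Finsupp.single_add _ _ _)

/-- The inclusion of `ℤ`, generated by the empty word, into the cycles. -/
noncomputable def trivialToCycles : TrivialModule Γ →ₗ[ℤ] cycles Γ :=
  (trivialToCyclesHom (Γ := Γ)).toIntLinearMap

theorem coe_trivialToCycles (n : TrivialModule Γ) : (trivialToCycles n : Words ℤ Γ) =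
    (show ULift.{u} ℤ from n).down • word (R := ℤ) ([] : List Γ) :=
  (Finsupp.smul_single_one (R := ℤ) _ _).symm

theorem equivariant_trivialToCycles :
    Equivariant (moduleRep Γ (TrivialModule Γ)) (subRep (cycles Γ) map_mem_cycles)
      trivialToCycles := fun g x => Subtype.ext (by
  rw [moduleRep_trivialModule]
  refine (coe_trivialToCycles x).trans ?_
  rw [subRep_apply, coe_trivialToCycles, map_smul, map_word, List.map_nil])

/-- The augmentation on the cycles. -/
noncomputable def cyclesToTrivial : cycles Γ →ₗ[ℤ] TrivialModule Γ :=
  (AddEquiv.ulift.symm.toAddMonoidHom.comp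
    ((aug (R := ℤ)).toAddMonoidHom.comp (cycles Γ).subtype) :
      cycles Γ →+ TrivialModule Γ).toIntLinearMap

theorem equivariant_cyclesToTrivial :
    Equivariant (subRep (cycles Γ) map_mem_cycles) (moduleRep Γ (TrivialModule Γ))
      cyclesToTrivial := fun g x => by
  rw [moduleRep_trivialModule]
  exact congrArg ULift.up (aug_map _ _)

theorem cyclesToTrivial_trivialToCycles (n : TrivialModule Γ) :
    cyclesToTrivial (trivialToCycles n) = n := by
  change ULift.up (aug (trivialToCycles n : Words ℤ Γ)) = n
  rw [coe_trivialToCycles, map_smul, aug_nil]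
  exact congrArg ULift.up (mul_one _)

theorem cyclesToInf_infToCycles (x : (cycles Γ ⊓ positive Γ : AddSubgroup (Words ℤ Γ))) :
    cyclesToInf (infToCycles x) = x := by
  refine Subtype.ext ?_
  rw [coe_cyclesToInf]
  change (x : Words ℤ Γ) - aug (x : Words ℤ Γ) • word (R := ℤ) [] = (x : Words ℤ Γ)
  rw [mem_positive.1 (AddSubgroup.mem_inf.1 x.2).2, zero_smul, sub_zero]

theorem positiveToCycles_surjective : Function.Surjective (positiveToCycles (Γ := Γ)) := by
  rintro ⟨x, hx⟩
  refine ⟨⟨cone 1 x, aug_cone 1 x⟩, Subtype.ext ?_⟩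
  change bd (cone 1 x) = x
  rw [bd_cone, mem_cycles.1 hx, map_zero, sub_zero]

open Abelian in
/-- If `H` is a binate normal subgroup of finite index, then the cohomology of `Γ` with values in
`ℤ[Γ/H]` is zero in positive degrees. -/
theorem ext_quotientModule_eq_zero {H : Subgroup Γ} [H.Normal] [Finite (Γ ⧸ H)] (hH : IsBinate H)
    (n : ℕ) (x : Ext (ModuleCat.of (MonoidAlgebra ℤ Γ) (TrivialModule Γ))
      (ModuleCat.of (MonoidAlgebra ℤ Γ) (QuotientModule H)) (n + 1)) : x = 0 := by
  let ρ₁ := subRep (cycles Γ ⊓ positive Γ) map_mem_inf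
  let ρ₂ := subRep (positive Γ) map_mem_positive
  let ρ₃ := subRep (cycles Γ) map_mem_cycles
  let f : (cycles Γ ⊓ positive Γ : AddSubgroup (Words ℤ Γ)) →ₗ[ℤ] positive Γ :=
    (AddSubgroup.inclusion inf_le_right).toIntLinearMap
  have hf : Equivariant ρ₁ ρ₂ f := fun g x => rfl
  have hi : Equivariant ρ₁ ρ₃ infToCycles := fun g x => rfl
  have hp : Equivariant ρ₂ ρ₃ positiveToCycles := fun g x => Subtype.ext (bd_map _ _)
  let := repModule ρ₁
  let := repModule ρ₂
  let := repModule ρ₃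
  have : Projective (repObj ρ₂) := projective_repObj liftProj_positive
  -- This sequence collects all syzygies of `ℤ` at once: chains of positive length map onto the
  -- cycles of all lengths, and the kernel consists of the cycles of positive length. The cycles are
  -- the direct sum of this kernel and of a copy of `ℤ` on the empty word, so both are retracts of
  -- the third term.
  let S : ShortComplex (ModuleCat.{u} (MonoidAlgebra ℤ Γ)) :=
    ShortComplex.mk (X₁ := repObj ρ₁) (X₂ := repObj ρ₂) (X₃ := repObj ρ₃)
      (ModuleCat.ofHom hf.repLinearMap) (ModuleCat.ofHom hp.repLinearMap) (by
        ext x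
        exact x.2.1)
  have hS : S.ShortExact := by
    refine ModuleCat.shortComplex_shortExact S ?_ ?_ ?_
    · intro x
      refine ⟨fun h => ⟨⟨(x : positive Γ).1, ⟨congrArg Subtype.val h, (x : positive Γ).2⟩⟩, rfl⟩, ?_⟩
      rintro ⟨y, rfl⟩
      exact Subtype.ext y.2.1
    · intro x y h
      exact Subtype.ext (congrArg (fun z : positive Γ => (z : Words ℤ Γ)) h)
    · exact positiveToCycles_surjective
  refine ext_eq_zero_of_retract_obj (Y := repObj ρ₃)
    (i := ModuleCat.ofHom (Equivariant.toLinearMap (f := trivialToCycles)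
      (by rw [moduleRep_repModule]; exact equivariant_trivialToCycles)))
    (r := ModuleCat.ofHom (Equivariant.toLinearMap (f := cyclesToTrivial)
      (by rw [moduleRep_repModule]; exact equivariant_cyclesToTrivial))) ?_ ?_ x
  · exact ModuleCat.hom_ext (LinearMap.ext cyclesToTrivial_trivialToCycles)
  · refine ext_eq_zero_of_retract hS (i := ModuleCat.ofHom hi.repLinearMap)
      (r := ModuleCat.ofHom (equivariant_cyclesToInf (Γ := Γ)).repLinearMap) ?_ ?_ n
    · exact ModuleCat.hom_ext (LinearMap.ext cyclesToInf_infToCycles)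
    · intro φ
      obtain ⟨φ', h1, h2⟩ := exists_extension hH φ.hom.toAddMonoidHom fun g x => by
        have h3 := equivariant_of_linearMap φ.hom g x
        rw [moduleRep_repModule] at h3
        exact h3
      have h4 : Equivariant ρ₂ (moduleRep Γ (QuotientModule H))
          (φ'.comp (positive Γ).subtype).toIntLinearMap := fun g x => h1 g x
      refine ⟨ModuleCat.ofHom (Equivariant.toLinearMap
        (f := (φ'.comp (positive Γ).subtype).toIntLinearMap) (by rwa [moduleRep_repModule])), ?_⟩
      ext x
      exact h2 x

end WordComplex

/-! ### Representations with the lifting property -/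

section LiftProj

variable {G : Type u} [Group G] {M : Type u} [AddCommGroup M] {ρ : Representation ℤ G M}

theorem Equivariant.add {A B : Type*} [AddCommGroup A] [AddCommGroup B]
    {σ : Representation ℤ G A} {τ : Representation ℤ G B} {f g : A →ₗ[ℤ] B}
    (hf : Equivariant σ τ f) (hg : Equivariant σ τ g) : Equivariant σ τ (f + g) := fun x a => by
  rw [LinearMap.add_apply, LinearMap.add_apply, hf, hg, map_add]

theorem Equivariant.comp {A B C : Type*} [AddCommGroup A] [AddCommGroup B] [AddCommGroup C]
    {σ : Representation ℤ G A} {τ : Representation ℤ G B} {υ : Representation ℤ G C}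
    {g : B →ₗ[ℤ] C} {f : A →ₗ[ℤ] B}
    (hg : Equivariant τ υ g) (hf : Equivariant σ τ f) : Equivariant σ υ (g ∘ₗ f) := fun x a => by
  rw [LinearMap.comp_apply, LinearMap.comp_apply, hf, hg]

/-- A representation that is a direct summand of a sum of two representations with the lifting
property has the lifting property. -/
theorem LiftProj.of_retract_add {X Y : Type u} [AddCommGroup X] [AddCommGroup Y]
    {σ : Representation ℤ G X} {τ : Representation ℤ G Y} (hσ : LiftProj σ) (hτ : LiftProj τ)
    {i₁ : M →ₗ[ℤ] X} {r₁ : X →ₗ[ℤ] M} {i₂ : M →ₗ[ℤ] Y} {r₂ : Y →ₗ[ℤ] M}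
    (hi₁ : Equivariant ρ σ i₁) (hr₁ : Equivariant σ ρ r₁) (hi₂ : Equivariant ρ τ i₂)
    (hr₂ : Equivariant τ ρ r₂) (h : ∀ m, r₁ (i₁ m) + r₂ (i₂ m) = m) : LiftProj ρ := by
  intro A B _ _ α β p f hp hf hsurj
  obtain ⟨l₁, hl₁, h₁⟩ := hσ α β p (f ∘ₗ r₁) hp (hf.comp hr₁) hsurj
  obtain ⟨l₂, hl₂, h₂⟩ := hτ α β p (f ∘ₗ r₂) hp (hf.comp hr₂) hsurj
  refine ⟨l₁ ∘ₗ i₁ + l₂ ∘ₗ i₂, (hl₁.comp hi₁).add (hl₂.comp hi₂), LinearMap.ext fun m => ?_⟩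
  have h₁' := LinearMap.congr_fun h₁ (i₁ m)
  have h₂' := LinearMap.congr_fun h₂ (i₂ m)
  simp only [LinearMap.comp_apply, LinearMap.add_apply, map_add] at h₁' h₂' ⊢
  rw [h₁', h₂', ← map_add, h]

theorem LiftProj.of_retract {X : Type u} [AddCommGroup X]
    {σ : Representation ℤ G X} (hσ : LiftProj σ) {i : M →ₗ[ℤ] X} {r : X →ₗ[ℤ] M}
    (hi : Equivariant ρ σ i) (hr : Equivariant σ ρ r) (h : ∀ m, r (i m) = m) : LiftProj ρ := by
  intro A B _ _ α β p f hp hf hsurj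
  obtain ⟨l, hl, h'⟩ := hσ α β p (f ∘ₗ r) hp (hf.comp hr) hsurj
  refine ⟨l ∘ₗ i, hl.comp hi, LinearMap.ext fun m => ?_⟩
  have := LinearMap.congr_fun h' (i m)
  simp only [LinearMap.comp_apply] at this ⊢
  rw [this, h]

/-- The lifting property is inherited by the restriction along an injective homomorphism. -/
theorem LiftProj.comp_injective {K : Type u} [Group K] (hρ : LiftProj ρ) {φ : K →* G}
    (hφ : Function.Injective φ) : LiftProj (ρ.comp φ) := by
  intro A B _ _ σ τ p f hp hf hsurj
  -- The lifting problem is moved to `G` by coinduction, the right adjoint of restriction.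
  -- Coinduction preserves surjections here because `G` is a free `K`-set when `φ` is injective.
  have hmem : ∀ a : Representation.coindV φ σ, p.compLeft G a.1 ∈ Representation.coindV φ τ :=
    fun a g h => by
      change p (a.1 (φ g * h)) = τ g (p (a.1 h))
      rw [a.2 g h, hp]
  let P : Representation.coindV φ σ →ₗ[ℤ] Representation.coindV φ τ :=
    ((p.compLeft G).comp (Submodule.subtype _)).codRestrict _ hmem
  let F : M →ₗ[ℤ] Representation.coindV φ τ :=
    (LinearMap.pi fun g => f ∘ₗ ρ g).codRestrict _ fun m g h => by
      change f (ρ (φ g * h) m) = τ g (f (ρ h m))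
      rw [← hf, map_mul]
      rfl
  have hP : Function.Surjective P := by
    rintro ⟨b, hb⟩
    have hk : ∀ h : G, ∃ k : K, φ k * (Quotient.mk (QuotientGroup.rightRel φ.range) h).out = h := by
      intro h
      have h1 := QuotientGroup.rightRel_apply.1
        (Quotient.exact (Quotient.out_eq (Quotient.mk (QuotientGroup.rightRel φ.range) h)))
      obtain ⟨k, hk⟩ := h1
      exact ⟨k, by rw [hk, inv_mul_cancel_right]⟩
    choose k hk using hk
    choose s hs using hsurj
    refine ⟨⟨fun h => σ (k h) (s (b (Quotient.mk (QuotientGroup.rightRel φ.range) h).out)),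
      fun g h => ?_⟩, Subtype.ext (funext fun h => ?_)⟩
    · have hq : Quotient.mk (QuotientGroup.rightRel φ.range) (φ g * h) =
          Quotient.mk (QuotientGroup.rightRel φ.range) h := by
        refine Quotient.sound (QuotientGroup.rightRel_apply.2 ⟨g⁻¹, ?_⟩)
        simp
      have hk' : k (φ g * h) = g * k h := by
        refine hφ (mul_right_cancel (b := (Quotient.mk (QuotientGroup.rightRel φ.range) h).out) ?_)
        rw [map_mul, mul_assoc, hk]
        have := hk (φ g * h)
        rwa [hq] at this
      change σ (k (φ g * h)) (s (b (Quotient.mk _ (φ g * h)).out)) = σ g (σ (k h) (s (b _)))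
      rw [hq, hk', map_mul]
      rfl
    · change p (σ (k h) (s (b _))) = b h
      rw [hp, hs, ← hb, hk]
  obtain ⟨l, hl, hl'⟩ := hρ (Representation.coind φ σ) (Representation.coind φ τ) P F
    (fun g a => rfl) (fun g m => Subtype.ext (funext fun h => by
      change f (ρ h (ρ g m)) = f (ρ (h * g) m)
      rw [map_mul]
      rfl)) hP
  refine ⟨LinearMap.proj 1 ∘ₗ Submodule.subtype _ ∘ₗ l, fun k m => ?_, LinearMap.ext fun m => ?_⟩
  · change (l (ρ (φ k) m)).1 1 = σ k ((l m).1 1)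
    rw [hl, ← (l m).2 k 1, mul_one]
    change (l m).1 (1 * φ k) = _
    rw [one_mul]
  · have h1 := congrArg (fun x : Representation.coindV φ τ => x.1 1) (LinearMap.congr_fun hl' m)
    change p ((l m).1 1) = f (ρ 1 m) at h1
    change p ((l m).1 1) = f m
    rw [h1, map_one]
    rfl

open Finsupp in
/-- A representation on `V →₀ N` that permutes the summands according to an action on `V` has the
lifting property if the stabilizers of the summands act with the lifting property. -/
theorem LiftProj.of_monomial {V N : Type u} [MulAction G V] [AddCommGroup N]
    {ρ : Representation ℤ G (V →₀ N)}
    (hρ : ∀ g v n, ∃ n', ρ g (single v n) = single (g • v) n')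
    (hstab : ∀ v, ∃ σ : Representation ℤ (MulAction.stabilizer G v) N, LiftProj σ ∧
      ∀ (g : MulAction.stabilizer G v) n, ρ g (single v n) = single v (σ g n)) : LiftProj ρ := by
  intro A B _ _ α β p f hp hf hsurj
  -- On each summand there is a lift that is equivariant for the stabilizer. Only those at the
  -- representatives of the orbits will be used; the others are obtained by transport.
  have hlift : ∀ v, ∃ l : N →ₗ[ℤ] A,
      (∀ (g : MulAction.stabilizer G v) n n', ρ g (single v n) = single v n' → l n' = α g (l n)) ∧
      ∀ n, p (l n) = f (single v n) := by
    intro v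
    obtain ⟨σ, hσ, h⟩ := hstab v
    obtain ⟨l, hl, hl'⟩ := hσ (α.comp (Subgroup.subtype _)) (β.comp (Subgroup.subtype _)) p
      (f ∘ₗ lsingle v) (fun g a => hp g a) (fun g n => by
        change f (single v (σ g n)) = β g (f (single v n))
        rw [← hf, h]) hsurj
    refine ⟨l, fun g n n' hn => ?_, fun n => LinearMap.congr_fun hl' n⟩
    rw [h] at hn
    rw [← single_injective v hn]
    exact hl g n
  choose l hl hl' using hlift
  have hx : ∀ v : V, ∃ x : G, x • v = (Quotient.mk (MulAction.orbitRel G V) v).out := fun v =>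
    Quotient.exact (Quotient.out_eq (Quotient.mk (MulAction.orbitRel G V) v))
  choose x hx using hx
  let r : V → V := fun v => (Quotient.mk (MulAction.orbitRel G V) v).out
  have hr : ∀ (g : G) v, r (g • v) = r v := fun g v => by
    change (Quotient.mk (MulAction.orbitRel G V) (g • v)).out = _
    rw [Quotient.sound (s := MulAction.orbitRel G V) (a := g • v) (b := v) ⟨g, rfl⟩]
  let F : (V →₀ N) →ₗ[ℤ] A := lsum ℤ fun v =>
    α (x v)⁻¹ ∘ₗ l (r v) ∘ₗ lapply (r v) ∘ₗ ρ (x v) ∘ₗ lsingle v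
  have hF : ∀ v n, F (single v n) = α (x v)⁻¹ (l (r v) (ρ (x v) (single v n) (r v))) := fun v n =>
    lsum_single ..
  -- Two elements that carry `v` to the representative differ by an element of its stabilizer, so
  -- the transported lift does not depend on the choice; this yields equivariance.
  have hFx : ∀ v n (y : G) n', y • v = r v → ρ y (single v n) = single (r v) n' →
      F (single v n) = α y⁻¹ (l (r v) n') := by
    intro v n y n' hy hn'
    obtain ⟨n₁, hn₁⟩ := hρ (x v) v n
    rw [hF, hn₁, show x v • v = r v from hx v, single_eq_same]
    have hmem : y * (x v)⁻¹ ∈ MulAction.stabilizer G (r v) := by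
      rw [MulAction.mem_stabilizer_iff, mul_smul, inv_smul_eq_iff.2 (hx v).symm, hy]
    rw [hl (r v) ⟨_, hmem⟩ n₁ n' ?_]
    · change _ = α y⁻¹ (α (y * (x v)⁻¹) _)
      rw [← Module.End.mul_apply, ← map_mul, inv_mul_cancel_left]
    · change ρ (y * (x v)⁻¹) _ = _
      rw [show x v • v = r v from hx v] at hn₁
      rw [← hn₁, ← Module.End.mul_apply, ← map_mul, inv_mul_cancel_right, hn']
  refine ⟨F, fun g c => ?_, LinearMap.ext fun c => ?_⟩
  · induction c using Finsupp.induction_linear with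
    | zero => simp
    | add c d hc hd => rw [map_add, map_add, map_add, map_add, hc, hd]
    | single v n =>
      obtain ⟨n₁, hn₁⟩ := hρ g v n
      obtain ⟨n₂, hn₂⟩ := hρ (x (g • v)) (g • v) n₁
      rw [show x (g • v) • g • v = r (g • v) from hx _] at hn₂
      rw [hn₁, hFx (g • v) n₁ (x (g • v)) n₂ (hx _) hn₂,
        hFx v n (x (g • v) * g) n₂ (by rw [mul_smul, hx, ← hr g]) (by
          rw [map_mul, Module.End.mul_apply, hn₁, hn₂, hr])]
      rw [← Module.End.mul_apply, ← map_mul, mul_inv_rev, mul_inv_cancel_left, hr]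
  · induction c using Finsupp.induction_linear with
    | zero => simp
    | add c d hc hd => rw [map_add, hc, hd, map_add]
    | single v n =>
      obtain ⟨n₁, hn₁⟩ := hρ (x v) v n
      rw [show x v • v = r v from hx v] at hn₁
      rw [LinearMap.comp_apply, hF, hn₁, single_eq_same, hp, hl', ← hn₁, hf,
        ← Module.End.mul_apply, ← map_mul, inv_mul_cancel, map_one]
      rfl

end LiftProj

/-! ### Group actions on rooted trees -/

/-- An action of `G` on an oriented tree with vertices `V` and edges `E`, with a root: each other
vertex `v` has a first edge `upEdge v` on its way to the root, which leads to `up v`. -/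
structure TreeAction (G V E : Type*) [Group G] [MulAction G V] [MulAction G E] where
  /-- The source of an edge. -/
  src : E → V
  /-- The target of an edge. -/
  tgt : E → V
  src_smul : ∀ (g : G) e, src (g • e) = g • src e
  tgt_smul : ∀ (g : G) e, tgt (g • e) = g • tgt e
  /-- The root. -/
  root : V
  /-- A height function. -/
  rank : V → ℕ
  /-- The next vertex on the way to the root. -/
  up : V → V
  /-- The next edge on the way to the root. -/
  upEdge : ∀ v, v ≠ root → E
  rank_up : ∀ v, v ≠ root → rank (up v) < rank v
  ends : ∀ v hv, (src (upEdge v hv) = up v ∧ tgt (upEdge v hv) = v) ∨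
    (src (upEdge v hv) = v ∧ tgt (upEdge v hv) = up v)
  exists_upEdge : ∀ e, ∃ v hv, upEdge v hv = e

/-- The diagonal representation on `V →₀ M`. -/
noncomputable def chainRep {G M : Type*} [Group G] [AddCommGroup M] (V : Type*) [MulAction G V]
    (ρ : Representation ℤ G M) : Representation ℤ G (V →₀ M) where
  toFun g := Finsupp.lsum ℤ fun v => Finsupp.lsingle (g • v) ∘ₗ ρ g
  map_one' := by
    refine Finsupp.lhom_ext fun v m => ?_
    simp
  map_mul' g h := by
    refine Finsupp.lhom_ext fun v m => ?_
    simp [mul_smul]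

section ChainRep

variable {G M V : Type*} [Group G] [AddCommGroup M] [MulAction G V] (ρ : Representation ℤ G M)

@[simp]
theorem chainRep_single (g : G) (v : V) (m : M) :
    chainRep V ρ g (Finsupp.single v m) = Finsupp.single (g • v) (ρ g m) := by
  simp [chainRep]

theorem chainRep_apply (g : G) (c : V →₀ M) (v : V) :
    chainRep V ρ g c v = ρ g (c (g⁻¹ • v)) := by
  classical
  induction c using Finsupp.induction_linear with
  | zero => simp
  | add c d hc hd => simp [hc, hd]
  | single w m =>
    rw [chainRep_single, Finsupp.single_apply, Finsupp.single_apply]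
    by_cases h : g • w = v
    · rw [if_pos h, if_pos (by rw [← h, inv_smul_smul])]
    · rw [if_neg h, if_neg (fun h' => h (by rw [h', smul_inv_smul])), map_zero]

/-- The sum of the coefficients. -/
noncomputable def chainSum (V M : Type*) [AddCommGroup M] : (V →₀ M) →ₗ[ℤ] M :=
  Finsupp.lsum ℤ fun _ => LinearMap.id

@[simp]
theorem chainSum_single {V M : Type*} [AddCommGroup M] (v : V) (m : M) :
    chainSum V M (Finsupp.single v m) = m := by
  simp [chainSum]

theorem equivariant_chainSum : Equivariant (chainRep V ρ) ρ (chainSum V M) := fun g c => by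
  induction c using Finsupp.induction_linear with
  | zero => simp
  | add c d hc hd => simp only [map_add, hc, hd]
  | single v m => simp

end ChainRep

theorem liftProj_chainRep {G V M : Type u} [Group G] [MulAction G V] [AddCommGroup M]
    {ρ : Representation ℤ G M}
    (h : ∀ v : V, LiftProj (ρ.comp (MulAction.stabilizer G v).subtype)) :
    LiftProj (chainRep V ρ) := by
  refine LiftProj.of_monomial (fun g v n => ⟨_, chainRep_single ρ g v n⟩) fun v =>
    ⟨_, h v, fun g n => ?_⟩
  rw [chainRep_single, MulAction.mem_stabilizer_iff.1 g.2]
  rfl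

namespace TreeAction

section Chains

variable {G V E : Type*} [Group G] [MulAction G V] [MulAction G E] (T : TreeAction G V E)

theorem exists_rec {α : Sort*} (a : α) (step : ∀ v, v ≠ T.root → α → α) :
    ∃ F : V → α, F T.root = a ∧ ∀ v hv, F v = step v hv (F (T.up v)) := by
  classical
  let wf := (measure T.rank).wf
  let F : V → α := wf.fix fun v ih =>
    if hv : v = T.root then a else step v hv (ih (T.up v) (T.rank_up v hv))
  have hF : ∀ v, F v = if hv : v = T.root then a else step v hv (F (T.up v)) := fun v =>
    wf.fix_eq _ v
  exact ⟨F, by rw [hF, dif_pos rfl], fun v hv => by rw [hF, dif_neg hv]⟩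

theorem induction {P : V → Prop} (root : P T.root)
    (step : ∀ v, v ≠ T.root → P (T.up v) → P v) (v : V) : P v := by
  induction h : T.rank v using Nat.strong_induction_on generalizing v with
  | _ n ih =>
    by_cases hv : v = T.root
    · exact hv ▸ root
    · exact step v hv (ih _ (h ▸ T.rank_up v hv) _ rfl)

theorem up_ne {v : V} (hv : v ≠ T.root) : T.up v ≠ v := fun h =>
  (T.rank_up v hv).ne (congrArg T.rank h)

variable (M : Type*) [AddCommGroup M]

/-- The boundary map from the chains of edges to the chains of vertices. -/
noncomputable def boundary : (E →₀ M) →ₗ[ℤ] (V →₀ M) :=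
  Finsupp.lsum ℤ fun e => Finsupp.lsingle (T.tgt e) - Finsupp.lsingle (T.src e)

@[simp]
theorem boundary_single (e : E) (m : M) : T.boundary M (Finsupp.single e m) =
    Finsupp.single (T.tgt e) m - Finsupp.single (T.src e) m := by
  simp [boundary]

theorem equivariant_boundary (ρ : Representation ℤ G M) :
    Equivariant (chainRep E ρ) (chainRep V ρ) (T.boundary M) := fun g c => by
  induction c using Finsupp.induction_linear with
  | zero => simp
  | add c d hc hd => simp only [map_add, hc, hd]
  | single v m => simp [T.src_smul, T.tgt_smul]

@[simp]
theorem chainSum_boundary (c : E →₀ M) : chainSum V M (T.boundary M c) = 0 := by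
  induction c using Finsupp.induction_linear with
  | zero => simp
  | add c d hc hd => simp only [map_add, hc, hd, add_zero]
  | single v m => simp

/-- The chain complex of a tree is contractible. -/
theorem exists_contraction : ∃ κ : (V →₀ M) →ₗ[ℤ] (E →₀ M), (∀ c, κ (T.boundary M c) = c) ∧
    ∀ y, T.boundary M (κ y) = y - Finsupp.single T.root (chainSum V M y) := by
  classical
  -- `F v m` is the path from the root to `v` with coefficient `m`; the sign of an edge records
  -- whether the path follows its orientation.
  obtain ⟨F, hF0, hF⟩ := T.exists_rec (0 : M →ₗ[ℤ] (E →₀ M)) fun v hv f =>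
    if T.tgt (T.upEdge v hv) = v then f + Finsupp.lsingle (T.upEdge v hv)
    else f - Finsupp.lsingle (T.upEdge v hv)
  have hFs : ∀ v m, Finsupp.lsum ℤ F (Finsupp.single v m) = F v m := fun v m =>
    Finsupp.lsum_single ..
  refine ⟨Finsupp.lsum ℤ F, fun c => ?_, fun y => ?_⟩
  · induction c using Finsupp.induction_linear with
    | zero => simp
    | add c d hc hd => simp only [map_add, hc, hd]
    | single e m =>
      obtain ⟨v, hv, rfl⟩ := T.exists_upEdge e
      rw [boundary_single, map_sub, hFs, hFs]
      obtain ⟨h1, h2⟩ | ⟨h1, h2⟩ := T.ends v hv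
      · rw [h1, h2, hF v hv, if_pos h2]
        simp
      · rw [h1, h2, hF v hv, if_neg (h2.trans_ne (T.up_ne hv))]
        simp
  · induction y using Finsupp.induction_linear with
    | zero => simp
    | add c d hc hd =>
      simp only [map_add, hc, hd, Finsupp.single_add]
      abel
    | single v m =>
      rw [hFs, chainSum_single]
      induction v using T.induction with
      | root => simp [hF0]
      | step v hv ih =>
        rw [hF v hv]
        obtain ⟨h1, h2⟩ | ⟨h1, h2⟩ := T.ends v hv
        · rw [if_pos h2, LinearMap.add_apply, map_add, ih, Finsupp.lsingle_apply,
            boundary_single, h1, h2]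
          abel
        · rw [if_neg (h2.trans_ne (T.up_ne hv)), LinearMap.sub_apply, map_sub, ih,
            Finsupp.lsingle_apply, boundary_single, h1, h2]
          abel

end Chains

/-! ### Moore's conjecture for groups acting on trees -/

section Moore

variable {G V E : Type u} [Group G] [MulAction G V] [MulAction G E]
  {H : Subgroup G}

theorem stabilizer_quotient_le [H.Normal] (q : G ⧸ H) : MulAction.stabilizer G q ≤ H := by
  intro x hx
  induction q using QuotientGroup.induction_on with
  | H g =>
    have h := QuotientGroup.eq.1 (MulAction.mem_stabilizer_iff.1 hx)
    have h' : x⁻¹ ∈ H := by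
      have := ‹H.Normal›.conj_mem _ h g
      simpa [mul_assoc] using this
    exact inv_mem_iff.1 h'

open Finsupp in
/-- If `G` acts on a tree in such a way that every representation that is projective over `H` is
projective over the stabilizers of vertices and edges, then every such representation is
projective. -/
theorem liftsProjective (T : TreeAction G V E) [H.Normal] [Finite (G ⧸ H)]
    (hV : ∀ (v : V) (M : Type u) [AddCommGroup M] (ρ : Representation ℤ G M),
      LiftProj (ρ.comp H.subtype) → LiftProj (ρ.comp (MulAction.stabilizer G v).subtype))
    (hE : ∀ (e : E) (M : Type u) [AddCommGroup M] (ρ : Representation ℤ G M),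
      LiftProj (ρ.comp H.subtype) → LiftProj (ρ.comp (MulAction.stabilizer G e).subtype)) :
    LiftsProjective H := by
  intro M _ ρ hρ
  -- `σ` is `M ⊗ ℤ[G/H]` with the diagonal action. It is projective over `G`, since the stabilizers
  -- of the points of `G/H` lie in `H`, and it contains `M` as the constant functions.
  let σ := chainRep (G ⧸ H) ρ
  have hσ : LiftProj σ := liftProj_chainRep fun q =>
    hρ.comp_injective (Subgroup.inclusion_injective (stabilizer_quotient_le q))
  let i : M →ₗ[ℤ] (G ⧸ H →₀ M) :=
    (linearEquivFunOnFinite ℤ M (G ⧸ H)).symm.toLinearMap ∘ₗ LinearMap.pi fun _ => LinearMap.id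
  have hi_apply : ∀ m q, i m q = m := fun m q => rfl
  have hi : Equivariant ρ σ i := fun g m => Finsupp.ext fun q => by
    rw [chainRep_apply, hi_apply, hi_apply]
  let N := (G ⧸ H →₀ M) ⧸ LinearMap.range i
  let π : (G ⧸ H →₀ M) →ₗ[ℤ] N := (LinearMap.range i).mkQ
  have hle : ∀ g, LinearMap.range i ≤ (LinearMap.range i).comap (σ g) := by
    rintro g _ ⟨m, rfl⟩
    exact ⟨ρ g m, hi g m⟩
  let τ : Representation ℤ G N :=
    { toFun := fun g => (LinearMap.range i).mapQ _ (σ g) (hle g)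
      map_one' := Submodule.linearMap_qext _ (LinearMap.ext fun c => by simp)
      map_mul' := fun g h => Submodule.linearMap_qext _ (LinearMap.ext fun c => by simp) }
  have hπ : Equivariant σ τ π := fun g c => rfl
  have hπ_surj : Function.Surjective π := Submodule.mkQ_surjective _
  have hπ_zero : ∀ c, π c = 0 → ∃ m, i m = c := fun c hc =>
    (Submodule.Quotient.mk_eq_zero _).1 hc
  have hπi : ∀ m, π (i m) = 0 := fun m => (Submodule.Quotient.mk_eq_zero _).2 ⟨m, rfl⟩
  -- Over `H`, evaluation at the coset `1` splits the inclusion of `M`, so the cokernel `N` is a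
  -- direct summand of `σ`.
  have hτ : LiftProj (τ.comp H.subtype) := by
    let s : N →ₗ[ℤ] (G ⧸ H →₀ M) := (LinearMap.range i).liftQ
      (LinearMap.id - i ∘ₗ lapply (1 : G ⧸ H)) (by
        rintro _ ⟨m, rfl⟩
        refine Finsupp.ext fun q => ?_
        change i m q - i (i m 1) q = 0
        rw [hi_apply, hi_apply, hi_apply, sub_self])
    refine (hσ.comp_injective H.subtype_injective).of_retract (i := s) (r := π) ?_
      (fun g c => hπ g c) ?_
    · intro g c
      obtain ⟨c, rfl⟩ := hπ_surj c
      change σ g c - i (σ g c 1) = σ g (c - i (c 1))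
      rw [map_sub, ← hi, chainRep_apply]
      have : (g : G)⁻¹ • (1 : G ⧸ H) = 1 :=
        (QuotientGroup.eq_one_iff ((g : G)⁻¹ * 1)).2 (by rw [mul_one]; exact inv_mem g.2)
      exact congrArg (fun q => σ g c - i (ρ g (c q))) this
    · intro c
      obtain ⟨c, rfl⟩ := hπ_surj c
      change π (c - i (c 1)) = π c
      rw [map_sub, hπi, sub_zero]
  -- The chains of the tree with coefficients in `N` form a short exact sequence ending in `N`; its
  -- edge and vertex terms are projective by the assumptions on stabilizers.
  have hP : LiftProj (chainRep V τ) := liftProj_chainRep fun v => hV v _ τ hτ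
  have hA : LiftProj (chainRep E τ) := liftProj_chainRep fun e => hE e _ τ hτ
  obtain ⟨κ, hκ, hκ'⟩ := T.exists_contraction N
  have hsum : Function.Surjective (chainSum V N) := fun n => ⟨single T.root n, by simp⟩
  obtain ⟨θ, hθ, hθ'⟩ := hσ (chainRep V τ) τ (chainSum V N) π (equivariant_chainSum τ) hπ hsum
  obtain ⟨ψ, hψ, hψ'⟩ := hP σ τ π (chainSum V N) hπ (equivariant_chainSum τ) hπ_surj
  replace hθ' : ∀ c, chainSum V N (θ c) = π c := fun c => LinearMap.congr_fun hθ' c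
  replace hψ' : ∀ c, π (ψ c) = chainSum V N c := fun c => LinearMap.congr_fun hψ' c
  have hi_inj : Function.Injective i := fun m m' h => by
    rw [← hi_apply m 1, h, hi_apply]
  have hbd_inj : Function.Injective (T.boundary N) := fun c d h => by
    rw [← hκ c, h, hκ]
  have hbκ : ∀ m, T.boundary N (κ (θ (i m))) = θ (i m) := fun m => by
    rw [hκ', hθ', hπi, single_zero, sub_zero]
  let ev : (G ⧸ H →₀ M) →ₗ[ℤ] M := lapply 1
  have hev : ∀ c, π c = 0 → i (ev c) = c := by
    intro c hc
    obtain ⟨m, rfl⟩ := hπ_zero c hc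
    rfl
  have h1 : ∀ c, π (c - ψ (θ c)) = 0 := fun c => by rw [map_sub, hψ', hθ', sub_self]
  have h2 : ∀ a, π (ψ (T.boundary N a)) = 0 := fun a => by rw [hψ', chainSum_boundary]
  -- Schanuel's lemma for the two projective modules that map onto `N`, with kernels `M` and the
  -- edge chains: `M` is a summand of the sum of `σ` and the edge chains. The maps `θ` and `ψ` lift
  -- each surjection through the other, and `ev` inverts `i` on its image.
  refine hσ.of_retract_add hA (i₁ := i) (r₁ := ev ∘ₗ (LinearMap.id - ψ ∘ₗ θ))
    (i₂ := κ ∘ₗ θ ∘ₗ i) (r₂ := ev ∘ₗ ψ ∘ₗ T.boundary N) hi ?_ ?_ ?_ ?_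
  · intro g c
    refine hi_inj ?_
    change i (ev (σ g c - ψ (θ (σ g c)))) = i (ρ g (ev (c - ψ (θ c))))
    rw [hev _ (h1 _), hi, hev _ (h1 _), map_sub, hθ, hψ]
  · intro g m
    refine hbd_inj ?_
    change T.boundary N (κ (θ (i (ρ g m)))) = T.boundary N (chainRep E τ g (κ (θ (i m))))
    rw [T.equivariant_boundary, hbκ, hbκ, hi, hθ]
  · intro g c
    refine hi_inj ?_
    change i (ev (ψ (T.boundary N (chainRep E τ g c)))) = i (ρ g (ev (ψ (T.boundary N c))))
    rw [hev _ (h2 _), hi, hev _ (h2 _), T.equivariant_boundary, hψ]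
  · intro m
    refine hi_inj ?_
    change i (ev (i m - ψ (θ (i m))) + ev (ψ (T.boundary N (κ (θ (i m)))))) = i m
    rw [map_add, hev _ (h1 _), hev _ (h2 _), hbκ, sub_add_cancel]

end Moore

end TreeAction

/-! ### Elements of prime order acting on trees -/

section PrimeOrder

variable {G X : Type*} [Group G] [MulAction G X] {g : G}

/-- As the order is prime, each nontrivial power of `g` generates the same group as `g` and has no
fixed point either. So the cyclic group acts freely, and representatives of its orbits form the set.
-/
theorem exists_fundamental_domain (hg : (orderOf g).Prime) (hX : ∀ x : X, g • x ≠ x) :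
    ∃ F : Set X, ∀ x, ∃ i ∈ Finset.range (orderOf g), ∀ j ∈ Finset.range (orderOf g),
      (g ^ j)⁻¹ • x ∈ F ↔ j = i := by
  have hfree : ∀ (k : ℤ) (x : X), g ^ k • x = x → (orderOf g : ℤ) ∣ k := by
    intro k x hk
    by_contra hdvd
    obtain ⟨a, b, hab⟩ := (Nat.prime_iff_prime_int.1 hg).coprime_iff_not_dvd.2 hdvd
    refine hX x (MulAction.mem_stabilizer_iff.1 ?_)
    have h : g = (g ^ k) ^ b := by
      rw [← zpow_mul]
      have h1 : g ^ (a * (orderOf g : ℤ) + b * k) = g ^ (1 : ℤ) := by rw [hab]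
      rw [zpow_add, mul_comm a, zpow_mul, zpow_natCast, pow_orderOf_eq_one, one_zpow, one_mul,
        zpow_one, mul_comm b] at h1
      exact h1.symm
    rw [h]
    exact zpow_mem (MulAction.mem_stabilizer_iff.2 hk) b
  let s := MulAction.orbitRel (Subgroup.zpowers g) X
  let r : X → X := fun x => (Quotient.mk s x).out
  have hr : ∀ (h : Subgroup.zpowers g) x, r (h • x) = r x := fun h x => by
    change (Quotient.mk s (h • x)).out = _
    rw [Quotient.sound (s := s) (a := h • x) (b := x) ⟨h, rfl⟩]
  refine ⟨{x | x = r x}, fun x => ?_⟩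
  obtain ⟨⟨h, hh⟩, hx⟩ : ∃ h : Subgroup.zpowers g, h • r x = x := by
    obtain ⟨h, hx⟩ := Quotient.exact (Quotient.out_eq (Quotient.mk s x))
    exact ⟨h⁻¹, inv_smul_eq_iff.2 hx.symm⟩
  have hfin : IsOfFinOrder g := orderOf_pos_iff.1 hg.pos
  obtain ⟨k, rfl⟩ := hfin.mem_powers_iff_mem_zpowers.2 hh
  have hx' : g ^ (k % orderOf g) • r x = x := by
    rw [pow_mod_orderOf]
    exact hx
  refine ⟨k % orderOf g, Finset.mem_range.2 (Nat.mod_lt _ hg.pos), fun j hj => ?_⟩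
  have hrj : r ((g ^ j)⁻¹ • x) = r x :=
    hr ⟨(g ^ j)⁻¹, inv_mem (pow_mem (Subgroup.mem_zpowers g) j)⟩ x
  rw [Set.mem_ofPred_eq, hrj, inv_smul_eq_iff]
  constructor
  · intro h
    have h1 : g ^ ((j : ℤ) - (k % orderOf g : ℕ)) • x = x := by
      have h2 : g ^ ((k % orderOf g : ℕ) : ℤ) • r x = x := by rwa [zpow_natCast]
      rw [zpow_sub, mul_smul, inv_smul_eq_iff.2 h2.symm, zpow_natCast, ← h]
    have h2 := hfree _ _ h1
    have h3 := Finset.mem_range.1 hj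
    have h4 := Nat.mod_lt k hg.pos
    have h5 := Int.eq_zero_of_abs_lt_dvd h2 (by rw [abs_lt]; constructor <;> omega)
    omega
  · rintro rfl
    exact hx'.symm

/-- `χ` restricts chains to a fundamental domain; each point lies in exactly one translate of this
set. This is the reason for the vanishing of Tate cohomology that `dvd_chainSum` and
`exists_sub_eq_of_sum_eq_zero` express. -/
theorem exists_projector (hg : (orderOf g).Prime) (hX : ∀ x : X, g • x ≠ x) :
    ∃ χ : (X →₀ ℤ) →ₗ[ℤ] (X →₀ ℤ), ∀ c, ∑ i ∈ Finset.range (orderOf g),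
      chainRep X (Representation.trivial ℤ G ℤ) (g ^ i)
        (χ (chainRep X (Representation.trivial ℤ G ℤ) (g ^ i)⁻¹ c)) = c := by
  classical
  obtain ⟨F, hF⟩ := exists_fundamental_domain hg hX
  let χ : (X →₀ ℤ) →ₗ[ℤ] (X →₀ ℤ) :=
    Finsupp.lsum ℤ fun x => if x ∈ F then Finsupp.lsingle x else 0
  have hχ : ∀ x n, χ (Finsupp.single x n) = if x ∈ F then Finsupp.single x n else 0 := by
    intro x n
    rw [Finsupp.lsum_single]
    split_ifs <;> rfl
  refine ⟨χ, fun c => ?_⟩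
  induction c using Finsupp.induction_linear with
  | zero => simp
  | add c d hc hd => simp only [map_add, Finset.sum_add_distrib, hc, hd]
  | single x n =>
    obtain ⟨i, hi, h⟩ := hF x
    rw [Finset.sum_eq_single_of_mem i hi]
    · rw [chainRep_single, hχ, if_pos ((h i hi).2 rfl), chainRep_single, smul_inv_smul]
      rfl
    · intro j hj hji
      rw [chainRep_single, hχ, if_neg (fun h' => hji ((h j hj).1 h')), map_zero]

/-- An invariant chain is the norm of its restriction to a fundamental domain, and the norm
multiplies the sum of the coefficients by the order of `g`. -/
theorem dvd_chainSum (hg : (orderOf g).Prime) (hX : ∀ x : X, g • x ≠ x) {c : X →₀ ℤ}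
    (hc : chainRep X (Representation.trivial ℤ G ℤ) g c = c) :
    (orderOf g : ℤ) ∣ chainSum X ℤ c := by
  obtain ⟨χ, hχ⟩ := exists_projector hg hX
  have hinv : ∀ i : ℕ, chainRep X (Representation.trivial ℤ G ℤ) (g ^ i)⁻¹ c = c := by
    intro i
    have h : ∀ i : ℕ, chainRep X (Representation.trivial ℤ G ℤ) (g ^ i) c = c := by
      intro i
      induction i with
      | zero => simp
      | succ i ih => rw [pow_succ, map_mul, Module.End.mul_apply, hc, ih]
    conv_lhs => rw [← h i]
    rw [← Module.End.mul_apply, ← map_mul, inv_mul_cancel, map_one]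
    rfl
  have h := congrArg (chainSum X ℤ) (hχ c)
  rw [map_sum] at h
  refine ⟨chainSum X ℤ (χ c), h.symm.trans ?_⟩
  rw [Finset.sum_congr rfl (g := fun _ => chainSum X ℤ (χ c)) fun i _ => by
    rw [hinv, equivariant_chainSum]
    rfl]
  simp

/-- If the norm is zero, then `∑ χ (g⁻ⁱ c) = 0` may be subtracted from `c = ∑ gⁱ χ (g⁻ⁱ c)`, and
each resulting term `gⁱ y - y` is in the image of `1 - g`. -/
theorem exists_sub_eq_of_sum_eq_zero (hg : (orderOf g).Prime) (hX : ∀ x : X, g • x ≠ x)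
    {c : X →₀ ℤ} (hc : ∑ i ∈ Finset.range (orderOf g),
      chainRep X (Representation.trivial ℤ G ℤ) (g ^ i)⁻¹ c = 0) :
    ∃ d, d - chainRep X (Representation.trivial ℤ G ℤ) g d = c := by
  obtain ⟨χ, hχ⟩ := exists_projector hg hX
  set σ := chainRep X (Representation.trivial ℤ G ℤ)
  have h : ∀ (i : ℕ) y, σ (g ^ i) y - y ∈ LinearMap.range (LinearMap.id - σ g) := by
    intro i
    induction i with
    | zero => simp
    | succ i ih =>
      intro y
      have h1 : σ (g ^ (i + 1)) y - y = (σ (g ^ i) (σ g y) - σ g y) - (y - σ g y) := by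
        rw [pow_succ, map_mul, Module.End.mul_apply]
        abel
      rw [h1]
      exact sub_mem (ih _) ⟨y, rfl⟩
  have h1 : c = ∑ i ∈ Finset.range (orderOf g),
      (σ (g ^ i) (χ (σ (g ^ i)⁻¹ c)) - χ (σ (g ^ i)⁻¹ c)) := by
    rw [Finset.sum_sub_distrib, hχ, ← map_sum, hc, map_zero, sub_zero]
  rw [h1]
  exact LinearMap.mem_range.1 (sum_mem fun i _ => h i _)

end PrimeOrder

/-- An element of prime order that acts on a tree fixes a vertex. -/
theorem TreeAction.exists_smul_eq {G V E : Type*} [Group G] [MulAction G V] [MulAction G E]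
    (T : TreeAction G V E) {g : G} (hg : (orderOf g).Prime) : ∃ v : V, g • v = v := by
  by_contra! hV
  have hE : ∀ e : E, g • e ≠ e := fun e he => hV (T.src e) (by rw [← T.src_smul, he])
  obtain ⟨κ, hκ, hκ'⟩ := T.exists_contraction ℤ
  let y : V →₀ ℤ := Finsupp.single T.root 1
  have hy : T.boundary ℤ (κ (y - chainRep V (Representation.trivial ℤ G ℤ) g y)) = y - chainRep V (Representation.trivial ℤ G ℤ) g y := by
    rw [hκ', map_sub, equivariant_chainSum]
    simp [y]
  -- The path `κ (y - g y)` has norm zero: the boundary of the norm telescopes, and the boundary map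
  -- is injective. So the path is `d - g d`, and `y` minus the boundary of `d` is an invariant chain
  -- with coefficient sum `1`, contrary to `dvd_chainSum`.
  obtain ⟨d, hd⟩ := exists_sub_eq_of_sum_eq_zero hg hE (c := κ (y - chainRep V (Representation.trivial ℤ G ℤ) g y)) (by
    rw [← hκ (∑ i ∈ _, _), map_sum]
    rw [Finset.sum_congr rfl (g := fun i => chainRep V (Representation.trivial ℤ G ℤ) (g ^ (i + 1))⁻¹ (chainRep V (Representation.trivial ℤ G ℤ) g y) -
      chainRep V (Representation.trivial ℤ G ℤ) (g ^ i)⁻¹ (chainRep V (Representation.trivial ℤ G ℤ) g y)) fun i _ => by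
        rw [T.equivariant_boundary, hy, map_sub]
        refine congrArg₂ (· - ·) ?_ rfl
        rw [← Module.End.mul_apply, ← map_mul, pow_succ', mul_inv_rev, inv_mul_cancel_right]]
    rw [Finset.sum_range_sub fun i => chainRep V (Representation.trivial ℤ G ℤ) (g ^ i)⁻¹ (chainRep V (Representation.trivial ℤ G ℤ) g y)]
    simp [pow_orderOf_eq_one])
  have h1 : chainRep V (Representation.trivial ℤ G ℤ) g (y - T.boundary ℤ d) = y - T.boundary ℤ d := by
    have h2 := congrArg (T.boundary ℤ) hd
    rw [hy, map_sub, T.equivariant_boundary] at h2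
    rw [map_sub, sub_eq_sub_iff_sub_eq_sub, ← neg_sub, ← h2, neg_sub]
  have h2 := dvd_chainSum hg hV h1
  rw [map_sub, T.chainSum_boundary] at h2
  simp only [y, chainSum_single, sub_zero] at h2
  exact hg.one_lt.ne' (by exact_mod_cast Int.eq_one_of_dvd_one (by positivity) h2)

/-! ### Restriction of Moore's conjecture to subgroups -/

-- The induced representation consists of copies of `N` indexed by the cosets of `φ.range`. Over `H`
-- these copies are permuted with stabilizers that embed into `H.comap φ`, by normality of `H`, so
-- it is projective over `H` and therefore over `Γ`. Restricted along `φ` it contains `N` as the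
-- summand at the trivial coset.
open Finsupp in
theorem LiftsProjective.comap {Γ₀ Γ : Type u} [Group Γ₀] [Group Γ] {H : Subgroup Γ} [H.Normal]
    (hH : LiftsProjective H) {φ : Γ₀ →* Γ} (hφ : Function.Injective φ) :
    LiftsProjective (H.comap φ) := by
  classical
  intro N _ ρ hρ
  let t : Γ ⧸ φ.range → Γ := Quotient.out
  have ht : ∀ x, (t x : Γ ⧸ φ.range) = x := fun x => Quotient.out_eq x
  have hc : ∀ (g : Γ) x, ∃ c, φ c = (t (g • x))⁻¹ * g * t x := by
    intro g x
    have h : ((t (g • x) : Γ) : Γ ⧸ φ.range) = ((g * t x : Γ) : Γ ⧸ φ.range) := by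
      rw [ht]
      conv_lhs => rw [← ht x]
      rfl
    obtain ⟨c, hc⟩ := QuotientGroup.eq.1 h
    exact ⟨c, by rw [hc, mul_assoc]⟩
  choose c hc using hc
  have hmul : ∀ g h x, c (g * h) x = c g (h • x) * c h x := fun g h x => hφ (by
    rw [map_mul, hc, hc, hc, mul_smul]
    group)
  let σ : Representation ℤ Γ (Γ ⧸ φ.range →₀ N) :=
    { toFun := fun g => lsum ℤ fun x => lsingle (g • x) ∘ₗ ρ (c g x)
      map_one' := by
        have h1 : ∀ x, c 1 x = 1 := fun x => hφ (by rw [hc, one_smul]; simp)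
        refine lhom_ext fun x n => ?_
        simp [h1]
      map_mul' := fun g h => by
        refine lhom_ext fun x n => ?_
        simp [hmul, mul_smul] }
  have hσ_single : ∀ g x n, σ g (single x n) = single (g • x) (ρ (c g x) n) := fun g x n =>
    lsum_single ..
  have hσ : LiftProj (σ.comp H.subtype) := by
    refine LiftProj.of_monomial (fun g x n => ⟨_, hσ_single g x n⟩) fun x => ?_
    have hcx : ∀ g : MulAction.stabilizer H x, φ (c (g : H) x) = (t x)⁻¹ * ((g : H) : Γ) * t x := by
      intro g
      have h : ((g : H) : Γ) • x = x := g.2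
      rw [hc, h]
    let f : MulAction.stabilizer H x →* H.comap φ :=
      { toFun := fun g => ⟨c (g : H) x, by
          rw [Subgroup.mem_comap, hcx]
          simpa using ‹H.Normal›.conj_mem _ (g : H).2 (t x)⁻¹⟩
        map_one' := Subtype.ext (hφ (by
          change φ (c ((1 : MulAction.stabilizer H x) : H) x) = φ 1
          rw [hcx]
          simp))
        map_mul' := fun g h => Subtype.ext (hφ (by
          change φ (c ((g * h : MulAction.stabilizer H x) : H) x) =
            φ (c (g : H) x * c (h : H) x)
          rw [hcx, map_mul, hcx, hcx]
          simp [mul_assoc])) }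
    have hf : Function.Injective f := fun g h hgh => by
      have h1 := congrArg (fun y : H.comap φ => φ y) hgh
      change φ (c (g : H) x) = φ (c (h : H) x) at h1
      rw [hcx, hcx] at h1
      exact Subtype.ext (Subtype.ext (by simpa using h1))
    refine ⟨_, hρ.comp_injective hf, fun g n => ?_⟩
    have h : ((g : H) : Γ) • x = x := g.2
    change σ ((g : H) : Γ) (single x n) = _
    rw [hσ_single, h]
    rfl
  let x₀ : Γ ⧸ φ.range := (1 : Γ)
  -- The chosen representative of the trivial coset need not be `1`, so `N` is identified with its
  -- copy by a twist with `a`.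
  obtain ⟨a, ha⟩ : ∃ a, φ a = t x₀ := by
    obtain ⟨a, ha⟩ := QuotientGroup.eq.1 (ht x₀).symm
    exact ⟨a, by rw [ha, inv_one, one_mul]⟩
  have hx₀ : ∀ γ, φ γ • x₀ = x₀ := fun γ =>
    (QuotientGroup.eq.2 ⟨γ⁻¹, by simp⟩ : ((φ γ * 1 : Γ) : Γ ⧸ φ.range) = (1 : Γ))
  have hcx₀ : ∀ γ, c (φ γ) x₀ = a⁻¹ * γ * a := fun γ => hφ (by
    rw [hc, hx₀, ← ha]
    simp)
  refine ((hH _ σ hσ).comp_injective hφ).of_retract (i := lsingle x₀ ∘ₗ ρ a⁻¹)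
    (r := ρ a ∘ₗ lapply x₀) (fun γ n => ?_) (fun γ y => ?_) fun n => ?_
  · change single x₀ (ρ a⁻¹ (ρ γ n)) = σ (φ γ) (single x₀ (ρ a⁻¹ n))
    rw [hσ_single, hx₀, hcx₀]
    simp only [← Module.End.mul_apply, ← map_mul, mul_inv_cancel_right]
  · change ρ a (σ (φ γ) y x₀) = ρ γ (ρ a (y x₀))
    induction y using Finsupp.induction_linear with
    | zero => simp
    | add y z hy hz => simp only [map_add, Finsupp.add_apply, hy, hz]
    | single x n =>
      rw [hσ_single]
      by_cases h : x = x₀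
      · subst h
        rw [hx₀, single_eq_same, single_eq_same, hcx₀]
        simp only [← Module.End.mul_apply, ← map_mul]
        simp [mul_assoc]
      · have h' : φ γ • x ≠ x₀ := fun h' => h (by
          rw [← hx₀ γ] at h'
          exact MulAction.injective _ h')
        rw [single_eq_of_ne' h, single_eq_of_ne' h', map_zero, map_zero]
  · change ρ a (single x₀ (ρ a⁻¹ n) x₀) = n
    rw [single_eq_same, ← Module.End.mul_apply, ← map_mul, mul_inv_cancel, map_one]
    rfl

/-! ### The geometric realization of a tree -/

namespace TreeAction

variable {G V E : Type u} [Group G] [MulAction G V] [MulAction G E]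

/-- The points of the geometric realization of a tree. -/
inductive Realization (T : TreeAction G V E) : Type u
  | vert (v : V) : Realization T
  | pt (e : E) (s : Set.Ioo (0 : ℝ) 1) : Realization T

namespace Realization

variable {T : TreeAction G V E}

/-- The parametrization of an edge, extended to the real line by constant maps. -/
noncomputable def edge (T : TreeAction G V E) (e : E) (x : ℝ) : Realization T :=
  if hx : x ∈ Set.Ioo (0 : ℝ) 1 then pt e ⟨x, hx⟩
  else if x ≤ 0 then vert (T.src e) else vert (T.tgt e)

theorem edge_of_mem {e : E} {x : ℝ} (hx : x ∈ Set.Ioo (0 : ℝ) 1) : edge T e x = pt e ⟨x, hx⟩ :=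
  dif_pos hx

theorem edge_of_nonpos {e : E} {x : ℝ} (hx : x ≤ 0) : edge T e x = vert (T.src e) := by
  rw [edge, dif_neg fun h => hx.not_gt h.1, if_pos hx]

theorem edge_of_one_le {e : E} {x : ℝ} (hx : 1 ≤ x) : edge T e x = vert (T.tgt e) := by
  rw [edge, dif_neg fun h => hx.not_gt h.2, if_neg fun h => zero_lt_one.not_ge (hx.trans h)]

/-- The weak topology. -/
noncomputable instance : TopologicalSpace (Realization T) :=
  ⨆ e, TopologicalSpace.coinduced (edge T e) inferInstance

theorem continuous_iff {Y : Type*} [TopologicalSpace Y] {f : Realization T → Y} :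
    Continuous f ↔ ∀ e, Continuous (f ∘ edge T e) := by
  rw [continuous_iSup_dom]
  exact forall_congr' fun e => continuous_coinduced_dom

theorem continuous_edge (e : E) : Continuous (edge T e) := continuous_iff.1 continuous_id e

theorem isClosed_iff {A : Set (Realization T)} :
    IsClosed A ↔ ∀ e, IsClosed (edge T e ⁻¹' A) := by
  rw [isClosed_iSup_iff]
  exact forall_congr' fun e => isClosed_coinduced

/-- The retraction of the real line to the unit interval. -/
noncomputable def clamp (x : ℝ) : ℝ := max 0 (min x 1)

theorem continuous_clamp : Continuous clamp := by
  unfold clamp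
  fun_prop

theorem clamp_of_mem {x : ℝ} (hx : x ∈ Set.Ioo (0 : ℝ) 1) : clamp x = x := by
  rw [clamp, min_eq_left hx.2.le, max_eq_right hx.1.le]

theorem clamp_of_nonpos {x : ℝ} (hx : x ≤ 0) : clamp x = 0 :=
  max_eq_left (min_le_of_left_le hx)

theorem clamp_of_one_le {x : ℝ} (hx : 1 ≤ x) : clamp x = 1 := by
  rw [clamp, min_eq_right hx, max_eq_right zero_le_one]

open Classical in
/-- The piecewise linear function with the value `1` at `v` and `0` at the other vertices. -/
noncomputable def hat (v : V) : Realization T → ℝ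
  | vert w => if w = v then 1 else 0
  | pt e s => (1 - s) * (if T.src e = v then 1 else 0) + s * (if T.tgt e = v then 1 else 0)

open Classical in
/-- A function that is positive on the interior of `e` and zero elsewhere. -/
noncomputable def bump (e : E) : Realization T → ℝ
  | vert _ => 0
  | pt e' s => if e' = e then s * (1 - s) else 0

theorem continuous_hat (v : V) : Continuous (hat v : Realization T → ℝ) := by
  classical
  refine continuous_iff.2 fun e => ?_
  have h : (hat v : Realization T → ℝ) ∘ edge T e = fun x =>
      (1 - clamp x) * (if T.src e = v then 1 else 0) + clamp x * (if T.tgt e = v then 1 else 0) := by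
    funext x
    rw [Function.comp_apply]
    rcases le_or_gt x 0 with hx | hx
    · rw [edge_of_nonpos hx, clamp_of_nonpos hx]
      simp [hat]
    · rcases le_or_gt 1 x with hx' | hx'
      · rw [edge_of_one_le hx', clamp_of_one_le hx']
        simp [hat]
      · rw [edge_of_mem ⟨hx, hx'⟩, clamp_of_mem ⟨hx, hx'⟩]
        rfl
  rw [h]
  have := continuous_clamp
  fun_prop

theorem continuous_bump (e : E) : Continuous (bump e : Realization T → ℝ) := by
  classical
  refine continuous_iff.2 fun e' => ?_
  have h : (bump e : Realization T → ℝ) ∘ edge T e' = fun x =>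
      (if e' = e then 1 else 0) * (clamp x * (1 - clamp x)) := by
    funext x
    rw [Function.comp_apply]
    rcases le_or_gt x 0 with hx | hx
    · rw [edge_of_nonpos hx, clamp_of_nonpos hx]
      simp [bump]
    · rcases le_or_gt 1 x with hx' | hx'
      · rw [edge_of_one_le hx', clamp_of_one_le hx']
        simp [bump]
      · rw [edge_of_mem ⟨hx, hx'⟩, clamp_of_mem ⟨hx, hx'⟩]
        simp [bump]
  rw [h]
  have := continuous_clamp
  fun_prop

end Realization

theorem src_ne_tgt (T : TreeAction G V E) (e : E) : T.src e ≠ T.tgt e := by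
  obtain ⟨v, hv, rfl⟩ := T.exists_upEdge e
  obtain ⟨h1, h2⟩ | ⟨h1, h2⟩ := T.ends v hv
  · rw [h1, h2]
    exact T.up_ne hv
  · rw [h1, h2]
    exact (T.up_ne hv).symm

namespace Realization

variable {T : TreeAction G V E}

theorem hat_tgt (e : E) (s : Set.Ioo (0 : ℝ) 1) : hat (T.tgt e) (pt e s : Realization T) = s := by
  simp [hat, T.src_ne_tgt e]

/-- Countless edges may meet at a vertex, so points are separated by continuous functions: `bump`
detects the open edge, `hat` at the target of an edge recovers the parameter, and the functions
`hat` distinguish vertices. -/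
instance : T2Space (Realization T) := by
  classical
  let f : Realization T → (V → ℝ) × (E → ℝ) := fun x => (fun v => hat v x, fun e => bump e x)
  have hf : Continuous f :=
    (continuous_pi continuous_hat).prodMk (continuous_pi continuous_bump)
  have hpos : ∀ s : Set.Ioo (0 : ℝ) 1, (s : ℝ) * (1 - s) ≠ 0 := fun s =>
    (mul_pos s.2.1 (sub_pos.2 s.2.2)).ne'
  refine T2Space.of_injective_continuous (f := f) (fun x y h => ?_) hf
  have h1 : ∀ v, hat v x = hat v y := fun v => congrFun (congrArg Prod.fst h) v
  have h2 : ∀ e, bump e x = bump e y := fun e => congrFun (congrArg Prod.snd h) e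
  rcases x with v | ⟨e, s⟩ <;> rcases y with w | ⟨e', s'⟩
  · have := h1 w
    simp only [hat, if_true] at this
    by_contra hne
    rw [if_neg fun h => hne (by rw [h])] at this
    exact zero_ne_one this
  · have := h2 e'
    simp only [bump, if_true] at this
    exact absurd this.symm (hpos s')
  · have := h2 e
    simp only [bump, if_true] at this
    exact absurd this (hpos s)
  · have h3 := h2 e
    simp only [bump, if_true] at h3
    by_cases he : e' = e
    · subst he
      have := h1 (T.tgt e')
      rw [hat_tgt, hat_tgt] at this
      rw [Subtype.ext this]
    · rw [if_neg he] at h3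
      exact absurd h3 (hpos s)

/-- The cells of the realization. -/
def Cell (V E : Type u) : ℕ → Type u
  | 0 => V
  | 1 => E
  | _ + 2 => PEmpty

theorem mem_ball_fin_one {x : Fin 1 → ℝ} :
    x ∈ Metric.ball (0 : Fin 1 → ℝ) 1 ↔ (x 0 + 1) / 2 ∈ Set.Ioo (0 : ℝ) 1 := by
  rw [mem_ball_zero_iff, pi_norm_lt_iff one_pos, Fin.forall_fin_one, Real.norm_eq_abs, abs_lt,
    Set.mem_Ioo]
  constructor <;> rintro ⟨h1, h2⟩ <;> constructor <;> linarith

/-- The characteristic map of a vertex. -/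
noncomputable def vertMap (T : TreeAction G V E) (v : V) :
    PartialEquiv (Fin 0 → ℝ) (Realization T) where
  toFun _ := vert v
  invFun _ := 0
  source := Metric.ball 0 1
  target := {vert v}
  map_source' _ _ := rfl
  map_target' _ _ := Metric.mem_ball_self one_pos
  left_inv' _ _ := Subsingleton.elim _ _
  right_inv' _ h := h.symm

/-- The characteristic map of an edge. -/
noncomputable def edgeMap (T : TreeAction G V E) (e : E) :
    PartialEquiv (Fin 1 → ℝ) (Realization T) where
  toFun x := edge T e ((x 0 + 1) / 2)
  invFun x _ := 2 * hat (T.tgt e) x - 1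
  source := Metric.ball 0 1
  target := Set.range (pt e)
  map_source' x hx := ⟨⟨_, mem_ball_fin_one.1 hx⟩, (edge_of_mem _).symm⟩
  map_target' := by
    rintro _ ⟨s, rfl⟩
    rw [mem_ball_fin_one, hat_tgt]
    convert s.2 using 1
    ring
  left_inv' x hx := by
    funext i
    rw [edge_of_mem (mem_ball_fin_one.1 hx), hat_tgt, Subsingleton.elim i 0]
    ring
  right_inv' := by
    rintro _ ⟨s, rfl⟩
    have h : (2 * hat (T.tgt e) (pt e s : Realization T) - 1 + 1) / 2 = s := by
      rw [hat_tgt]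
      ring
    change edge T e ((2 * hat (T.tgt e) (pt e s : Realization T) - 1 + 1) / 2) = _
    rw [h, edge_of_mem s.2]

/-- The characteristic maps of the cells. -/
noncomputable def cellMap (T : TreeAction G V E) :
    ∀ n, Cell V E n → PartialEquiv (Fin n → ℝ) (Realization T)
  | 0, v => vertMap T v
  | 1, e => edgeMap T e

/-- The open cell that contains a point. -/
def cellOf : Realization T → Σ n, Cell V E n
  | vert v => ⟨0, v⟩
  | pt e _ => ⟨1, e⟩

theorem cellOf_eq : ∀ (n : ℕ) (c : Cell V E n) (x : Realization T), x ∈ (cellMap T n c).target →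
    cellOf x = ⟨n, c⟩
  | 0, _, _, rfl => rfl
  | 1, _, _, ⟨_, rfl⟩ => rfl

theorem source_cellMap : ∀ n (e : Cell V E n), (cellMap T n e).source = Metric.ball 0 1
  | 0, _ => rfl
  | 1, _ => rfl

theorem image_ball (n : ℕ) (e : Cell V E n) :
    cellMap T n e '' Metric.ball 0 1 = (cellMap T n e).target := by
  rw [← source_cellMap (T := T) n e, PartialEquiv.image_source_eq_target]

theorem image_closedBall_zero (v : V) :
    vertMap T v '' Metric.closedBall 0 1 = {(vert v : Realization T)} := by
  refine Set.eq_singleton_iff_unique_mem.2 ⟨⟨0, Metric.mem_closedBall_self zero_le_one, rfl⟩, ?_⟩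
  rintro _ ⟨x, -, rfl⟩
  rfl

theorem image_closedBall_one (e : E) :
    edgeMap T e '' Metric.closedBall 0 1 = Set.range (edge T e) := by
  refine Set.Subset.antisymm ?_ ?_
  · rintro _ ⟨x, -, rfl⟩
    exact ⟨_, rfl⟩
  · rintro _ ⟨x, rfl⟩
    have h : edge T e x = edge T e (clamp x) := by
      rcases le_or_gt x 0 with hx | hx
      · rw [edge_of_nonpos hx, clamp_of_nonpos hx, edge_of_nonpos le_rfl]
      · rcases le_or_gt 1 x with hx' | hx'
        · rw [edge_of_one_le hx', clamp_of_one_le hx', edge_of_one_le le_rfl]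
        · rw [clamp_of_mem ⟨hx, hx'⟩]
    refine ⟨fun _ => 2 * clamp x - 1, ?_, ?_⟩
    · rw [mem_closedBall_zero_iff, pi_norm_le_iff_of_nonneg zero_le_one, Fin.forall_fin_one,
        Real.norm_eq_abs, abs_le]
      have h1 : 0 ≤ clamp x := le_max_left _ _
      have h2 : clamp x ≤ 1 := max_le zero_le_one (min_le_right _ _)
      constructor <;> linarith
    · change edge T e ((2 * clamp x - 1 + 1) / 2) = _
      rw [h]
      congr 1
      ring

/-- The cell structure. -/
noncomputable instance : Topology.CWComplex (Set.univ : Set (Realization T)) where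
  cell := Cell V E
  map := cellMap T
  source_eq := source_cellMap
  continuousOn
    | 0, v => continuousOn_const
    | 1, e => ((continuous_edge (T := T) (show E from e)).comp (by fun_prop)).continuousOn
  continuousOn_symm
    | 0, v => continuousOn_const
    | 1, e => by
      have := continuous_hat (T := T) (T.tgt (show E from e))
      exact (continuous_pi fun _ => by fun_prop :
        Continuous fun x (_ : Fin 1) => 2 * hat (T.tgt (show E from e)) x - 1).continuousOn
  pairwiseDisjoint' := by
    rintro ⟨m, c⟩ - ⟨n, d⟩ - hne
    change Disjoint (cellMap T m c '' Metric.ball 0 1) (cellMap T n d '' Metric.ball 0 1)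
    rw [image_ball, image_ball, Set.disjoint_left]
    intro x hx hx'
    exact hne ((cellOf_eq m c x hx).symm.trans (cellOf_eq n d x hx'))
  mapsTo'
    | 0, v => ⟨fun _ => ∅, fun x hx => by
        rw [Subsingleton.elim x 0, mem_sphere_zero_iff_norm, norm_zero] at hx
        exact absurd hx zero_ne_one⟩
    | 1, e => by
      classical
      refine ⟨fun m => match m with
        | 0 => ({T.src (show E from e), T.tgt (show E from e)} : Finset V)
        | _ + 1 => ∅, fun x hx => ?_⟩
      have h : x ∉ Metric.ball (0 : Fin 1 → ℝ) 1 := fun h => by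
        rw [mem_sphere_zero_iff_norm] at hx
        rw [mem_ball_zero_iff] at h
        exact h.ne hx
      rw [mem_ball_fin_one, Set.mem_Ioo, not_and_or, not_lt, not_lt] at h
      simp only [Set.mem_iUnion]
      rcases h with h | h
      · refine ⟨0, one_pos, T.src (show E from e), Finset.mem_insert_self _ _, ?_⟩
        refine (image_closedBall_zero _).symm.subset ?_
        exact edge_of_nonpos h
      · refine ⟨0, one_pos, T.tgt (show E from e),
          Finset.mem_insert_of_mem (Finset.mem_singleton_self _), ?_⟩
        refine (image_closedBall_zero _).symm.subset ?_
        exact edge_of_one_le h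
  closed' A _ h := by
    refine isClosed_iff.2 fun e => ?_
    have h1 : IsClosed (A ∩ edgeMap T e '' Metric.closedBall 0 1) := h 1 e
    rw [image_closedBall_one] at h1
    have h2 := h1.preimage (continuous_edge e)
    rwa [Set.preimage_inter, Set.preimage_range, Set.inter_univ] at h2
  union' := by
    refine Set.eq_univ_of_forall fun x => ?_
    simp only [Set.mem_iUnion]
    rcases x with v | ⟨e, s⟩
    · exact ⟨0, v, (image_closedBall_zero v).symm.subset rfl⟩
    · exact ⟨1, e, (image_closedBall_one e).symm.subset ⟨s, edge_of_mem s.2⟩⟩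

end Realization

end TreeAction

/-! ### The group action on the realization, and its contractibility -/

namespace TreeAction.Realization

variable {G V E : Type u} [Group G] [MulAction G V] [MulAction G E] {T : TreeAction G V E}

instance : MulAction G (Realization T) where
  smul g
    | vert v => vert (g • v)
    | pt e s => pt (g • e) s
  one_smul
    | vert v => congrArg vert (one_smul G v)
    | pt e s => congrArg (pt · s) (one_smul G e)
  mul_smul g h
    | vert v => congrArg vert (mul_smul g h v)
    | pt e s => congrArg (pt · s) (mul_smul g h e)

theorem smul_vert (g : G) (v : V) : g • (vert v : Realization T) = vert (g • v) := rfl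

theorem smul_pt (g : G) (e : E) (s : Set.Ioo (0 : ℝ) 1) :
    g • (pt e s : Realization T) = pt (g • e) s := rfl

theorem smul_edge (g : G) (e : E) (x : ℝ) : g • edge T e x = edge T (g • e) x := by
  rcases le_or_gt x 0 with hx | hx
  · rw [edge_of_nonpos hx, edge_of_nonpos hx, smul_vert, T.src_smul]
  · rcases le_or_gt 1 x with hx' | hx'
    · rw [edge_of_one_le hx', edge_of_one_le hx', smul_vert, T.tgt_smul]
    · rw [edge_of_mem ⟨hx, hx'⟩, edge_of_mem ⟨hx, hx'⟩, smul_pt]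

theorem continuous_smul (g : G) : Continuous fun x : Realization T => g • x := by
  refine continuous_iff.2 fun e => ?_
  have h : (fun x : Realization T => g • x) ∘ edge T e = edge T (g • e) :=
    funext fun x => smul_edge g e x
  rw [h]
  exact continuous_edge _

/-! ### The contraction to the root -/

open Classical in
/-- The parametrization of the edge from `v` to `up v`. -/
noncomputable def upPath (T : TreeAction G V E) (v : V) (hv : v ≠ T.root) (x : ℝ) : Realization T :=
  if T.tgt (T.upEdge v hv) = v then edge T (T.upEdge v hv) (1 - x) else edge T (T.upEdge v hv) x

theorem upPath_of_nonpos {v : V} {hv : v ≠ T.root} {x : ℝ} (hx : x ≤ 0) :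
    upPath T v hv x = vert v := by
  obtain ⟨h1, h2⟩ | ⟨h1, h2⟩ := T.ends v hv
  · rw [upPath, if_pos h2, edge_of_one_le (by linarith), h2]
  · rw [upPath, if_neg (h2.trans_ne (T.up_ne hv)), edge_of_nonpos hx, h1]

theorem upPath_of_one_le {v : V} {hv : v ≠ T.root} {x : ℝ} (hx : 1 ≤ x) :
    upPath T v hv x = vert (T.up v) := by
  obtain ⟨h1, h2⟩ | ⟨h1, h2⟩ := T.ends v hv
  · rw [upPath, if_pos h2, edge_of_nonpos (by linarith), h1]
  · rw [upPath, if_neg (h2.trans_ne (T.up_ne hv)), edge_of_one_le hx, h2]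

theorem continuous_upPath {v : V} {hv : v ≠ T.root} : Continuous (upPath T v hv) := by
  unfold upPath
  split_ifs
  · exact (continuous_edge _).comp (by fun_prop)
  · exact continuous_edge _

/-- The time at which the contraction moves the vertex `v`. -/
noncomputable def time (T : TreeAction G V E) (v : V) : ℝ := 1 / ((T.rank v : ℝ) + 1)

theorem time_pos (v : V) : 0 < time T v := by
  unfold time
  positivity

theorem time_le_one (v : V) : time T v ≤ 1 := by
  unfold time
  rw [div_le_one (by positivity)]
  simp

theorem time_lt_time_up {v : V} (hv : v ≠ T.root) : time T v < time T (T.up v) := by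
  have h : (T.rank (T.up v) : ℝ) < T.rank v := by exact_mod_cast T.rank_up v hv
  exact one_div_lt_one_div_of_lt (by positivity) (by linarith)

-- The path from `v` rests until `time T v` and then crosses each edge between the times of its
-- ends. Times increase towards the root and are at most `1`, so every path has arrived at time `1`;
-- and once the path of `v` reaches `up v`, it coincides with the path of `up v`.
open Classical in
theorem exists_geodesics (T : TreeAction G V E) : ∃ γ : V → ℝ → Realization T,
    (∀ v, Continuous (γ v)) ∧ (∀ v τ, τ ≤ time T v → γ v τ = vert v) ∧
    (∀ v (hv : v ≠ T.root) τ, τ ≤ time T (T.up v) →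
      γ v τ = upPath T v hv ((τ - time T v) / (time T (T.up v) - time T v))) ∧
    (∀ v, v ≠ T.root → ∀ τ, time T (T.up v) ≤ τ → γ v τ = γ (T.up v) τ) ∧
    (∀ v τ, 1 ≤ τ → γ v τ = vert T.root) := by
  obtain ⟨γ, h0, h⟩ := T.exists_rec (fun _ : ℝ => (vert T.root : Realization T)) fun v hv f τ =>
    if τ ≤ time T (T.up v) then upPath T v hv ((τ - time T v) / (time T (T.up v) - time T v))
    else f τ
  have h1 : ∀ v τ, τ ≤ time T v → γ v τ = vert v := by
    intro v τ hτ
    by_cases hv : v = T.root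
    · rw [hv, h0]
    · have hlt := time_lt_time_up hv
      rw [h v hv]
      dsimp only
      rw [if_pos (hτ.trans hlt.le), upPath_of_nonpos]
      exact div_nonpos_of_nonpos_of_nonneg (by linarith) (by linarith)
  have h2 : ∀ v (hv : v ≠ T.root) τ, τ ≤ time T (T.up v) →
      γ v τ = upPath T v hv ((τ - time T v) / (time T (T.up v) - time T v)) := by
    intro v hv τ hτ
    rw [h v hv]
    dsimp only
    rw [if_pos hτ]
  have hend : ∀ v (hv : v ≠ T.root), upPath T v hv
      ((time T (T.up v) - time T v) / (time T (T.up v) - time T v)) =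
        γ (T.up v) (time T (T.up v)) := by
    intro v hv
    have hlt := time_lt_time_up hv
    rw [div_self (by linarith), upPath_of_one_le le_rfl, h1 _ _ le_rfl]
  have h3 : ∀ v, v ≠ T.root → ∀ τ, time T (T.up v) ≤ τ → γ v τ = γ (T.up v) τ := by
    intro v hv τ hτ
    rcases hτ.eq_or_lt with rfl | hlt
    · rw [h2 v hv _ le_rfl, hend v hv]
    · rw [h v hv]
      dsimp only
      rw [if_neg hlt.not_ge]
  refine ⟨γ, fun v => ?_, h1, h2, h3, fun v => ?_⟩
  · induction v using T.induction with
    | root =>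
      rw [h0]
      exact continuous_const
    | step v hv ih =>
      rw [h v hv]
      refine Continuous.if_le (continuous_upPath.comp (by fun_prop)) ih continuous_id
        continuous_const ?_
      rintro _ rfl
      exact hend v hv
  · induction v using T.induction with
    | root => intro τ _; rw [h0]
    | step v hv ih => exact fun τ hτ => (h3 v hv τ ((time_le_one _).trans hτ)).trans (ih τ hτ)

/-- Everything flows to the root along the paths of `exists_geodesics`. A point inside an edge lies
on the path of the end `low e` farther from the root; it waits until that path passes it and then
follows, which explains the maximum in `Φ`. -/
instance : ContractibleSpace (Realization T) := by
  classical
  obtain ⟨γ, hγ, h1, h2, h3, h4⟩ := exists_geodesics T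
  let t : V → ℝ → ℝ := fun v x => time T v + clamp x * (time T (T.up v) - time T v)
  have ht : ∀ v, v ≠ T.root → ∀ x, t v x ≤ time T (T.up v) := fun v hv x => by
    have hx : clamp x ≤ 1 := max_le zero_le_one (min_le_right _ _)
    have := time_lt_time_up hv
    simp only [t]
    nlinarith
  have ht0 : ∀ v, v ≠ T.root → ∀ x, 0 ≤ t v x := fun v hv x => by
    have hx : 0 ≤ clamp x := le_max_left _ _
    have := time_lt_time_up hv
    have := time_pos (T := T) v
    simp only [t]
    nlinarith
  choose low hlow hlow' using T.exists_upEdge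
  let pos : ∀ e, ℝ → ℝ := fun e x => if T.tgt e = low e then 1 - x else x
  let Φ : Realization T → ℝ → Realization T
    | vert v => γ v
    | pt e s => fun τ => γ (low e) (max τ (t (low e) (pos e s)))
  have hΦ : ∀ e x τ, Φ (edge T e x) τ = γ (low e) (max τ (t (low e) (pos e x))) := by
    intro e x τ
    have hlt := time_lt_time_up (hlow e)
    have key0 : ∀ y ≤ 0, γ (low e) (max τ (t (low e) y)) = γ (low e) τ := by
      intro y hy
      have : t (low e) y = time T (low e) := by simp only [t, clamp_of_nonpos hy]; ring
      rw [this]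
      rcases le_total τ (time T (low e)) with h | h
      · rw [max_eq_right h, h1 _ _ le_rfl, h1 _ _ h]
      · rw [max_eq_left h]
    have key1 : ∀ y, 1 ≤ y → γ (low e) (max τ (t (low e) y)) = γ (T.up (low e)) τ := by
      intro y hy
      have : t (low e) y = time T (T.up (low e)) := by simp only [t, clamp_of_one_le hy]; ring
      rw [this, h3 _ (hlow e) _ (le_max_right _ _)]
      rcases le_total τ (time T (T.up (low e))) with h | h
      · rw [max_eq_right h, h1 _ _ le_rfl, h1 _ _ h]
      · rw [max_eq_left h]
    have hends := T.ends (low e) (hlow e)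
    rw [hlow'] at hends
    by_cases hx : x ∈ Set.Ioo (0 : ℝ) 1
    · rw [edge_of_mem hx]
    · rw [Set.mem_Ioo, not_and_or, not_lt, not_lt] at hx
      rcases hends with ⟨he1, he2⟩ | ⟨he1, he2⟩
      · simp only [pos, if_pos he2]
        rcases hx with hx | hx
        · rw [edge_of_nonpos hx, key1 _ (by linarith), he1]
        · rw [edge_of_one_le hx, key0 _ (by linarith), he2]
      · simp only [pos, if_neg (he2.trans_ne (T.up_ne (hlow e)))]
        rcases hx with hx | hx
        · rw [edge_of_nonpos hx, key0 _ hx, he1]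
        · rw [edge_of_one_le hx, key1 _ hx, he2]
  have hpos : ∀ e, Continuous (pos e) := fun e => by
    simp only [pos]
    split_ifs <;> fun_prop
  have hcont : ∀ x, Continuous (Φ x)
    | vert v => hγ v
    | pt e s => (hγ _).comp (by fun_prop)
  -- With values in a space of paths, the homotopy is a map on the realization alone, and continuity
  -- can be tested edge by edge; no topology on a product with the realization has to be compared.
  let Ψ : Realization T → C(unitInterval, Realization T) := fun x =>
    ⟨fun τ => Φ x τ, (hcont x).comp continuous_subtype_val⟩
  have hΨ : Continuous Ψ := by
    refine continuous_iff.2 fun e => ?_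
    have hc := hpos e
    have hcl := continuous_clamp
    let F : C(ℝ × unitInterval, Realization T) :=
      ⟨fun p => γ (low e) (max (p.2 : ℝ) (t (low e) (pos e p.1))), (hγ _).comp (by
        simp only [t]
        fun_prop)⟩
    have : Ψ ∘ edge T e = F.curry := by
      funext x
      ext τ
      exact hΦ e x τ
    rw [this]
    exact F.curry.continuous
  rw [contractible_iff_id_nullhomotopic]
  refine ⟨vert T.root, ⟨{
    toFun := fun p => Ψ p.2 p.1
    continuous_toFun := (ContinuousMap.continuous_uncurry_of_continuous ⟨Ψ, hΨ⟩).comp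
      continuous_swap
    map_zero_left := fun x => ?_
    map_one_left := fun x => ?_ }⟩⟩
  · change Φ x 0 = x
    rcases x with v | ⟨e, s⟩
    · exact h1 v 0 (time_pos v).le
    · have hlt := time_lt_time_up (hlow e)
      have hp : pos e s ∈ Set.Ioo (0 : ℝ) 1 := by
        simp only [pos]
        split_ifs
        · exact ⟨sub_pos.2 s.2.2, sub_lt_self _ s.2.1⟩
        · exact s.2
      change γ (low e) (max 0 (t (low e) (pos e s))) = _
      rw [max_eq_right (ht0 _ (hlow e) _), h2 _ (hlow e) _ (ht _ (hlow e) _)]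
      simp only [t, add_sub_cancel_left]
      rw [mul_div_cancel_right₀ _ (sub_pos.2 hlt).ne', clamp_of_mem hp, upPath]
      simp only [hlow', pos]
      split_ifs
      · rw [sub_sub_cancel, edge_of_mem s.2]
      · rw [edge_of_mem s.2]
  · change Φ x 1 = vert T.root
    rcases x with v | ⟨e, s⟩
    · exact h4 v 1 le_rfl
    · exact h4 _ _ (le_max_left _ _)

end TreeAction.Realization

open TreeAction.Realization in
/-- If `G` acts on a tree, and the stabilizers of vertices and edges belong to a class, then `G`
belongs to `H₁` of this class. -/
theorem TreeAction.krophollerStep {G V E : Type u} [Group G] [MulAction G V] [MulAction G E]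
    (T : TreeAction G V E) {𝔛 : GroupClass.{u}} (hV : ∀ v : V, 𝔛 (MulAction.stabilizer G v))
    (hE : ∀ e : E, 𝔛 (MulAction.stabilizer G e)) : KrophollerStep 𝔛 G := by
  have hvert : ∀ (g : G) (v : V), g • ({vert v} : Set (Realization T)) = {vert (g • v)} :=
    fun g v => Set.smul_set_singleton
  have hpt : ∀ (g : G) (e : E), g • Set.range (pt (T := T) e) = Set.range (pt (g • e)) := by
    intro g e
    ext x
    constructor
    · rintro ⟨_, ⟨s, rfl⟩, rfl⟩
      exact ⟨s, rfl⟩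
    · rintro ⟨s, rfl⟩
      exact ⟨_, ⟨s, rfl⟩, rfl⟩
  have hopen : ∀ (n : ℕ) (e : Cell V E n),
      Topology.CWComplex.openCell (C := (Set.univ : Set (Realization T))) n e =
        (cellMap T n e).target := fun n e => image_ball n e
  have hvstab : ∀ v : V, MulAction.stabilizer G ({vert v} : Set (Realization T)) =
      fixingSubgroup G ({vert v} : Set (Realization T)) ∧
        𝔛 (MulAction.stabilizer G ({vert v} : Set (Realization T))) := by
    intro v
    have h : MulAction.stabilizer G ({vert v} : Set (Realization T)) =
        MulAction.stabilizer G v := by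
      ext g
      rw [MulAction.mem_stabilizer_iff, MulAction.mem_stabilizer_iff, hvert,
        Set.singleton_eq_singleton_iff]
      exact ⟨fun h => by injection h, fun h => congrArg vert h⟩
    rw [h]
    refine ⟨?_, hV v⟩
    ext g
    rw [mem_fixingSubgroup_iff, MulAction.mem_stabilizer_iff]
    constructor
    · rintro h _ rfl
      exact congrArg vert h
    · intro h
      injection h _ rfl
  have hestab : ∀ e : E, MulAction.stabilizer G (Set.range (pt (T := T) e)) =
      fixingSubgroup G (Set.range (pt (T := T) e)) ∧
        𝔛 (MulAction.stabilizer G (Set.range (pt (T := T) e))) := by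
    intro e
    have h : MulAction.stabilizer G (Set.range (pt (T := T) e)) = MulAction.stabilizer G e := by
      ext g
      rw [MulAction.mem_stabilizer_iff, MulAction.mem_stabilizer_iff, hpt]
      constructor
      · intro h
        obtain ⟨s, hs⟩ := h.subset ⟨⟨1 / 2, by norm_num, by norm_num⟩, rfl⟩
        injection hs with hs
        exact hs.symm
      · intro h
        exact congrArg (fun e' : E => Set.range (pt (T := T) e')) h
    rw [h]
    refine ⟨?_, hE e⟩
    ext g
    rw [mem_fixingSubgroup_iff, MulAction.mem_stabilizer_iff]
    constructor
    · rintro h _ ⟨s, rfl⟩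
      exact congrArg (pt · s) h
    · intro h
      have := h _ ⟨⟨1 / 2, by norm_num, by norm_num⟩, rfl⟩
      injection this
  refine ⟨Realization T, inferInstance, inferInstance, inferInstance, inferInstance, inferInstance,
    ⟨?_⟩, continuous_smul, ?_, ?_⟩
  · refine Filter.eventually_atTop.2 ⟨2, fun n hn => ?_⟩
    obtain ⟨m, rfl⟩ := Nat.exists_eq_add_of_le' hn
    exact inferInstanceAs (IsEmpty PEmpty)
  · intro g n e
    match n, e with
    | 0, v => exact ⟨g • (show V from v), (congrArg (g • ·) (hopen 0 v)).trans
        ((hvert g v).trans (hopen 0 (g • (show V from v))).symm)⟩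
    | 1, e => exact ⟨g • (show E from e), (congrArg (g • ·) (hopen 1 e)).trans
        ((hpt g e).trans (hopen 1 (g • (show E from e))).symm)⟩
  · intro n e
    rw [hopen]
    match n, e with
    | 0, v => exact hvstab v
    | 1, e => exact hestab e

/-! ### Examples of trees -/

namespace TreeAction

/-- The trivial action. -/
abbrev trivialAction (G X : Type*) [Group G] : MulAction G X where
  smul _ x := x
  one_smul _ := rfl
  mul_smul _ _ _ := rfl

/-- The tree with one vertex. -/
def point (G : Type u) [Group G] :
    letI := trivialAction G PUnit.{u + 1}
    letI := trivialAction G PEmpty.{u + 1}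
    TreeAction G PUnit.{u + 1} PEmpty.{u + 1} :=
  letI := trivialAction G PUnit.{u + 1}
  letI := trivialAction G PEmpty.{u + 1}
  { src := fun e => e.elim
    tgt := fun e => e.elim
    src_smul := fun _ e => e.elim
    tgt_smul := fun _ e => e.elim
    root := PUnit.unit
    rank := fun _ => 0
    up := id
    upEdge := fun _ h => (h rfl).elim
    rank_up := fun _ h => (h rfl).elim
    ends := fun _ h => (h rfl).elim
    exists_upEdge := fun e => e.elim }

/-- The action on the line given by a homomorphism to the integers. -/
abbrev lineAction {G : Type u} [Group G] (f : G →* Multiplicative ℤ) :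
    MulAction G (ULift.{u} ℤ) where
  smul g n := ⟨(f g).toAdd + n.down⟩
  one_smul n := ULift.ext _ _ (by
    change (f 1).toAdd + n.down = n.down
    simp)
  mul_smul g h n := ULift.ext _ _ (by
    change (f (g * h)).toAdd + n.down = (f g).toAdd + ((f h).toAdd + n.down)
    simp [add_assoc])

/-- The line. -/
def line {G : Type u} [Group G] (f : G →* Multiplicative ℤ) :
    letI := lineAction f
    TreeAction G (ULift.{u} ℤ) (ULift.{u} ℤ) :=
  letI := lineAction f
  { src := id
    tgt := fun n => ⟨n.down + 1⟩
    src_smul := fun _ _ => rfl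
    tgt_smul := fun g n => ULift.ext _ _ (add_assoc (f g).toAdd n.down 1)
    root := ⟨0⟩
    rank := fun n => n.down.natAbs
    up := fun n => if 0 < n.down then ⟨n.down - 1⟩ else ⟨n.down + 1⟩
    upEdge := fun n _ => if 0 < n.down then ⟨n.down - 1⟩ else n
    rank_up := fun n hn => by
      have h : n.down ≠ 0 := fun h => hn (ULift.ext _ _ h)
      split_ifs
      · change (n.down - 1).natAbs < n.down.natAbs
        omega
      · change (n.down + 1).natAbs < n.down.natAbs
        omega
    ends := fun n hn => by
      split_ifs
      · exact Or.inl ⟨rfl, ULift.ext _ _ (sub_add_cancel _ _)⟩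
      · exact Or.inr ⟨rfl, rfl⟩
    exists_upEdge := fun n => by
      rcases le_or_gt 0 n.down with h | h
      · refine ⟨⟨n.down + 1⟩, fun h' => ?_, ?_⟩
        · have : n.down + 1 = 0 := congrArg ULift.down h'
          omega
        · rw [if_pos (show 0 < n.down + 1 by omega)]
          exact ULift.ext _ _ (add_sub_cancel_right _ _)
      · refine ⟨n, fun h' => ?_, ?_⟩
        · have : n.down = 0 := congrArg ULift.down h'
          omega
        · rw [if_neg h.not_gt] }

theorem stabilizer_lineAction_le {G : Type u} [Group G] (f : G →* Multiplicative ℤ)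
    (n : ULift.{u} ℤ) :
    letI := lineAction f
    MulAction.stabilizer G n ≤ f.ker := by
  let := lineAction f
  intro g hg
  have h : (f g).toAdd + n.down = n.down := congrArg ULift.down (MulAction.mem_stabilizer_iff.1 hg)
  exact MonoidHom.mem_ker.2 (Multiplicative.toAdd.injective (add_eq_right.1 h))

/-! ### The tree of an ascending union -/

section Ascending

variable {G : Type u} [Group G] {K : ℕ → Subgroup G}

/-- The map of cosets. -/
def cosetMap (hK : Monotone K) (n : ℕ) : G ⧸ K n → G ⧸ K (n + 1) :=
  Subgroup.quotientMapOfLE (hK n.le_succ)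

theorem exists_stage (hK : Monotone K) (hK' : ∀ g, ∃ n, g ∈ K n) (n : ℕ) (g : G) :
    ∃ m, n ≤ m ∧ g ∈ K m := by
  obtain ⟨m, hm⟩ := hK' g
  exact ⟨max n m, le_max_left _ _, hK (le_max_right n m) hm⟩

open Classical in
/-- The first stage that contains the coset. -/
noncomputable def stage (hK : Monotone K) (hK' : ∀ g, ∃ n, g ∈ K n) (x : Σ n, G ⧸ K n) : ℕ :=
  Nat.find (exists_stage hK hK' x.1 x.2.out)

/-- This frees `stage` from the chosen representative: two representatives of a coset differ by an
element of `K n ≤ K m`. -/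
theorem stage_le_iff (hK : Monotone K) (hK' : ∀ g, ∃ n, g ∈ K n) (n : ℕ) (g : G) (m : ℕ) :
    stage hK hK' ⟨n, (g : G ⧸ K n)⟩ ≤ m ↔ n ≤ m ∧ g ∈ K m := by
  classical
  have hout : ∀ m, n ≤ m → ((g : G ⧸ K n).out ∈ K m ↔ g ∈ K m) := by
    intro m hm
    have h := hK hm (QuotientGroup.eq.1 (Quotient.out_eq (g : G ⧸ K n)))
    constructor
    · intro h'
      simpa using mul_mem h' h
    · intro h'
      simpa using mul_mem h' (inv_mem h)
  rw [stage, Nat.find_le_iff]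
  constructor
  · rintro ⟨k, hk, h1, h2⟩
    exact ⟨h1.trans hk, hK hk ((hout k h1).1 h2)⟩
  · rintro ⟨h1, h2⟩
    exact ⟨m, le_rfl, h1, (hout m h1).2 h2⟩

/-- The base point of the previous stage. -/
def previous (K : ℕ → Subgroup G) : ℕ → Σ n, G ⧸ K n
  | 0 => ⟨0, ((1 : G) : G ⧸ K 0)⟩
  | n + 1 => ⟨n, ((1 : G) : G ⧸ K n)⟩

/-- The image of a coset in the next stage. -/
def nextCoset (hK : Monotone K) (x : Σ n, G ⧸ K n) : Σ n, G ⧸ K n :=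
  ⟨x.1 + 1, cosetMap hK x.1 x.2⟩

open Classical in
/-- The tree of an ascending union of subgroups. -/
noncomputable def ascending (hK : Monotone K) (hK' : ∀ g, ∃ n, g ∈ K n) :
    TreeAction G (Σ n, G ⧸ K n) (Σ n, G ⧸ K n) where
  src := id
  tgt := nextCoset hK
  src_smul _ _ := rfl
  tgt_smul g x := by
    obtain ⟨n, x⟩ := x
    induction x using QuotientGroup.induction_on with
    | H h => rfl
  root := ⟨0, ((1 : G) : G ⧸ K 0)⟩
  -- This is the distance from the root: `stage - n` steps up until the coset becomes trivial, and
  -- then `stage` steps down through the trivial cosets.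
  rank x := 2 * stage hK hK' x - x.1
  up x := if x.2 = ((1 : G) : G ⧸ K x.1) then previous K x.1
    else nextCoset hK x
  upEdge x _ := if x.2 = ((1 : G) : G ⧸ K x.1) then previous K x.1 else x
  rank_up := by
    rintro ⟨n, x⟩ hx
    induction x using QuotientGroup.induction_on with
    | H g =>
      have hn := (stage_le_iff hK hK' n g (stage hK hK' ⟨n, (g : G ⧸ K n)⟩)).1 le_rfl
      split_ifs with h
      · dsimp only at h
        cases n with
        | zero => exact absurd (by rw [h]) hx
        | succ n =>
          have h1 := (stage_le_iff hK hK' n 1 n).2 ⟨le_rfl, one_mem _⟩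
          change 2 * stage hK hK' ⟨n, ((1 : G) : G ⧸ K n)⟩ - n < 2 * _ - (n + 1)
          have := hn.1
          omega
      · have h1 : g ∉ K n := fun hg => h ((QuotientGroup.eq (s := K n)).2 (by simpa using hg))
        have h2 : stage hK hK' ⟨n, (g : G ⧸ K n)⟩ ≠ n := fun h2 => h1 (h2 ▸ hn.2)
        have h3 := (stage_le_iff hK hK' (n + 1) g (stage hK hK' ⟨n, (g : G ⧸ K n)⟩)).2
          ⟨by have := hn.1; omega, hn.2⟩
        change 2 * stage hK hK' ⟨n + 1, (g : G ⧸ K (n + 1))⟩ - (n + 1) < 2 * _ - n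
        have := hn.1
        omega
  ends := by
    rintro ⟨n, x⟩ hx
    by_cases h : x = ((1 : G) : G ⧸ K n)
    · subst h
      rw [if_pos rfl, if_pos rfl]
      cases n with
      | zero => exact absurd rfl hx
      | succ n => exact Or.inl ⟨rfl, rfl⟩
    · rw [if_neg h, if_neg h]
      exact Or.inr ⟨rfl, rfl⟩
  exists_upEdge := by
    rintro ⟨n, x⟩
    by_cases h : x = ((1 : G) : G ⧸ K n)
    · subst h
      refine ⟨⟨n + 1, ((1 : G) : G ⧸ K (n + 1))⟩, fun h => ?_, if_pos rfl⟩
      have := congrArg Sigma.fst h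
      exact absurd this n.succ_ne_zero
    · refine ⟨⟨n, x⟩, ?_, if_neg h⟩
      rintro ⟨⟩
      exact h rfl

end Ascending

end TreeAction

/-! ### The classes `HF` and `LHF` -/

section Kropholler

theorem krophollerStage_zero (𝔛 : GroupClass.{u}) : KrophollerStage 𝔛 0 = 𝔛 :=
  Ordinal.limitRecOn_zero ..

theorem krophollerStage_add_one (𝔛 : GroupClass.{u}) (α : Ordinal.{u}) :
    KrophollerStage 𝔛 (α + 1) = KrophollerStep (KrophollerStage 𝔛 α) :=
  Ordinal.limitRecOn_add_one ..

theorem krophollerStage_limit (𝔛 : GroupClass.{u}) {α : Ordinal.{u}} (hα : Order.IsSuccLimit α)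
    (G : Type u) [Group G] :
    KrophollerStage 𝔛 α G ↔ ∃ γ < α, KrophollerStage 𝔛 γ G := by
  have h : KrophollerStage 𝔛 α = fun (G : Type u) [Group G] => ∃ (γ : Ordinal.{u}) (_ : γ < α),
      KrophollerStage 𝔛 γ G := Ordinal.limitRecOn_limit (h := hα) ..
  rw [h]
  exact ⟨fun ⟨γ, hγ, h⟩ => ⟨γ, hγ, h⟩, fun ⟨γ, hγ, h⟩ => ⟨γ, hγ, h⟩⟩

/-- Pulling back an action along a homomorphism. -/
theorem KrophollerStep.pullback {𝔛 𝔜 : GroupClass.{u}} {K G : Type u} [Group K] [Group G]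
    (f : K →* G) (h : ∀ S : Subgroup G, 𝔛 S → 𝔜 (S.comap f)) (hG : KrophollerStep 𝔛 G) :
    KrophollerStep 𝔜 K := by
  obtain ⟨X, i1, i2, i3, i4, h1, h2, h3, h4, h5⟩ := hG
  let i5 : MulAction K X := MulAction.compHom X f
  have hstab : ∀ A : Set X,
      MulAction.stabilizer K A = (MulAction.stabilizer G A).comap f := fun A => rfl
  have hfix : ∀ A : Set X, fixingSubgroup K A = (fixingSubgroup G A).comap f := fun A => by
    ext k
    rw [Subgroup.mem_comap, mem_fixingSubgroup_iff, mem_fixingSubgroup_iff]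
    rfl
  refine ⟨X, i1, i2, i3, i5, h1, h2, fun k => h3 (f k), fun k n e => h4 (f k) n e, fun n e => ?_⟩
  rw [hstab, hfix, (h5 n e).1]
  exact ⟨rfl, (h5 n e).1 ▸ h _ (h5 n e).2⟩

theorem krophollerStage_of_injective (α : Ordinal.{u}) {K G : Type u} [Group K] [Group G]
    {f : K →* G} (hf : Function.Injective f) (hG : KrophollerStage finiteGroups α G) :
    KrophollerStage finiteGroups α K := by
  induction α using Ordinal.limitRecOn generalizing K G with
  | zero =>
    rw [krophollerStage_zero] at hG ⊢
    have : Finite G := hG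
    exact Finite.of_injective f hf
  | add_one α ih =>
    rw [krophollerStage_add_one] at hG ⊢
    refine hG.pullback f fun S hS => ih (f := f.subgroupComap S) ?_ hS
    exact fun x y h => Subtype.ext (hf (congrArg Subtype.val h))
  | limit α hα ih =>
    rw [krophollerStage_limit _ hα] at hG ⊢
    obtain ⟨γ, hγ, h⟩ := hG
    exact ⟨γ, hγ, ih γ hγ hf h⟩

theorem krophollerStage_le_add_one (α : Ordinal.{u}) {G : Type u} [Group G]
    (hG : KrophollerStage finiteGroups α G) : KrophollerStage finiteGroups (α + 1) G := by
  rw [krophollerStage_add_one]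
  let := TreeAction.trivialAction G PUnit.{u + 1}
  let := TreeAction.trivialAction G PEmpty.{u + 1}
  exact (TreeAction.point G).krophollerStep
    (fun v => krophollerStage_of_injective α (Subgroup.subtype_injective _) hG) fun e => e.elim

theorem krophollerStage_mono {α β : Ordinal.{u}} (hαβ : α ≤ β) {G : Type u} [Group G]
    (hG : KrophollerStage finiteGroups α G) : KrophollerStage finiteGroups β G := by
  induction β using Ordinal.limitRecOn with
  | zero => rwa [← le_antisymm hαβ zero_le]
  | add_one β ih =>
    rcases hαβ.eq_or_lt with rfl | h
    · exact hG
    · exact krophollerStage_le_add_one β (ih (Order.lt_add_one_iff.1 h))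
  | limit β hβ ih =>
    rcases hαβ.eq_or_lt with rfl | h
    · exact hG
    · exact (krophollerStage_limit _ hβ G).2 ⟨α, h, hG⟩

/-- The class `HF`. -/
abbrev HF : GroupClass.{u} := KrophollerClass finiteGroups

theorem HF.of_injective {K G : Type u} [Group K] [Group G] {f : K →* G}
    (hf : Function.Injective f) (hG : HF G) : HF K :=
  hG.imp fun α => krophollerStage_of_injective α hf

theorem HF.of_finite (G : Type u) [Group G] [h : Finite G] : HF G :=
  ⟨0, by rw [krophollerStage_zero]; exact h⟩

/-- The cells are indexed by a type in the universe of `G`, so the stages of their stabilizers have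
a common upper bound, and the classes increase with the stage. -/
theorem HF.of_step {G : Type u} [Group G] (hG : KrophollerStep HF G) : HF G := by
  obtain ⟨X, i1, i2, i3, i4, h1, h2, h3, h4, h5⟩ := hG
  choose α hα using fun n e => (h5 n e).2
  refine ⟨(⨆ c : Σ n, Topology.CWComplex.cell (Set.univ : Set X) n, α c.1 c.2) + 1, ?_⟩
  rw [krophollerStage_add_one]
  exact ⟨X, i1, i2, i3, i4, h1, h2, h3, h4, fun n e => ⟨(h5 n e).1, krophollerStage_mono
    (Ordinal.le_iSup (fun c : Σ n, Topology.CWComplex.cell (Set.univ : Set X) n => α c.1 c.2) ⟨n, e⟩)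
    (hα n e)⟩⟩

theorem HF.of_tree {G V E : Type u} [Group G] [MulAction G V] [MulAction G E]
    (T : TreeAction G V E) (hV : ∀ v : V, HF (MulAction.stabilizer G v))
    (hE : ∀ e : E, HF (MulAction.stabilizer G e)) : HF G :=
  HF.of_step (T.krophollerStep hV hE)

/-- A group with a homomorphism to a group in `HF` is in `HF` if the preimages of the finite
subgroups are. -/
theorem HF.of_hom {G Q : Type u} [Group G] [Group Q] (f : G →* Q) (hQ : HF Q)
    (h : ∀ F : Subgroup Q, Finite F → HF (F.comap f)) : HF G := by
  obtain ⟨α, hα⟩ := hQ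
  induction α using Ordinal.limitRecOn generalizing G Q with
  | zero =>
    rw [krophollerStage_zero] at hα
    have : Finite Q := hα
    refine HF.of_injective (f := (MonoidHom.id G).codRestrict ((⊤ : Subgroup Q).comap f)
      fun x => Subgroup.mem_top _) ?_ (h ⊤ inferInstance)
    exact fun x y hxy => congrArg Subtype.val hxy
  | add_one α ih =>
    rw [krophollerStage_add_one] at hα
    -- `G` acts through `f` on the complex of `Q`, with the preimages of the cell stabilizers `S` as
    -- stabilizers; a finite subgroup of `S` is a finite subgroup of `Q`, so the hypothesis is
    -- inherited.
    refine HF.of_step (hα.pullback f fun S hS => ih (f.subgroupComap S) (fun F hF => ?_) hS)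
    have : Finite (F.map S.subtype) := inferInstanceAs (Finite (S.subtype '' F))
    refine HF.of_injective (f := ((S.comap f).subtype.comp (Subgroup.subtype _)).codRestrict
      ((F.map S.subtype).comap f) fun x => ⟨f.subgroupComap S x, x.2, rfl⟩) ?_
        (h (F.map S.subtype) this)
    exact fun x y hxy => Subtype.ext (Subtype.ext
      (congrArg (fun z : (F.map S.subtype).comap f => (z : G)) hxy))
  | limit α hα' ih =>
    rw [krophollerStage_limit _ hα'] at hα
    obtain ⟨γ, hγ, hγ'⟩ := hα
    exact ih γ hγ f h hγ'

/-- A group is in `HF` if it has finitely many homomorphisms to groups in `HF` whose kernels have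
a finite intersection. -/
theorem HF.of_finset {ι : Type*} {Q : Type u} [Group Q] (s : Finset ι) {L : Type u} [Group L]
    (f : ι → L →* Q) (hf : ∀ i ∈ s, HF (f i).range)
    (hfin : Finite (⨅ i ∈ s, (f i).ker : Subgroup L)) : HF L := by
  classical
  induction s using Finset.induction_on generalizing L with
  | empty =>
    have h : (⨅ i ∈ (∅ : Finset ι), (f i).ker : Subgroup L) = ⊤ := by simp
    rw [h] at hfin
    have : Finite L := Finite.of_injective (fun x : L => (⟨x, Subgroup.mem_top x⟩ : (⊤ : Subgroup L)))
      fun x y hxy => congrArg Subtype.val hxy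
    exact HF.of_finite L
  | insert i s hi ih =>
    refine HF.of_hom (f i).rangeRestrict (hf i (Finset.mem_insert_self i s)) fun F hF => ?_
    set L' := F.comap (f i).rangeRestrict
    refine ih (fun j => (f j).comp L'.subtype) (fun j hj => ?_) ?_
    · refine HF.of_injective (f := Subgroup.inclusion ?_)
        (Subgroup.inclusion_injective _) (hf j (Finset.mem_insert_of_mem hj))
      rintro _ ⟨x, rfl⟩
      exact ⟨x, rfl⟩
    · set K : Subgroup L' := ⨅ j ∈ s, ((f j).comp L'.subtype).ker
      -- The common kernel `K` of the remaining maps on `L'` is finite: its image under `f i` lies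
      -- in the finite group `F`, and the kernel of `f i` on `K` lies in the finite intersection of
      -- all kernels.
      let g : K →* F := ((f i).rangeRestrict.subgroupComap F).comp K.subtype
      rw [g.finite_iff_finite_ker_range]
      refine ⟨?_, inferInstance⟩
      have hmem : ∀ x : g.ker, ((((x : K) : L') : L)) ∈ (⨅ j ∈ insert i s, (f j).ker : Subgroup L) := by
        intro x
        rw [Finset.iInf_insert, Subgroup.mem_inf]
        constructor
        · have h1 := MonoidHom.mem_ker.1 x.2
          exact congrArg (fun y : F => ((y : (f i).range) : Q)) h1
        · have h1 := (x : K).2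
          simp only [K, Subgroup.mem_iInf] at h1 ⊢
          exact fun j hj => h1 j hj
      exact Finite.of_injective (fun x : g.ker =>
        (⟨_, hmem x⟩ : (⨅ j ∈ insert i s, (f j).ker : Subgroup L))) fun x y hxy =>
          Subtype.ext (Subtype.ext (Subtype.ext
            (congrArg (fun z : (⨅ j ∈ insert i s, (f j).ker : Subgroup L) => (z : L)) hxy)))

/-- The stabilizer of a coset embeds into the subgroup. -/
theorem exists_injective_stabilizer {G : Type u} [Group G] (K : Subgroup G) (x : G ⧸ K) :
    ∃ f : MulAction.stabilizer G x →* K, Function.Injective f := by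
  induction x using QuotientGroup.induction_on with
  | H g =>
    refine ⟨(((MulAut.conj g⁻¹).toMonoidHom.comp (Subgroup.subtype _)).codRestrict K fun x => ?_),
      fun x y h => ?_⟩
    · have h := QuotientGroup.eq.1 (MulAction.mem_stabilizer_iff.1 x.2)
      have h' := inv_mem h
      simpa [mul_assoc] using h'
    · have h' := congrArg Subtype.val h
      exact Subtype.ext ((MulAut.conj g⁻¹).injective h')

theorem exists_injective_stabilizer_sigma {G : Type u} {ι : Type*} [Group G] (K : ι → Subgroup G)
    (x : Σ i, G ⧸ K i) : ∃ f : MulAction.stabilizer G x →* K x.1, Function.Injective f := by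
  obtain ⟨i, x⟩ := x
  obtain ⟨f, hf⟩ := exists_injective_stabilizer (K i) x
  have h : MulAction.stabilizer G (⟨i, x⟩ : Σ i, G ⧸ K i) ≤ MulAction.stabilizer G x := by
    intro g hg
    have := MulAction.mem_stabilizer_iff.1 hg
    injection this
  exact ⟨f.comp (Subgroup.inclusion h), hf.comp (Subgroup.inclusion_injective h)⟩

end Kropholler

/-! ### Closure properties of `HF` and `LHF` -/

/-- The restriction of an action on a tree to a subgroup. -/
def TreeAction.restrict {G V E : Type*} [Group G] [MulAction G V] [MulAction G E]
    (T : TreeAction G V E) (K : Subgroup G) : TreeAction K V E where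
  src := T.src
  tgt := T.tgt
  src_smul g e := T.src_smul (g : G) e
  tgt_smul g e := T.tgt_smul (g : G) e
  root := T.root
  rank := T.rank
  up := T.up
  upEdge := T.upEdge
  rank_up := T.rank_up
  ends := T.ends
  exists_upEdge := T.exists_upEdge

theorem HF.of_ascending {G : Type u} [Group G] {K : ℕ → Subgroup G} (hK : Monotone K)
    (hK' : ∀ g, ∃ n, g ∈ K n) (h : ∀ n, HF (K n)) : HF G := by
  have hs : ∀ x : Σ n, G ⧸ K n, HF (MulAction.stabilizer G x) := fun x => by
    obtain ⟨f, hf⟩ := exists_injective_stabilizer_sigma K x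
    exact HF.of_injective hf (h x.1)
  exact HF.of_tree (TreeAction.ascending hK hK') hs hs

/-- A finitely generated subgroup of an ascending union is contained in a term of the union. -/
theorem exists_le_of_fg {G : Type u} [Group G] {K : ℕ → Subgroup G} (hK : Monotone K)
    (hK' : ∀ g, ∃ n, g ∈ K n) {S : Subgroup G} (hS : S.FG) : ∃ n, S ≤ K n := by
  obtain ⟨s, rfl⟩ := hS
  choose n hn using hK'
  exact ⟨s.sup n, (Subgroup.closure_le _).2 fun g hg => hK (Finset.le_sup hg) (hn g)⟩

theorem fg_map {K G : Type u} [Group K] [Group G] (f : K →* G) {S : Subgroup K} (hS : S.FG) :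
    (S.map f).FG := by
  have := (Group.fg_iff_subgroup_fg S).2 hS
  exact (Group.fg_iff_subgroup_fg _).1 (Group.fg_of_surjective (f.subgroupMap_surjective S))

theorem LHF.of_injective {K G : Type u} [Group K] [Group G] {f : K →* G}
    (hf : Function.Injective f) (hG : LHF G) : LHF K := fun S hS =>
  HF.of_injective (f := f.subgroupMap S)
    (fun _ _ h => Subtype.ext (hf (congrArg Subtype.val h))) (hG (S.map f) (fg_map f hS))

theorem LHF.of_ascending {G : Type u} [Group G] {K : ℕ → Subgroup G} (hK : Monotone K)
    (hK' : ∀ g, ∃ n, g ∈ K n) (h : ∀ n, LHF (K n)) : LHF G := fun S hS => by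
  obtain ⟨n, hn⟩ := exists_le_of_fg hK hK' hS
  have hfg : (S.subgroupOf (K n)).FG := by
    have := (Group.fg_iff_subgroup_fg S).2 hS
    exact (Group.fg_iff_subgroup_fg _).1
      (Group.fg_of_surjective (f := (Subgroup.subgroupOfEquivOfLe hn).symm.toMonoidHom)
        (Subgroup.subgroupOfEquivOfLe hn).symm.surjective)
  exact HF.of_injective (f := (Subgroup.inclusion hn).codRestrict (S.subgroupOf (K n))
    fun x => x.2) (fun _ _ h => Subtype.ext
      (congrArg (fun y : S.subgroupOf (K n) => ((y : K n) : G)) h)) (h n _ hfg)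

theorem countable_of_fg {G : Type u} [Group G] {S : Subgroup G} (hS : S.FG) : Countable S := by
  have := (Group.fg_iff_subgroup_fg S).2 hS
  obtain ⟨n, _, φ, hφ⟩ := Group.fg_iff_exists_freeGroup_hom_surjective_finite.1 this
  exact hφ.countable

/-- Countable groups in `LHF` are in `HF`. -/
theorem LHF.hf_of_countable {G : Type u} [Group G] [Countable G] (hG : LHF G) : HF G := by
  obtain ⟨a, ha⟩ := exists_surjective_nat G
  refine HF.of_ascending (K := fun n => Subgroup.closure (a '' Set.Iio n))
    (fun m n hmn => Subgroup.closure_mono (Set.image_mono (Set.Iio_subset_Iio hmn)))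
    (fun g => ?_) fun n => hG _ ?_
  · obtain ⟨n, rfl⟩ := ha g
    exact ⟨n + 1, Subgroup.subset_closure ⟨n, n.lt_succ_self, rfl⟩⟩
  · exact (Subgroup.fg_iff _).2 ⟨_, rfl, (Set.finite_Iio n).image a⟩

/-- A finitely generated subgroup need not have finitely generated stabilizers, but these are
countable, and countable groups in `LHF` are in `HF`. So the tree shows that the subgroup is in
`HF`. -/
theorem LHF.of_tree {G V E : Type u} [Group G] [MulAction G V] [MulAction G E]
    (T : TreeAction G V E) (hV : ∀ v : V, LHF (MulAction.stabilizer G v))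
    (hE : ∀ e : E, LHF (MulAction.stabilizer G e)) : LHF G := fun K hK => by
  have := countable_of_fg hK
  refine HF.of_tree (T.restrict K) (fun v => LHF.hf_of_countable ?_)
    fun e => LHF.hf_of_countable ?_
  · exact LHF.of_injective (f := (K.subtype.comp (Subgroup.subtype _)).codRestrict
      (MulAction.stabilizer G v) fun x => x.2) (fun _ _ h => Subtype.ext (Subtype.ext
        (congrArg (fun y : MulAction.stabilizer G v => (y : G)) h))) (hV v)
  · exact LHF.of_injective (f := (K.subtype.comp (Subgroup.subtype _)).codRestrict
      (MulAction.stabilizer G e) fun x => x.2) (fun _ _ h => Subtype.ext (Subtype.ext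
        (congrArg (fun y : MulAction.stabilizer G e => (y : G)) h))) (hE e)

theorem LHF.of_hom_int {G : Type u} [Group G] (f : G →* Multiplicative ℤ) (h : LHF f.ker) :
    LHF G := by
  let := TreeAction.lineAction f
  have hs : ∀ n : ULift.{u} ℤ, LHF (MulAction.stabilizer G n) := fun n =>
    LHF.of_injective (Subgroup.inclusion_injective (TreeAction.stabilizer_lineAction_le f n)) h
  exact LHF.of_tree (TreeAction.line f) hs hs

/-- A group all of whose finitely generated subgroups are separated by finitely many homomorphisms
to a group in `LHF` is in `LHF`. -/
theorem LHF.of_homs {ι : Type*} {L Q : Type u} [Group L] [Group Q] (hQ : LHF Q) (f : ι → L →* Q)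
    (h : ∀ S : Subgroup L, S.FG → ∃ s : Finset ι, ∀ x ∈ S, (∀ i ∈ s, f i x = 1) → x = 1) :
    LHF L := fun S hS => by
  obtain ⟨s, hs⟩ := h S hS
  refine HF.of_finset s (fun i => (f i).comp S.subtype) (fun i _ => ?_) ?_
  · rw [MonoidHom.range_comp, Subgroup.range_subtype]
    exact hQ _ (fg_map (f i) hS)
  · have : (⨅ i ∈ s, ((f i).comp S.subtype).ker : Subgroup S) = ⊥ := by
      refine (Subgroup.eq_bot_iff_forall _).2 fun x hx => ?_
      simp only [Subgroup.mem_iInf] at hx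
      exact Subtype.ext (hs x x.2 fun i hi => hx i hi)
    rw [this]
    infer_instance

/-! ### The tree of an amalgamated product -/

section Amalgam

open Monoid

variable {ι : Type*} {A : ι → Type*} {C : Type*} [∀ i, Group (A i)] [Group C] {φ : ∀ i, C →* A i}

/-- The parts of a normal form that depend only on cosets: the length, the index of the first
letter, and the rest of the word when a letter with index `i` is removed from its beginning. -/
structure AmalgamNormalForm (φ : ∀ i, C →* A i) where
  /-- The length of the normal form. -/
  len : PushoutI φ → ℕ
  /-- The index of the first letter. -/
  fst : PushoutI φ → Option ι
  /-- The rest of the word, without the first letter if this has the index `i`. -/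
  tail : ι → PushoutI φ → PushoutI φ
  len_base_mul : ∀ c g, len (PushoutI.base φ c * g) = len g
  fst_base_mul : ∀ c g, fst (PushoutI.base φ c * g) = fst g
  fst_one : fst 1 = none
  mem_of_fst_eq_none : ∀ g, fst g = none → g ∈ (PushoutI.base φ).range
  tail_of_mul : ∀ i a g, tail i (PushoutI.of i a * g) = tail i g
  exists_of_mul_tail : ∀ i g, ∃ a, PushoutI.of i a * tail i g = g
  len_tail_lt : ∀ i g, fst g = some i → len (tail i g) < len g
  exists_base_mul_tail : ∀ i g, fst g ≠ some i → ∃ c, PushoutI.base φ c * tail i g = g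

-- Normal words relative to a transversal supply the data. `tail i` drops from the normal word its
-- head in `C` and, if the first letter has index `i`, this letter as well; left multiplication by
-- the factor with index `i` affects only the dropped part.
open PushoutI NormalWord in
theorem nonempty_amalgamNormalForm (hφ : ∀ i, Function.Injective (φ i)) :
    Nonempty (AmalgamNormalForm φ) := by
  classical
  obtain ⟨d⟩ := transversal_nonempty φ hφ
  let w : PushoutI φ → NormalWord d := fun g => g • NormalWord.empty
  have hw : ∀ g, (w g).prod = g := fun g => by simp [w]
  let t : ι → PushoutI φ → NormalWord d := fun i g =>
    ⟨(NormalWord.equivPair i (w g)).tail, 1, (NormalWord.equivPair i (w g)).normalized⟩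
  have ht : ∀ i g, (t i g).toWord = (CoprodI.Word.equivPair i (w g).toWord).tail := by
    intro i g
    change (CoprodI.Word.equivPair i (CoprodI.of (φ i (w g).head) • (w g).toWord)).tail = _
    rw [CoprodI.Word.equivPair_smul_same]
  have hprod : ∀ i g, (t i g).prod = ofCoprodI (t i g).toWord.prod := fun i g => by
    rw [NormalWord.prod]
    change base φ 1 * _ = _
    rw [map_one, one_mul]
  have hfst : ∀ i g, (w g).fstIdx ≠ some i → (t i g).toWord = (w g).toWord := fun i g h => by
    rw [ht, CoprodI.Word.equivPair_eq_of_fstIdx_ne h]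
  refine ⟨{
    len := fun g => (w g).toList.length
    fst := fun g => (w g).fstIdx
    tail := fun i g => (t i g).prod
    len_base_mul := fun c g => by simp only [w, mul_smul, base_smul_def]
    fst_base_mul := fun c g => by simp only [w, mul_smul, base_smul_def]
    fst_one := by
      simp only [w, one_smul]
      rfl
    mem_of_fst_eq_none := fun g h => ?_
    tail_of_mul := fun i a g => ?_
    exists_of_mul_tail := fun i g => ?_
    len_tail_lt := fun i g h => ?_
    exists_base_mul_tail := fun i g h => ⟨(w g).head, ?_⟩ }⟩
  · have h1 : (w g).toList = [] := by
      rw [CoprodI.Word.fstIdx, Option.map_eq_none_iff, List.head?_eq_none_iff] at h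
      exact h
    refine ⟨(w g).head, ?_⟩
    conv_rhs => rw [← hw g, NormalWord.prod, CoprodI.Word.prod, h1]
    simp
  · have h1 : NormalWord.equivPair i (w (of i a * g)) =
        { NormalWord.equivPair i (w g) with head := a * (NormalWord.equivPair i (w g)).head } := by
      simp only [w, mul_smul, summand_smul_def, Equiv.apply_symm_apply]
    have h2 : (t i (of i a * g)).toWord = (t i g).toWord := by
      change (NormalWord.equivPair i (w (of i a * g))).tail = _
      rw [h1]
    rw [hprod, hprod, h2]
  · set p := CoprodI.Word.equivPair i (CoprodI.of (φ i (w g).head) • (w g).toWord)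
    refine ⟨p.head, ?_⟩
    have h1 := congrArg (fun v => ofCoprodI (φ := φ) (CoprodI.Word.prod v))
      (CoprodI.Word.equivPair_head_smul_equivPair_tail (i := i)
        (CoprodI.of (φ i (w g).head) • (w g).toWord))
    simp only [CoprodI.Word.prod_smul, map_mul, ofCoprodI_of, of_apply_eq_base] at h1
    rw [hprod]
    refine h1.trans ?_
    conv_rhs => rw [← hw g, NormalWord.prod]
  · have h1 : w (t i g).prod = t i g := NormalWord.prod_smul_empty _
    rw [h1]
    have h2 := ht i g
    change (t i g).toWord.toList.length < (w g).toWord.toList.length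
    rw [h2]
    set p := CoprodI.Word.equivPair i (w g).toWord with hp
    have h3 : CoprodI.Word.rcons p = (w g).toWord := by
      rw [← CoprodI.Word.equivPair_symm, hp, Equiv.symm_apply_apply]
    rw [← h3, CoprodI.Word.rcons]
    split_ifs with h4
    · rw [CoprodI.Word.rcons, dif_pos h4] at h3
      exact absurd (by rw [h3]; exact h) p.fstIdx_ne
    · simp [CoprodI.Word.cons]
  · rw [hprod, hfst i g h]
    conv_rhs => rw [← hw g, NormalWord.prod]

/-- The vertices of the tree of an amalgamated product. -/
abbrev AmalgamVertex (φ : ∀ i, C →* A i) :=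
  (PushoutI φ ⧸ (PushoutI.base φ).range) ⊕
    Σ i, PushoutI φ ⧸ (PushoutI.of (φ := φ) i).range

/-- The edges of the tree of an amalgamated product. -/
abbrev AmalgamEdge (φ : ∀ i, C →* A i) :=
  Σ _ : ι, PushoutI φ ⧸ (PushoutI.base φ).range

/-- The root of the tree of an amalgamated product. -/
def amalgamRoot (φ : ∀ i, C →* A i) : AmalgamVertex φ := Sum.inl (QuotientGroup.mk 1)

theorem base_range_le (i : ι) : (PushoutI.base φ).range ≤ (PushoutI.of (φ := φ) i).range := by
  rintro _ ⟨c, rfl⟩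
  exact ⟨φ i c, PushoutI.of_apply_eq_base φ i c⟩

namespace AmalgamNormalForm

variable (N : AmalgamNormalForm φ)

theorem len_out (g : PushoutI φ) :
    N.len ((g : PushoutI φ ⧸ (PushoutI.base φ).range).out⁻¹) = N.len g⁻¹ := by
  obtain ⟨c, hc⟩ := QuotientGroup.eq.1
    (Quotient.out_eq (g : PushoutI φ ⧸ (PushoutI.base φ).range))
  rw [← N.len_base_mul c g⁻¹, hc, mul_inv_cancel_right]

theorem fst_out (g : PushoutI φ) :
    N.fst ((g : PushoutI φ ⧸ (PushoutI.base φ).range).out⁻¹) = N.fst g⁻¹ := by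
  obtain ⟨c, hc⟩ := QuotientGroup.eq.1
    (Quotient.out_eq (g : PushoutI φ ⧸ (PushoutI.base φ).range))
  rw [← N.fst_base_mul c g⁻¹, hc, mul_inv_cancel_right]

theorem tail_out (i : ι) (g : PushoutI φ) :
    N.tail i ((g : PushoutI φ ⧸ (PushoutI.of (φ := φ) i).range).out⁻¹) = N.tail i g⁻¹ := by
  obtain ⟨a, ha⟩ := QuotientGroup.eq.1
    (Quotient.out_eq (g : PushoutI φ ⧸ (PushoutI.of (φ := φ) i).range))
  rw [← N.tail_of_mul i a g⁻¹, ha, mul_inv_cancel_right]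

theorem exists_fst (x : PushoutI φ ⧸ (PushoutI.base φ).range)
    (hx : (Sum.inl x : AmalgamVertex φ) ≠ amalgamRoot φ) :
    ∃ i, N.fst x.out⁻¹ = some i := by
  rw [← Option.ne_none_iff_exists']
  intro h
  refine hx (congrArg Sum.inl ?_)
  rw [← Quotient.out_eq x]
  exact QuotientGroup.eq.2 (by rw [mul_one]; exact N.mem_of_fst_eq_none _ h)

/-- The projection of cosets. -/
def proj (φ : ∀ i, C →* A i) (i : ι) : PushoutI φ ⧸ (PushoutI.base φ).range →
    PushoutI φ ⧸ (PushoutI.of (φ := φ) i).range :=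
  Subgroup.quotientMapOfLE (base_range_le i)

/-- The next vertex on the way to the root. -/
noncomputable def up : AmalgamVertex φ → AmalgamVertex φ
  | Sum.inl x => match N.fst x.out⁻¹ with
    | none => Sum.inl x
    | some i => Sum.inr ⟨i, proj φ i x⟩
  | Sum.inr y => Sum.inl ((N.tail y.1 y.2.out⁻¹)⁻¹ : PushoutI φ)

theorem up_inl {x : PushoutI φ ⧸ (PushoutI.base φ).range} {i : ι} (h : N.fst x.out⁻¹ = some i) :
    N.up (Sum.inl x) = Sum.inr ⟨i, proj φ i x⟩ := by
  simp only [up, h]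

theorem mk_tail_inv (i : ι) (y : PushoutI φ ⧸ (PushoutI.of (φ := φ) i).range) :
    (((N.tail i y.out⁻¹)⁻¹ : PushoutI φ) : PushoutI φ ⧸ (PushoutI.of (φ := φ) i).range) = y := by
  obtain ⟨a, ha⟩ := N.exists_of_mul_tail i y.out⁻¹
  conv_rhs => rw [← Quotient.out_eq y]
  refine QuotientGroup.eq.2 ⟨a⁻¹, ?_⟩
  rw [map_inv, inv_inv]
  exact inv_eq_of_mul_eq_one_right (by rw [← mul_assoc, ha, inv_mul_cancel])

/-- The next edge on the way to the root. -/
noncomputable def upEdge : ∀ v : AmalgamVertex φ, v ≠ amalgamRoot φ → AmalgamEdge φ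
  | Sum.inl x, hx => ⟨(N.exists_fst x hx).choose, x⟩
  | Sum.inr y, _ => ⟨y.1, ((N.tail y.1 y.2.out⁻¹)⁻¹ : PushoutI φ)⟩

/-- The height function. -/
noncomputable def rank : AmalgamVertex φ → ℕ
  -- Normal forms are invariant under left multiplication by `C`, whereas vertices are left cosets,
  -- hence the inverses. The factor `2` leaves room for the other kind of vertex between two
  -- consecutive lengths.
  | Sum.inl x => 2 * N.len x.out⁻¹
  | Sum.inr y => 2 * N.len (N.tail y.1 y.2.out⁻¹) + 1

/-- The tree of an amalgamated product. -/
noncomputable def tree : TreeAction (PushoutI φ) (AmalgamVertex φ) (AmalgamEdge φ) where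
  src e := Sum.inl e.2
  tgt e := Sum.inr ⟨e.1, proj φ e.1 e.2⟩
  src_smul _ _ := rfl
  tgt_smul g e := by
    obtain ⟨i, x⟩ := e
    induction x using QuotientGroup.induction_on with
    | H h => rfl
  root := amalgamRoot φ
  rank := N.rank
  up := N.up
  upEdge := N.upEdge
  rank_up := by
    rintro (x | ⟨i, y⟩) hx
    · obtain ⟨i, hi⟩ := N.exists_fst x hx
      induction x using QuotientGroup.induction_on with
      | H g =>
        simp only [up, hi, rank, N.len_out]
        change 2 * N.len (N.tail i ((g : PushoutI φ ⧸ (PushoutI.of (φ := φ) i).range).out⁻¹)) + 1 < _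
        rw [N.tail_out]
        rw [N.fst_out] at hi
        have := N.len_tail_lt i g⁻¹ hi
        omega
    · change 2 * N.len _⁻¹ < 2 * N.len _ + 1
      rw [N.len_out, inv_inv]
      exact Nat.lt_succ_self _
  ends := by
    rintro (x | ⟨i, y⟩) hx
    · exact Or.inr ⟨rfl, (N.up_inl (N.exists_fst x hx).choose_spec).symm⟩
    · exact Or.inl ⟨rfl, congrArg (fun y => (Sum.inr ⟨i, y⟩ : AmalgamVertex φ))
        (N.mk_tail_inv i y)⟩
  exists_upEdge := by
    rintro ⟨i, x⟩
    by_cases h : N.fst x.out⁻¹ = some i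
    · have hx : (Sum.inl x : AmalgamVertex φ) ≠ amalgamRoot φ := by
        intro hx
        rw [Sum.inl.inj hx, N.fst_out, inv_one, N.fst_one] at h
        cases h
      refine ⟨Sum.inl x, hx, ?_⟩
      have h' := (N.exists_fst x hx).choose_spec
      exact congrArg (fun j => (⟨j, x⟩ : AmalgamEdge φ)) (Option.some.inj (h'.symm.trans h))
    · refine ⟨Sum.inr ⟨i, proj φ i x⟩, Sum.inr_ne_inl, congrArg (Sigma.mk i) ?_⟩
      induction x using QuotientGroup.induction_on with
      | H g =>
        rw [N.fst_out] at h
        obtain ⟨c, hc⟩ := N.exists_base_mul_tail i g⁻¹ h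
        change (((N.tail i ((g : PushoutI φ ⧸ (PushoutI.of (φ := φ) i).range).out⁻¹))⁻¹ :
          PushoutI φ) : PushoutI φ ⧸ (PushoutI.base φ).range) = _
        rw [N.tail_out]
        refine QuotientGroup.eq.2 ⟨c⁻¹, ?_⟩
        rw [map_inv, inv_inv]
        exact inv_eq_of_mul_eq_one_right (by rw [← mul_assoc, hc, inv_mul_cancel])

end AmalgamNormalForm

end Amalgam

/-! ### A binate overgroup -/

section Mitosis

open Filter

/-- The functions from the integers to `H` that are constant near `∞` and trivial near `-∞`. -/
def eventuallyConstant (H : Type*) [Group H] : Subgroup (ℤ → H) where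
  carrier := {F | (∃ c, ∀ᶠ n in atTop, F n = c) ∧ ∀ᶠ n in atBot, F n = 1}
  one_mem' := ⟨⟨1, Eventually.of_forall fun _ => rfl⟩, Eventually.of_forall fun _ => rfl⟩
  mul_mem' := by
    rintro F F' ⟨⟨c, hc⟩, h⟩ ⟨⟨c', hc'⟩, h'⟩
    refine ⟨⟨c * c', ?_⟩, ?_⟩
    · filter_upwards [hc, hc'] with n h1 h2
      rw [Pi.mul_apply, h1, h2]
    · filter_upwards [h, h'] with n h1 h2
      rw [Pi.mul_apply, h1, h2, one_mul]
  inv_mem' := by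
    rintro F ⟨⟨c, hc⟩, h⟩
    refine ⟨⟨c⁻¹, ?_⟩, ?_⟩
    · filter_upwards [hc] with n h1
      rw [Pi.inv_apply, h1]
    · filter_upwards [h] with n h1
      rw [Pi.inv_apply, h1, inv_one]

variable {H : Type u} [Group H]

/-- The shift of functions on the integers. -/
def shift (H : Type*) [Group H] : Multiplicative ℤ →* MulAut (eventuallyConstant H) where
  toFun k :=
    { toFun := fun F => ⟨fun n => F.1 (n - k.toAdd), by
        obtain ⟨F, ⟨c, hc⟩, h⟩ := F
        exact ⟨⟨c, (tendsto_atTop_add_const_right atTop (-k.toAdd) tendsto_id).eventually hc⟩,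
          (tendsto_atBot_add_const_right atBot (-k.toAdd) tendsto_id).eventually h⟩⟩
      invFun := fun F => ⟨fun n => F.1 (n + k.toAdd), by
        obtain ⟨F, ⟨c, hc⟩, h⟩ := F
        exact ⟨⟨c, (tendsto_atTop_add_const_right atTop k.toAdd tendsto_id).eventually hc⟩,
          (tendsto_atBot_add_const_right atBot k.toAdd tendsto_id).eventually h⟩⟩
      left_inv := fun F => Subtype.ext (funext fun n => congrArg F.1 (by simp))
      right_inv := fun F => Subtype.ext (funext fun n => congrArg F.1 (by simp))
      map_mul' := fun F F' => rfl }
  map_one' := MulEquiv.ext fun F => Subtype.ext (funext fun n => congrArg F.1 (by simp))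
  map_mul' k l := MulEquiv.ext fun F => Subtype.ext (funext fun n => congrArg F.1 (by
    rw [toAdd_mul]
    ring))

/-- The functions on the integers that are constant on `[n, ∞)` and trivial on `(-∞, -n]`. -/
def constantOutside (H : Type*) [Group H] (n : ℕ) : Subgroup (eventuallyConstant H) where
  carrier := {F | (∀ k : ℤ, n ≤ k → F.1 k = F.1 n) ∧ ∀ k : ℤ, k ≤ -n → F.1 k = 1}
  one_mem' := ⟨fun _ _ => rfl, fun _ _ => rfl⟩
  mul_mem' := by
    rintro F F' ⟨h1, h2⟩ ⟨h1', h2'⟩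
    refine ⟨fun k hk => ?_, fun k hk => ?_⟩
    · change F.1 k * F'.1 k = F.1 n * F'.1 n
      rw [h1 k hk, h1' k hk]
    · change F.1 k * F'.1 k = 1
      rw [h2 k hk, h2' k hk, one_mul]
  inv_mem' := by
    rintro F ⟨h1, h2⟩
    refine ⟨fun k hk => congrArg (·⁻¹) (h1 k hk), fun k hk => ?_⟩
    change (F.1 k)⁻¹ = 1
    rw [h2 k hk, inv_one]

theorem constantOutside_mono : Monotone (constantOutside H) := by
  rintro m n hmn F ⟨h1, h2⟩
  have hmn' : (m : ℤ) ≤ n := by exact_mod_cast hmn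
  exact ⟨fun k hk => (h1 k (hmn'.trans hk)).trans (h1 n hmn').symm, fun k hk => h2 k (by omega)⟩

theorem exists_mem_constantOutside (F : eventuallyConstant H) : ∃ n, F ∈ constantOutside H n := by
  obtain ⟨F, ⟨c, hc⟩, h⟩ := F
  obtain ⟨a, ha⟩ := eventually_atTop.1 hc
  obtain ⟨b, hb⟩ := eventually_atBot.1 h
  refine ⟨max a.natAbs b.natAbs, fun k hk => ?_, fun k hk => hb k (by omega)⟩
  exact (ha k (by omega)).trans (ha _ (by omega)).symm

/-- The functions in a finitely generated subgroup are constant to the right and trivial to the left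
of a common bounded interval, so the finitely many evaluations on this interval are jointly
injective. -/
theorem lhf_eventuallyConstant (hH : LHF H) : LHF (eventuallyConstant H) := by
  refine LHF.of_homs hH (fun n : ℤ => (Pi.evalMonoidHom _ n).comp (eventuallyConstant H).subtype)
    fun S hS => ?_
  obtain ⟨n, hn⟩ := exists_le_of_fg constantOutside_mono exists_mem_constantOutside hS
  refine ⟨Finset.Icc (-n) n, fun F hF h => Subtype.ext (funext fun k => ?_)⟩
  have h' : ∀ i : ℤ, -n ≤ i → i ≤ n → F.1 i = 1 := fun i h1 h2 => h i (Finset.mem_Icc.2 ⟨h1, h2⟩)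
  obtain ⟨h1, h2⟩ := hn hF
  rcases le_or_gt k (-n) with hk | hk
  · exact h2 k hk
  · rcases le_or_gt (n : ℤ) k with hk' | hk'
    · exact (h1 k hk').trans (h' n (by omega) le_rfl)
    · exact h' k hk.le hk'.le

/-- The unrestricted wreath product of eventually constant functions with the integers. -/
abbrev Mitosis (H : Type u) [Group H] : Type u :=
  SemidirectProduct (eventuallyConstant H) (Multiplicative ℤ) (shift H)

/-- The projection to the integers gives an action on a line, and its kernel consists of eventually
constant functions. -/
theorem lhf_mitosis (hH : LHF H) : LHF (Mitosis H) := by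
  refine LHF.of_hom_int SemidirectProduct.rightHom (LHF.of_injective
    (f := ({ toFun := fun x => (x : Mitosis H).left
             map_one' := rfl
             map_mul' := fun x y => ?_ } : (SemidirectProduct.rightHom (φ := shift H)).ker →*
               eventuallyConstant H)) (fun x y h => ?_) (lhf_eventuallyConstant hH))
  · have hx : (x : Mitosis H).right = 1 := x.2
    change (x : Mitosis H).left * shift H (x : Mitosis H).right (y : Mitosis H).left = _
    rw [hx, map_one]
    rfl
  · have hx : (x : Mitosis H).right = 1 := x.2
    have hy : (y : Mitosis H).right = 1 := y.2
    exact Subtype.ext (SemidirectProduct.ext h (hx.trans hy.symm))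

/-- The functions supported at `0`. -/
def mitosisSingle (H : Type u) [Group H] : H →* Mitosis H :=
  SemidirectProduct.inl.comp (((MonoidHom.mulSingle (fun _ : ℤ => H) 0)).codRestrict
    (eventuallyConstant H) fun h => ⟨⟨1, by
      filter_upwards [eventually_gt_atTop 0] with n hn
      exact Pi.mulSingle_eq_of_ne (M := fun _ : ℤ => H) hn.ne' h⟩, by
      filter_upwards [eventually_lt_atBot 0] with n hn
      exact Pi.mulSingle_eq_of_ne (M := fun _ : ℤ => H) hn.ne h⟩)

/-- The functions that are constant on the positive integers and trivial on the others. -/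
def mitosisTail (H : Type u) [Group H] : H →* Mitosis H :=
  SemidirectProduct.inl.comp
    { toFun := fun h => ⟨fun n => if 0 < n then h else 1, ⟨h, by
        filter_upwards [eventually_gt_atTop 0] with n hn
        rw [if_pos hn]⟩, by
        filter_upwards [eventually_lt_atBot 0] with n hn
        rw [if_neg hn.not_gt]⟩
      map_one' := Subtype.ext (funext fun n => ite_self _)
      map_mul' := fun h h' => Subtype.ext (funext fun n => by
        change (if 0 < n then h * h' else 1) = (if 0 < n then h else 1) * (if 0 < n then h' else 1)
        split_ifs
        · rfl
        · rw [one_mul]) }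

theorem mitosisSingle_injective : Function.Injective (mitosisSingle H) := by
  intro h h' hh
  have h1 := congrArg (fun F : eventuallyConstant H => F.1 0) (SemidirectProduct.inl_injective hh)
  change Pi.mulSingle (M := fun _ : ℤ => H) 0 h 0 = Pi.mulSingle (M := fun _ : ℤ => H) 0 h' 0 at h1
  rwa [Pi.mulSingle_eq_same, Pi.mulSingle_eq_same] at h1

theorem mitosisSingle_mul_mitosisTail (a b : H) :
    mitosisSingle H a * mitosisTail H b = mitosisTail H b * mitosisSingle H a := by
  simp only [mitosisSingle, mitosisTail, MonoidHom.comp_apply, ← map_mul]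
  refine congrArg _ (Subtype.ext (funext fun n => ?_))
  change Pi.mulSingle (M := fun _ : ℤ => H) 0 a n * (if 0 < n then b else 1) =
    (if 0 < n then b else 1) * Pi.mulSingle (M := fun _ : ℤ => H) 0 a n
  split_ifs with hn
  · rw [Pi.mulSingle_eq_of_ne hn.ne', one_mul, mul_one]
  · rw [one_mul, mul_one]

/-- The value `h` at `0` together with the tail on the positive integers is the constant `h` on the
nonnegative integers, which the shift moves onto the tail: an infinite repetition absorbs one more
copy. -/
theorem conj_mitosisSingle_mul_mitosisTail (h : H) :
    SemidirectProduct.inr (φ := shift H) (Multiplicative.ofAdd 1) *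
      (mitosisSingle H h * mitosisTail H h) *
        (SemidirectProduct.inr (φ := shift H) (Multiplicative.ofAdd 1))⁻¹ = mitosisTail H h := by
  simp only [mitosisSingle, mitosisTail, MonoidHom.comp_apply, ← map_mul]
  rw [← map_inv, ← SemidirectProduct.inl_aut]
  refine congrArg _ (Subtype.ext (funext fun n => ?_))
  change Pi.mulSingle (M := fun _ : ℤ => H) 0 h (n - 1) * (if 0 < n - 1 then h else 1) =
    (if 0 < n then h else 1)
  rcases lt_trichotomy (n - 1) 0 with hn | hn | hn
  · rw [Pi.mulSingle_eq_of_ne hn.ne, if_neg hn.not_gt, if_neg (by omega), one_mul]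
  · rw [hn, Pi.mulSingle_eq_same, if_neg (lt_irrefl _), if_pos (by omega), mul_one]
  · rw [Pi.mulSingle_eq_of_ne hn.ne', if_pos hn, if_pos (by omega), one_mul]

end Mitosis

/-! ### Stabilizers of cosets -/

section Cosets

variable {G : Type u} [Group G]

theorem exists_conj_mem {K : Subgroup G} {x : G ⧸ K} {g : G} (h : g • x = x) :
    ∃ y : G, y⁻¹ * g * y ∈ K := by
  induction x using QuotientGroup.induction_on with
  | H y =>
    refine ⟨y, ?_⟩
    simpa [mul_assoc] using inv_mem (QuotientGroup.eq.1 h)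

/-- The stabilizer of `g K` is `g K g⁻¹`, and the operator `ρ g` identifies the two restrictions of
`ρ`. -/
theorem LiftProj.stabilizer_coset {K : Subgroup G} {M : Type u} [AddCommGroup M]
    {ρ : Representation ℤ G M} (h : LiftProj (ρ.comp K.subtype)) (x : G ⧸ K) :
    LiftProj (ρ.comp (MulAction.stabilizer G x).subtype) := by
  induction x using QuotientGroup.induction_on with
  | H g =>
    let f : MulAction.stabilizer G (g : G ⧸ K) →* K :=
      ((MulAut.conj g⁻¹).toMonoidHom.comp (Subgroup.subtype _)).codRestrict K fun x => by
        have h := inv_mem (QuotientGroup.eq.1 (MulAction.mem_stabilizer_iff.1 x.2))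
        simpa [mul_assoc] using h
    have hf : Function.Injective f := fun x y h =>
      Subtype.ext ((MulAut.conj g⁻¹).injective (congrArg Subtype.val h))
    have hfx : ∀ x, ((f x : K) : G) = g⁻¹ * x * g := fun x => by
      change g⁻¹ * (x : G) * g⁻¹⁻¹ = _
      rw [inv_inv]
    refine (h.comp_injective hf).of_retract (i := ρ g⁻¹) (r := ρ g) (fun x m => ?_) (fun x m => ?_)
      fun m => ?_
    · change ρ g⁻¹ (ρ x m) = ρ (f x : K) (ρ g⁻¹ m)
      rw [hfx, ← Module.End.mul_apply, ← Module.End.mul_apply, ← map_mul, ← map_mul,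
        mul_inv_cancel_right]
    · change ρ g (ρ (f x : K) m) = ρ x (ρ g m)
      rw [hfx, ← Module.End.mul_apply, ← Module.End.mul_apply, ← map_mul, ← map_mul, mul_assoc,
        mul_inv_cancel_left]
    · rw [← Module.End.mul_apply, ← map_mul, mul_inv_cancel, map_one]
      rfl

theorem LiftProj.range {K : Type u} [Group K] {f : K →* G} (hf : Function.Injective f)
    {M : Type u} [AddCommGroup M] {ρ : Representation ℤ G M} (h : LiftProj (ρ.comp f)) :
    LiftProj (ρ.comp f.range.subtype) := by
  have h1 := h.comp_injective (φ := (MonoidHom.ofInjective hf).symm.toMonoidHom)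
    (MonoidHom.ofInjective hf).symm.injective
  have h2 : (ρ.comp f).comp (MonoidHom.ofInjective hf).symm.toMonoidHom =
      ρ.comp f.range.subtype := by
    ext1 x
    exact congrArg ρ (MonoidHom.apply_ofInjective_symm hf x)
  rwa [h2] at h1

theorem LHF.range {K : Type u} [Group K] {f : K →* G} (hf : Function.Injective f) (h : LHF K) :
    LHF f.range :=
  LHF.of_injective (f := (MonoidHom.ofInjective hf).symm.toMonoidHom)
    (MonoidHom.ofInjective hf).symm.injective h

end Cosets

/-! ### One step of the construction -/

section Step

open Monoid

variable {Γ Q : Type u} [Group Γ] [Group Q] (f : Γ →* Q)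

/-- The groups that are amalgamated over the kernel of `f`. -/
def stepGroup (f : Γ →* Q) : Bool → Type u
  | false => Γ
  | true => Mitosis f.ker

instance : ∀ b, Group (stepGroup f b)
  | false => inferInstanceAs (Group Γ)
  | true => inferInstanceAs (Group (Mitosis f.ker))

/-- The embeddings of the kernel of `f`. -/
def stepEmbedding : ∀ b, f.ker →* stepGroup f b
  | false => f.ker.subtype
  | true => mitosisSingle f.ker

theorem stepEmbedding_injective : ∀ b, Function.Injective (stepEmbedding f b)
  | false => Subtype.val_injective
  | true => mitosisSingle_injective

/-- The amalgamated product of `Γ` and the mitosis of the kernel of `f`. -/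
abbrev StepProduct : Type u := PushoutI (stepEmbedding f)

/-- The embedding of `Γ` into the amalgamated product. -/
def stepIncl : Γ →* StepProduct f := PushoutI.of (φ := stepEmbedding f) false

/-- The embedding of the mitosis into the amalgamated product. -/
def stepMitosis : Mitosis f.ker →* StepProduct f := PushoutI.of (φ := stepEmbedding f) true

theorem stepIncl_injective : Function.Injective (stepIncl f) :=
  PushoutI.of_injective (stepEmbedding_injective f) false

theorem stepMitosis_injective : Function.Injective (stepMitosis f) :=
  PushoutI.of_injective (stepEmbedding_injective f) true

/-- The components of the extension of `f`. -/
def stepComponent : ∀ b, stepGroup f b →* Q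
  | false => f
  | true => 1

/-- The extension of `f` that is trivial on the mitosis. -/
def stepHom : StepProduct f →* Q :=
  PushoutI.lift (stepComponent f) 1 fun b => by
    cases b with
    | false => exact MonoidHom.ext fun x => x.2
    | true => rfl

theorem stepHom_stepIncl (x : Γ) : stepHom f (stepIncl f x) = f x :=
  PushoutI.lift_of (i := false) (stepComponent f) 1 _ x

theorem stepHom_stepMitosis (x : Mitosis f.ker) : stepHom f (stepMitosis f x) = 1 :=
  PushoutI.lift_of (i := true) (stepComponent f) 1 _ x

theorem stepMitosis_mitosisSingle (x : f.ker) :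
    stepMitosis f (mitosisSingle f.ker x) = stepIncl f x :=
  (PushoutI.of_apply_eq_base (stepEmbedding f) true x).trans
    (PushoutI.of_apply_eq_base (stepEmbedding f) false x).symm

theorem base_range_le_ker : (PushoutI.base (stepEmbedding f)).range ≤ (stepHom f).ker := by
  rintro _ ⟨x, rfl⟩
  rw [← PushoutI.of_apply_eq_base (stepEmbedding f) true x]
  exact stepHom_stepMitosis f _

theorem stepMitosis_range_le_ker : (stepMitosis f).range ≤ (stepHom f).ker := by
  rintro _ ⟨x, rfl⟩
  exact stepHom_stepMitosis f _

/-- The tree of the amalgamated product. -/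
theorem exists_stepTree : Nonempty (TreeAction (StepProduct f) (AmalgamVertex (stepEmbedding f))
    (AmalgamEdge (stepEmbedding f))) :=
  (nonempty_amalgamNormalForm (stepEmbedding_injective f)).map AmalgamNormalForm.tree

theorem stabilizer_inl_le {G X Y : Type*} [Group G] [MulAction G X] [MulAction G Y] (x : X) :
    MulAction.stabilizer G (Sum.inl x : X ⊕ Y) ≤ MulAction.stabilizer G x := fun _ hg =>
  Sum.inl.inj hg

theorem stabilizer_inr_le {G X Y : Type*} [Group G] [MulAction G X] [MulAction G Y] (y : Y) :
    MulAction.stabilizer G (Sum.inr y : X ⊕ Y) ≤ MulAction.stabilizer G y := fun _ hg =>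
  Sum.inr.inj hg

theorem stabilizer_sigma_le {G ι : Type*} {X : ι → Type*} [Group G] [∀ i, MulAction G (X i)] (i : ι)
    (x : X i) : MulAction.stabilizer G (⟨i, x⟩ : Σ i, X i) ≤ MulAction.stabilizer G x := by
  intro g hg
  have := MulAction.mem_stabilizer_iff.1 hg
  injection this

/-- An element of prime order fixes a vertex of the Bass-Serre tree, so it is conjugate into `Γ`,
where the hypothesis applies, or into a subgroup of the kernel, which is normal. -/
theorem mooreCondition_stepHom (hf : MooreCondition f.ker) : MooreCondition (stepHom f).ker := by
  intro g hg hprime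
  obtain ⟨T⟩ := exists_stepTree f
  have hnorm : ∀ {K : Subgroup (StepProduct f)} {x : StepProduct f ⧸ K}, K ≤ (stepHom f).ker →
      g • x ≠ x := by
    intro K x hK h
    obtain ⟨y, hy⟩ := exists_conj_mem h
    have h1 := MonoidHom.mem_ker.1 (hK hy)
    rw [map_mul, map_mul, map_inv, mul_assoc, inv_mul_eq_one, eq_comm, mul_eq_right] at h1
    exact hg h1
  obtain ⟨x | ⟨_ | _, x⟩, hx⟩ := T.exists_smul_eq hprime
  · exact hnorm (base_range_le_ker f) (stabilizer_inl_le x hx)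
  · obtain ⟨y, hy⟩ := exists_conj_mem (stabilizer_sigma_le _ _ (stabilizer_inr_le _ hx))
    obtain ⟨z, hz⟩ : ∃ z : Γ, stepIncl f z = y⁻¹ * g * y := hy
    refine hf z (fun hz' => hg ?_) ?_
    · have h1 : stepHom f (y⁻¹ * g * y) = 1 := by
        rw [← hz, stepHom_stepIncl]
        exact hz'
      rw [map_mul, map_mul, map_inv, mul_assoc, inv_mul_eq_one, eq_comm, mul_eq_right] at h1
      exact h1
    · rw [← orderOf_injective (stepIncl f) (stepIncl_injective f), hz]
      have h2 : y⁻¹ * g * y = MulAut.conj y⁻¹ g := by simp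
      rwa [h2, MulEquiv.orderOf_eq]
  · exact hnorm (K := (stepMitosis f).range) (stepMitosis_range_le_ker f)
      (stabilizer_sigma_le (X := fun b => StepProduct f ⧸ (PushoutI.of (φ := stepEmbedding f) b).range)
        true x (stabilizer_inr_le _ hx))

/-- Up to conjugation the vertex and edge groups embed into `Γ` or into the mitosis of the kernel,
and both are in `LHF`. -/
theorem lhf_stepProduct (hΓ : LHF Γ) : LHF (StepProduct f) := by
  obtain ⟨T⟩ := exists_stepTree f
  have hker : LHF f.ker := LHF.of_injective f.ker.subtype_injective hΓ
  have hbase : LHF (PushoutI.base (stepEmbedding f)).range :=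
    LHF.range (PushoutI.base_injective (stepEmbedding_injective f)) hker
  have hcoset : ∀ {K : Subgroup (StepProduct f)} (x : StepProduct f ⧸ K), LHF K →
      LHF (MulAction.stabilizer (StepProduct f) x) := by
    intro K x hK
    obtain ⟨θ, hθ⟩ := exists_injective_stabilizer K x
    exact LHF.of_injective hθ hK
  refine LHF.of_tree T ?_ ?_
  · rintro (x | ⟨_ | _, x⟩)
    · exact LHF.of_injective (Subgroup.inclusion_injective (stabilizer_inl_le x)) (hcoset x hbase)
    · exact LHF.of_injective (Subgroup.inclusion_injective
        ((stabilizer_inr_le _).trans (stabilizer_sigma_le _ _)))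
          (hcoset x (LHF.range (stepIncl_injective f) hΓ))
    · exact LHF.of_injective (Subgroup.inclusion_injective
        ((stabilizer_inr_le _).trans (stabilizer_sigma_le _ _)))
          (hcoset x (LHF.range (stepMitosis_injective f) (lhf_mitosis hker)))
  · rintro ⟨b, x⟩
    exact LHF.of_injective (Subgroup.inclusion_injective (stabilizer_sigma_le _ _))
      (hcoset x hbase)

theorem finite_quotient_ker {G : Type*} [Group G] [Finite Q] (F : G →* Q) : Finite (G ⧸ F.ker) :=
  Finite.of_injective _ (QuotientGroup.kerLift_injective F)

/-- A stabilizer in the Bass-Serre tree either lies in the kernel, where projectivity passes to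
subgroups, or is conjugate into the copy of `Γ`, where the hypothesis on `f` applies. -/
theorem liftsProjective_stepHom [Finite Q] (hf : LiftsProjective f.ker) :
    LiftsProjective (stepHom f).ker := by
  obtain ⟨T⟩ := exists_stepTree f
  have := finite_quotient_ker (stepHom f)
  have hle : ∀ {K S : Subgroup (StepProduct f)} {M : Type u} [AddCommGroup M]
      {ρ : Representation ℤ (StepProduct f) M}, S ≤ K → LiftProj (ρ.comp K.subtype) →
      LiftProj (ρ.comp S.subtype) := fun hSK h =>
    h.comp_injective (Subgroup.inclusion_injective hSK)
  refine T.liftsProjective ?_ ?_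
  · rintro (x | ⟨_ | _, x⟩) M _ ρ hρ
    · exact hle (stabilizer_inl_le x) (LiftProj.stabilizer_coset (hle (base_range_le_ker f) hρ) x)
    · refine hle ((stabilizer_inr_le _).trans (stabilizer_sigma_le _ _))
        (LiftProj.stabilizer_coset (LiftProj.range (stepIncl_injective f) (hf M _ ?_)) x)
      let θ : f.ker →* (stepHom f).ker := ((stepIncl f).comp f.ker.subtype).codRestrict _ fun x =>
        (stepHom_stepIncl f x).trans x.2
      have hθ : Function.Injective θ := fun x y h =>
        Subtype.ext (stepIncl_injective f (congrArg Subtype.val h))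
      exact hρ.comp_injective hθ
    · exact hle ((stabilizer_inr_le _).trans (stabilizer_sigma_le _ _))
        (LiftProj.stabilizer_coset (hle (stepMitosis_range_le_ker f) hρ) x)
  · rintro ⟨b, x⟩ M _ ρ hρ
    exact hle (stabilizer_sigma_le _ _)
      (LiftProj.stabilizer_coset (hle (base_range_le_ker f) hρ) x)

/-- The kernel of `f` is centralized by a copy of itself that is conjugate to the diagonal. -/
theorem exists_mitosis : ∃ (φ : f.ker →* StepProduct f) (g : StepProduct f),
    (∀ a b : f.ker, stepIncl f a * φ b = φ b * stepIncl f a) ∧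
    (∀ k : f.ker, g * (stepIncl f k * φ k) * g⁻¹ = φ k) ∧
    (∀ k, stepHom f (φ k) = 1) ∧ stepHom f g = 1 := by
  refine ⟨(stepMitosis f).comp (mitosisTail f.ker),
    stepMitosis f (SemidirectProduct.inr (Multiplicative.ofAdd 1)), fun a b => ?_, fun k => ?_,
    fun k => stepHom_stepMitosis f _, stepHom_stepMitosis f _⟩
  · rw [← stepMitosis_mitosisSingle, MonoidHom.comp_apply, ← map_mul, ← map_mul,
      mitosisSingle_mul_mitosisTail]
  · rw [← stepMitosis_mitosisSingle, MonoidHom.comp_apply, ← map_inv, ← map_mul, ← map_mul,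
      ← map_mul, conj_mitosisSingle_mul_mitosisTail]

end Step

/-! ### Unions of sequences of groups -/

section Union

variable {Γ : ℕ → Type u} [∀ n, Group (Γ n)]

/-- The composites of a sequence of homomorphisms. -/
def transition (s : ∀ n, Γ n →* Γ (n + 1)) (i j : ℕ) (h : i ≤ j) : Γ i →* Γ j :=
  Nat.leRec (motive := fun j _ => Γ i →* Γ j) (MonoidHom.id _) (fun j _ t => (s j).comp t) h

theorem transition_self (s : ∀ n, Γ n →* Γ (n + 1)) (i : ℕ) :
    transition s i i le_rfl = MonoidHom.id _ :=
  Nat.leRec_self _ _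

theorem transition_succ (s : ∀ n, Γ n →* Γ (n + 1)) {i j : ℕ} (h : i ≤ j) :
    transition s i (j + 1) (h.trans j.le_succ) = (s j).comp (transition s i j h) :=
  Nat.leRec_succ _ _ _

theorem transition_transition (s : ∀ n, Γ n →* Γ (n + 1)) {i j k : ℕ} (h : i ≤ j) (h' : j ≤ k)
    (x : Γ i) : transition s j k h' (transition s i j h x) = transition s i k (h.trans h') x := by
  induction k, h' using Nat.le_induction with
  | base => rw [transition_self]; rfl
  | succ k hk ih =>
    rw [transition_succ s hk, transition_succ s (h.trans hk)]
    exact congrArg (s k) ih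

instance (s : ∀ n, Γ n →* Γ (n + 1)) : DirectedSystem Γ fun i j h => transition s i j h where
  map_self i x := by rw [transition_self]; rfl
  map_map k j i hij hjk x := transition_transition s hij hjk x

theorem transition_injective {s : ∀ n, Γ n →* Γ (n + 1)} (hs : ∀ n, Function.Injective (s n))
    (i j : ℕ) (h : i ≤ j) : Function.Injective (transition s i j h) := by
  induction j, h using Nat.le_induction with
  | base => rw [transition_self]; exact fun _ _ h => h
  | succ j hj ih => rw [transition_succ s hj]; exact (hs j).comp ih

theorem transition_compatible {Q : Type*} [Group Q] {s : ∀ n, Γ n →* Γ (n + 1)} {f : ∀ n, Γ n →* Q}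
    (hf : ∀ n x, f (n + 1) (s n x) = f n x) (i j : ℕ) (h : i ≤ j) (x : Γ i) :
    f i x = f j (transition s i j h x) := by
  induction j, h using Nat.le_induction with
  | base => rw [transition_self]; rfl
  | succ j hj ih => rw [transition_succ s hj]; exact ih.trans (hf j _).symm

theorem exists_union {Q : Type*} [Group Q] {s : ∀ n, Γ n →* Γ (n + 1)}
    (hs : ∀ n, Function.Injective (s n)) {f : ∀ n, Γ n →* Q}
    (hf : ∀ n x, f (n + 1) (s n x) = f n x) :
    ∃ (G : Type u) (_ : Group G) (ι : ∀ n, Γ n →* G) (F : G →* Q),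
      (∀ n, Function.Injective (ι n)) ∧ (∀ n x, ι (n + 1) (s n x) = ι n x) ∧
      (∀ g, ∃ n x, ι n x = g) ∧ ∀ n x, F (ι n x) = f n x := by
  let ι : ∀ n, Γ n →* DirectLimit Γ (transition s) := fun n =>
    MonoidHom.mk' (fun x => ⟦⟨n, x⟩⟧) fun x y => (DirectLimit.mul_def (f := transition s) n x y).symm
  let F : DirectLimit Γ (transition s) →* Q :=
    MonoidHom.mk' (DirectLimit.lift _ (fun n x => f n x) (transition_compatible hf)) fun x y =>
      DirectLimit.lift_mul (f := transition s) f (transition_compatible hf) x y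
  refine ⟨DirectLimit Γ (transition s), inferInstance, ι, F,
    DirectLimit.mk_injective _ (transition_injective hs), fun n x => ?_, fun g => ?_,
    fun n x => rfl⟩
  · have h := DirectLimit.mk_apply (f := transition s) n (n + 1) x n.le_succ
    rw [transition_succ s le_rfl, transition_self] at h
    exact h
  · obtain ⟨n, x, rfl⟩ := DirectLimit.exists_eq_mk _ g
    exact ⟨n, x, rfl⟩

end Union

/-! ### The tower -/

section Tower

/-- A group with a homomorphism to `Q`. -/
structure GroupOver (Q : Type u) [Group Q] where
  /-- The group. -/
  carrier : Type u
  [group : Group carrier]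
  /-- The homomorphism. -/
  hom : carrier →* Q

attribute [instance] GroupOver.group

variable {Γ Q : Type u} [Group Γ] [Group Q]

/-- The groups over `Q` that are obtained from `f` by repeated amalgamation with a mitosis. -/
def tower (f : Γ →* Q) : ℕ → GroupOver Q
  | 0 => ⟨Γ, f⟩
  | n + 1 => ⟨StepProduct (tower f n).hom, stepHom (tower f n).hom⟩

theorem exists_tower (f : Γ →* Q) : ∃ (G : Type u) (_ : Group G)
    (ι : ∀ n, (tower f n).carrier →* G) (F : G →* Q), (∀ n, Function.Injective (ι n)) ∧
      (∀ n x, ι (n + 1) (stepIncl (tower f n).hom x) = ι n x) ∧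
      (∀ g, ∃ n x, ι n x = g) ∧ ∀ n x, F (ι n x) = (tower f n).hom x :=
  exists_union (Γ := fun n => (tower f n).carrier) (s := fun n => stepIncl (tower f n).hom)
    (fun n => stepIncl_injective (tower f n).hom) (f := fun n => (tower f n).hom)
    fun n => stepHom_stepIncl (tower f n).hom

theorem mooreCondition_tower {f : Γ →* Q} (hf : MooreCondition f.ker) (n : ℕ) :
    MooreCondition (tower f n).hom.ker := by
  induction n with
  | zero => exact hf
  | succ n ih => exact mooreCondition_stepHom _ ih

theorem liftsProjective_tower [Finite Q] {f : Γ →* Q} (hf : LiftsProjective f.ker) (n : ℕ) :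
    LiftsProjective (tower f n).hom.ker := by
  induction n with
  | zero => exact hf
  | succ n ih => exact liftsProjective_stepHom _ ih

theorem lhf_tower (f : Γ →* Q) (hΓ : LHF Γ) (n : ℕ) : LHF (tower f n).carrier := by
  induction n with
  | zero => exact hΓ
  | succ n ih => exact lhf_stepProduct _ ih

variable {f : Γ →* Q} {G : Type u} [Group G] {ι : ∀ n, (tower f n).carrier →* G} {F : G →* Q}

theorem monotone_range (hι : ∀ n x, ι (n + 1) (stepIncl (tower f n).hom x) = ι n x) :
    Monotone fun n => (ι n).range := by
  refine monotone_nat_of_le_succ fun n => ?_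
  rintro _ ⟨x, rfl⟩
  exact ⟨_, hι n x⟩

theorem mooreCondition_union (hinj : ∀ n, Function.Injective (ι n))
    (hsurj : ∀ g, ∃ n x, ι n x = g) (hF : ∀ n x, F (ι n x) = (tower f n).hom x)
    (hf : MooreCondition f.ker) : MooreCondition F.ker := by
  intro g hg hprime
  obtain ⟨n, x, rfl⟩ := hsurj g
  rw [orderOf_injective (ι n) (hinj n)] at hprime
  exact mooreCondition_tower hf n x (fun h => hg ((hF n x).trans h)) hprime

/-- In the tree of the ascending union each stabilizer is contained in a conjugate of some stage, so
the result for the stages passes to the union. -/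
theorem liftsProjective_union [Finite Q] (hinj : ∀ n, Function.Injective (ι n))
    (hι : ∀ n x, ι (n + 1) (stepIncl (tower f n).hom x) = ι n x)
    (hsurj : ∀ g, ∃ n x, ι n x = g) (hF : ∀ n x, F (ι n x) = (tower f n).hom x)
    (hf : LiftsProjective f.ker) : LiftsProjective F.ker := by
  have := finite_quotient_ker F
  have key : ∀ (x : Σ n, G ⧸ (ι n).range) (M : Type u) [AddCommGroup M]
      (ρ : Representation ℤ G M), LiftProj (ρ.comp F.ker.subtype) →
      LiftProj (ρ.comp (MulAction.stabilizer G x).subtype) := by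
    rintro ⟨n, x⟩ M _ ρ hρ
    let θ : (tower f n).hom.ker →* F.ker := ((ι n).comp (Subgroup.subtype _)).codRestrict _ fun x =>
      (hF n x).trans x.2
    have hθ : Function.Injective θ := fun x y h =>
      Subtype.ext (hinj n (congrArg Subtype.val h))
    exact (LiftProj.stabilizer_coset (LiftProj.range (hinj n)
      (liftsProjective_tower hf n M _ (hρ.comp_injective hθ))) x).comp_injective
        (Subgroup.inclusion_injective
          (stabilizer_sigma_le (X := fun n => G ⧸ (ι n).range) n x))
  exact (TreeAction.ascending (monotone_range hι) hsurj).liftsProjective key key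

theorem lhf_union (hinj : ∀ n, Function.Injective (ι n))
    (hι : ∀ n x, ι (n + 1) (stepIncl (tower f n).hom x) = ι n x)
    (hsurj : ∀ g, ∃ n x, ι n x = g) (hΓ : LHF Γ) : LHF G :=
  LHF.of_ascending (monotone_range hι) hsurj fun n => LHF.range (hinj n) (lhf_tower f hΓ n)

/-- A finite subset of the kernel already lies in the kernel at some stage `n`. The homomorphism and
the conjugating element provided by `exists_mitosis` at stage `n + 1` belong to the kernel because
the extended map is trivial on the mitosis. -/
theorem isBinate_ker_union (hinj : ∀ n, Function.Injective (ι n))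
    (hι : ∀ n x, ι (n + 1) (stepIncl (tower f n).hom x) = ι n x)
    (hsurj : ∀ g, ∃ n x, ι n x = g) (hF : ∀ n x, F (ι n x) = (tower f n).hom x) :
    WordComplex.IsBinate F.ker := by
  intro S
  have hmono := monotone_range hι
  obtain ⟨n, hn⟩ : ∃ n, ∀ s ∈ S, (s : G) ∈ (ι n).range := by
    choose m y hm using hsurj
    refine ⟨S.sup fun s => m s, fun s hs => ?_⟩
    exact hmono (Finset.le_sup (f := fun s : F.ker => m s) hs) ⟨y s, hm s⟩
  obtain ⟨φ, g, hcomm, hconj, hφ, hg⟩ := exists_mitosis (tower f n).hom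
  obtain ⟨j, hj, hFj⟩ : ∃ j : StepProduct (tower f n).hom →* G,
      (∀ x, j (stepIncl (tower f n).hom x) = ι n x) ∧ ∀ x, F (j x) = stepHom (tower f n).hom x :=
    ⟨ι (n + 1), hι n, hF (n + 1)⟩
  let θ : (tower f n).hom.ker →* F.ker := ((ι n).comp (Subgroup.subtype _)).codRestrict _ fun x =>
    (hF n x).trans x.2
  have hθ : Function.Injective θ := fun x y h =>
    Subtype.ext (hinj n (congrArg Subtype.val h))
  let ψ : (tower f n).hom.ker →* F.ker := (j.comp φ).codRestrict _ fun x =>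
    (hFj _).trans (hφ x)
  let e := MonoidHom.ofInjective hθ
  have he : ∀ k : θ.range, ((k : F.ker) : G) = j (stepIncl (tower f n).hom (e.symm k)) := by
    intro k
    have h := congrArg Subtype.val (MonoidHom.apply_ofInjective_symm hθ k)
    exact (h.symm.trans (hj _).symm)
  refine ⟨θ.range, ψ.comp e.symm.toMonoidHom, ⟨j g, (hFj g).trans hg⟩,
    fun s hs => ?_, fun a b => Subtype.ext ?_, fun k => Subtype.ext ?_⟩
  · obtain ⟨x, hx⟩ := hn s hs
    refine ⟨⟨x, ?_⟩, Subtype.ext hx⟩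
    rw [MonoidHom.mem_ker, ← hF, hx]
    exact s.2
  · change (a : G) * j (φ (e.symm b)) = j (φ (e.symm b)) * (a : G)
    rw [he, ← map_mul, hcomm, map_mul]
  · change j g * ((k : G) * j (φ (e.symm k))) * (j g)⁻¹ =
      j (φ (e.symm k))
    rw [he, ← map_mul, ← map_inv, ← map_mul, ← map_mul, hconj]

end Tower

/-! ### The theorem -/

theorem mainTheorem6 {Γ₀ : Type u} [Group Γ₀] (H₀ : Subgroup Γ₀) [H₀.Normal]
    (hH₀ : H₀.index.Prime) :
    ∃ (Γ : Type u) (_ : Group Γ) (H : Subgroup Γ) (_ : H.Normal) (φ : Γ₀ →* Γ),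
      H.index.Prime ∧
      (AcyclicGroup H ∧ ¬ BocksteinNilpotent H) ∧
      (Function.Injective φ ∧ H₀ = H.comap φ ∧
        ∃ h : H₀ ≤ H.comap φ, Function.Bijective (QuotientGroup.map H₀ H φ h)) ∧
      (MooreCondition H ↔ MooreCondition H₀) ∧
      (MooreConjecture H ↔ MooreConjecture H₀) ∧
      (LHF Γ ↔ LHF Γ₀) := by
  have hfin : Finite (Γ₀ ⧸ H₀) := Nat.finite_of_card_ne_zero hH₀.ne_zero
  obtain ⟨f, hf, hsurj₀⟩ : ∃ f : Γ₀ →* Γ₀ ⧸ H₀, f.ker = H₀ ∧ Function.Surjective f :=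
    ⟨QuotientGroup.mk' H₀, QuotientGroup.ker_mk' H₀, QuotientGroup.mk'_surjective H₀⟩
  obtain ⟨Γ, _, ι, F, hinj, hι, hsurj, hF⟩ := exists_tower f
  obtain ⟨φ, hφ, hFφ⟩ : ∃ φ : Γ₀ →* Γ, Function.Injective φ ∧ ∀ x, F (φ x) = f x :=
    ⟨ι 0, hinj 0, hF 0⟩
  have hcomap : H₀ = F.ker.comap φ := by
    refine hf.symm.trans (Subgroup.ext fun x => ?_)
    rw [Subgroup.mem_comap, MonoidHom.mem_ker, MonoidHom.mem_ker, hFφ]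
  have hFsurj : Function.Surjective F := fun q => by
    obtain ⟨x, rfl⟩ := hsurj₀ q
    exact ⟨φ x, hFφ x⟩
  have hindex : F.ker.index.Prime := by
    rw [Subgroup.index_ker, MonoidHom.range_eq_top.2 hFsurj, Subgroup.card_top]
    exact hH₀
  have := finite_quotient_ker F
  have hbinate := isBinate_ker_union hinj hι hsurj hF
  have hcondition : MooreCondition F.ker ↔ MooreCondition H₀ := by
    refine ⟨fun h g hg hprime => h (φ g) (fun hg' => hg ?_) ?_, fun h => ?_⟩
    · rw [hcomap]
      exact hg'
    · rwa [orderOf_injective φ hφ]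
    · exact mooreCondition_union hinj hsurj hF (by rwa [hf])
  have hlifts : LiftsProjective F.ker ↔ LiftsProjective H₀ := by
    refine ⟨fun h => ?_, fun h => liftsProjective_union hinj hι hsurj hF (by rwa [hf])⟩
    rw [hcomap]
    exact h.comap hφ
  refine ⟨Γ, inferInstance, F.ker, inferInstance, φ, hindex,
    ⟨acyclicGroup_of_isBinate hbinate, not_bocksteinNilpotent_of_ext_eq_zero hindex
      (WordComplex.ext_quotientModule_eq_zero hbinate)⟩,
    ⟨hφ, hcomap, hcomap.le, ?_, fun q => ?_⟩, hcondition, ?_,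
    fun h => LHF.of_injective hφ h, lhf_union hinj hι hsurj⟩
  · rw [← MonoidHom.ker_eq_bot_iff, QuotientGroup.ker_map, ← hcomap, QuotientGroup.map_mk'_self]
  · induction q using QuotientGroup.induction_on with
    | H g =>
      obtain ⟨x, hx⟩ := hsurj₀ (F g)
      refine ⟨(x : Γ₀ ⧸ H₀), ?_⟩
      rw [QuotientGroup.map_mk, QuotientGroup.eq, MonoidHom.mem_ker, map_mul, map_inv, hFφ, hx,
        inv_mul_cancel]
  · rw [mooreConjecture_iff, mooreConjecture_iff, hcondition, hlifts]
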